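/- Let $p$ be an odd prime, $k$ a finite field of characteristic $p$ with algebraic closure $\bar k$, $\overline{\mathbf Q}_p$ an algebraic closure of $\mathbf Q_p$ and $\mathscr G_{\mathbf Q_p}=\operatorname{Gal}(\overline{\mathbf Q}_p/\mathbf Q_p)$. Let $\mathbf Q_{p^4}=\mathbf Q_p(\mu_{p^4-1})\subset\overline{\mathbf Q}_p$ be the unramified extension of degree $4$, and let $\omega_4\colon\mathscr G_{\mathbf Q_{p^4}}\to\mathbf F_{p^4}^\times$ be the fundamental character of level $4$ given by $g(\pi)=\omega_4(g)\pi$ for any $\pi$ with $\pi^{p^4-1}=-p$ (identifying $\mu_{p^4-1}(\overline{\mathbf Q}_p)$ with $\mathbf F_{p^4}^\times$ by reduction). Fix an embedding of the residue field of $\overline{\mathbf Q}_p$ into $\bar k$, and use it to regard $\omega_4$ as a $\bar k^\times$-valued character. Let $\omega\colon\mathscr G_{\mathbf Q_p}\to\mathbf F_p^\times\subset k^\times$ be the mod-$p$ cyclotomic character. For an integer $h$ put $$I(h)=\operatorname{Ind}_{\mathscr G_{\mathbf Q_{p^4}}}^{\mathscr G_{\mathbf Q_p}}\bigl(\omega_4^{\frac{p^2+1}{2}h}\bigr),$$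 a representation on a $\bar k$-vector space. A representation is called smooth if all stabilizers of vectors are open, and a character is smooth if its kernel is open. (i) For every odd integer $h$ with $1\le h\le 2(p^2-1)$ there is a smooth, absolutely irreducible $4$-dimensional representation $\rho$ of $\mathscr G_{\mathbf Q_p}$ over $k$ with $\rho\cong\rho\otimes\omega^{\frac{p-1}{2}}$ and $\bar k\otimes_k\rho\cong I(h)$. (ii) Let $\rho$ be a smooth representation of $\mathscr G_{\mathbf Q_p}$ on a $4$-dimensional $k$-vector space. Then $\rho$ is absolutely irreducible and satisfies $\rho\cong\rho\otimes\omega^{\frac{p-1}{2}}$ if and only if there are a smooth character $\chi\colon\mathscr G_{\mathbf Q_p}\to\bar k^\times$ and an odd integer $h$ with $1\le h\le 2(p^2-1)$ such that $\bar k\otimes_k\rho\cong\chi\otimes I(h)$. -/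

import Mathlib

open scoped TensorProduct

noncomputable section

namespace ModpGalois

/-! ### Linear representations of a topological group -/

section Representations

variable {F G V : Type*} [Field F] [Group G] [AddCommGroup V] [Module F V]

/-- A representation is smooth if the stabilizer of every vector is open. -/
def IsSmooth [TopologicalSpace G] (ρ : Representation F G V) : Prop :=
  ∀ v : V, IsOpen {g : G | ρ g v = v}

/-- A character with values in `Fˣ` is smooth if its kernel is open. -/
def IsSmoothChar [TopologicalSpace G] (χ : G →* Fˣ) : Prop :=
  IsOpen (χ.ker : Set G)

/-- The twist `χ ⊗ ρ`, i.e. `g ↦ χ(g) ρ(g)`. -/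
def twist (χ : G →* Fˣ) (ρ : Representation F G V) : Representation F G V where
  toFun g := (χ g : F) • ρ g
  map_one' := by simp
  map_mul' g h := by
    ext v
    simp [mul_smul, smul_comm (χ g : F) (χ h : F)]

/-- The extension of scalars `E ⊗_F ρ` of a representation. -/
def baseChange (E : Type*) [Field E] [Algebra F E] (ρ : Representation F G V) :
    Representation E G (E ⊗[F] V) :=
  (Module.End.baseChangeHom F E V : Module.End F V →* Module.End E (E ⊗[F] V)).comp ρ

/-- A representation over `F` is absolutely irreducible if it is irreducible over an algebraic
closure of `F`. -/
def IsAbsolutelyIrreducible (ρ : Representation F G V) : Prop :=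
  (baseChange (AlgebraicClosure F) ρ).IsIrreducible

/-- The one-dimensional representation attached to a character. -/
def charRep (χ : G →* Fˣ) : Representation F G F :=
  twist χ (Representation.trivial F G F)

/-- The space of the representation induced from a character `ψ` of a subgroup `H`:
functions `f : G → F` with `f (h g) = ψ(h) f(g)`. -/
abbrev IndSpace (H : Subgroup G) (ψ : H →* Fˣ) : Type _ :=
  Representation.coindV H.subtype (charRep ψ)

/-- The induced representation `Ind_H^G ψ`, with `G` acting by right translation. When `H` is open
of finite index and `ψ` is smooth, every function in `IndSpace H ψ` has open stabilizer, so this is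
the smooth induction. -/
abbrev ind (H : Subgroup G) (ψ : H →* Fˣ) : Representation F G (IndSpace H ψ) :=
  Representation.coind H.subtype (charRep ψ)

end Representations

/-! ### The absolute Galois group of `ℚ_p` -/

variable (p : ℕ) [Fact p.Prime]

/-- The fixed algebraic closure of `ℚ_p`. -/
abbrev QpBar : Type := AlgebraicClosure ℚ_[p]

/-- The absolute Galois group of `ℚ_p`, with its Krull topology. -/
abbrev GalQp : Type := QpBar p ≃ₐ[ℚ_[p]] QpBar p

/-- The ring of integers of the algebraic closure of `ℚ_p`. -/
abbrev ZpBar : Subalgebra ℤ_[p] (QpBar p) := integralClosure ℤ_[p] (QpBar p)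

/-- The unramified extension `ℚ_{p^n}` of degree `n` of `ℚ_p`, i.e. `ℚ_p(μ_{p^n-1})`. -/
def unramified (n : ℕ) : IntermediateField ℚ_[p] (QpBar p) :=
  IntermediateField.adjoin ℚ_[p] {ζ : QpBar p | ζ ^ (p ^ n - 1) = 1}

/-- The absolute Galois group of `ℚ_{p^n}`, as a subgroup of that of `ℚ_p`. -/
abbrev GalUnram (n : ℕ) : Subgroup (GalQp p) := (unramified p n).fixingSubgroup

lemma pow_sub_one_pos (n : ℕ) [NeZero n] : 0 < p ^ n - 1 :=
  Nat.sub_pos_of_lt (Nat.one_lt_pow (NeZero.ne n) (Fact.out : p.Prime).one_lt)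

lemma exists_kummerRoot (n : ℕ) [NeZero n] :
    ∃ π : QpBar p, π ^ (p ^ n - 1) = -(p : QpBar p) :=
  IsAlgClosed.exists_pow_nat_eq _ (pow_sub_one_pos p n)

/-- A chosen `(p^n-1)`-st root of `-p`. -/
def kummerRoot (n : ℕ) [NeZero n] : QpBar p := (exists_kummerRoot p n).choose

lemma kummerRoot_pow (n : ℕ) [NeZero n] :
    kummerRoot p n ^ (p ^ n - 1) = -(p : QpBar p) := (exists_kummerRoot p n).choose_spec

lemma neg_p_ne_zero : -(p : QpBar p) ≠ 0 :=
  neg_ne_zero.mpr (Nat.cast_ne_zero.mpr (Fact.out : p.Prime).ne_zero)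

lemma ne_zero_of_pow_eq {n : ℕ} [NeZero n] {π : QpBar p}
    (h : π ^ (p ^ n - 1) = -(p : QpBar p)) : π ≠ 0 := by
  rintro rfl
  rw [zero_pow (pow_sub_one_pos p n).ne'] at h
  exact neg_p_ne_zero p h.symm

lemma div_pow_eq_one {n : ℕ} [NeZero n] {x y : QpBar p}
    (hx : x ^ (p ^ n - 1) = -(p : QpBar p)) (hy : y ^ (p ^ n - 1) = -(p : QpBar p)) :
    (x / y) ^ (p ^ n - 1) = 1 := by
  rw [div_pow, hx, hy, div_self (neg_p_ne_zero p)]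

lemma apply_pow_eq {n : ℕ} {π : QpBar p} (h : π ^ (p ^ n - 1) = -(p : QpBar p)) (g : GalQp p) :
    (g π) ^ (p ^ n - 1) = -(p : QpBar p) := by
  rw [← map_pow, h]; simp

lemma galUnram_fix {n : ℕ} (g : GalUnram p n) {ζ : QpBar p} (h : ζ ^ (p ^ n - 1) = 1) :
    (g : GalQp p) ζ = ζ :=
  (IntermediateField.mem_fixingSubgroup_iff _ _).mp g.2 ζ (IntermediateField.subset_adjoin _ _ h)

/-- Serre's fundamental character of level `n` attached to the uniformizer `-p`, namely
`g ↦ g(π)/π` with `π^{p^n-1} = -p`, valued in `μ_{p^n-1}` inside the ring of integers `ZpBar p`.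
Composing with the reduction modulo the maximal ideal, which maps `μ_{p^n-1}` isomorphically
onto `𝔽_{p^n}ˣ`, gives the fundamental character with values in `𝔽_{p^n}ˣ`. -/
def fundCharLift (n : ℕ) [NeZero n] : GalUnram p n →* (ZpBar p)ˣ :=
  MonoidHom.toHomUnits
    { toFun := fun g =>
        ⟨(g : GalQp p) (kummerRoot p n) / kummerRoot p n,
          IsIntegral.of_pow (pow_sub_one_pos p n) (by
            rw [div_pow_eq_one p (apply_pow_eq p (kummerRoot_pow p n) g) (kummerRoot_pow p n)]
            exact isIntegral_one)⟩
      map_one' := by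
        apply Subtype.ext
        simp [div_self (ne_zero_of_pow_eq p (kummerRoot_pow p n))]
      map_mul' := by
        intro g h
        apply Subtype.ext
        have h0 := ne_zero_of_pow_eq p (kummerRoot_pow p n)
        have h1 := galUnram_fix p g
          (div_pow_eq_one p (apply_pow_eq p (kummerRoot_pow p n) h) (kummerRoot_pow p n))
        have h2 : (g : GalQp p) (kummerRoot p n) ≠ 0 := by simpa using h0
        rw [map_div₀, div_eq_iff h2] at h1
        simp only [AlgEquiv.mul_apply, MulMemClass.coe_mul]
        rw [h1]
        field_simp }

/-- The defining property of the fundamental character, for every choice of the root of `-p`. -/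
lemma fundCharLift_spec (n : ℕ) [NeZero n] (g : GalUnram p n) (π : QpBar p)
    (hπ : π ^ (p ^ n - 1) = -(p : QpBar p)) :
    (g : GalQp p) π = (((fundCharLift p n g : (ZpBar p)ˣ) : ZpBar p) : QpBar p) * π := by
  have h0 := ne_zero_of_pow_eq p (kummerRoot_pow p n)
  have h1 := galUnram_fix p g (div_pow_eq_one p hπ (kummerRoot_pow p n))
  have h2 : (g : GalQp p) (kummerRoot p n) ≠ 0 := by simpa using h0
  rw [map_div₀, div_eq_iff h2] at h1
  change (g : GalQp p) π = (g : GalQp p) (kummerRoot p n) / kummerRoot p n * π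
  rw [h1]
  field_simp

/-- The fundamental character `ω_n` of level `n` with values in a field `E` of characteristic `p`.
Here `ι : ZpBar p → E` is a ring homomorphism, i.e. reduction modulo the maximal ideal of `ZpBar p`
followed by an embedding of the residue field (which contains `𝔽_{p^n}`) into `E`. -/
def fundChar {E : Type*} [Field E] (ι : ZpBar p →+* E) (n : ℕ) [NeZero n] :
    GalUnram p n →* Eˣ :=
  (Units.map (ι : ZpBar p →* E)).comp (fundCharLift p n)

lemma card_rootsOfUnity_p : Nat.card (rootsOfUnity p (QpBar p)) = p :=
  haveI : NeZero (p : QpBar p) := ⟨Nat.cast_ne_zero.mpr (Fact.out : p.Prime).ne_zero⟩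
  HasEnoughRootsOfUnity.natCard_rootsOfUnity (QpBar p) p

/-- The mod-`p` cyclotomic character `ω` of the absolute Galois group of `ℚ_p`, with values in a
field `k` of characteristic `p`: one has `g ζ = ζ ^ ω(g)` for all `ζ` with `ζ ^ p = 1`. -/
def cyclo (k : Type*) [Field k] [CharP k p] : GalQp p →* kˣ :=
  (Units.map (ZMod.castHom dvd_rfl k : ZMod p →* k)).comp
    ((modularCyclotomicCharacter (QpBar p) (card_rootsOfUnity_p p)).comp
      (MulSemiringAction.toRingAut (GalQp p) (QpBar p)))

end ModpGalois

end

/-! Write E for the algebraic closure of k, Φ for a Frobenius, η for ω^((p-1)/2) and ψ for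
ω_4^((p²+1)/2·h) with h odd. Inertia and Frobenius are defined by their action on residues through
`ι`. An open subgroup containing both is the whole group (`IsFrobenius.eq_top`), so invariance need
only be checked on them. The tame characters of inertia are surjective
(`exists_inertia_resChar_eq`), and ω is the fundamental character of level one (`cyclo_eq_resChar`),
so η restricts to ω_4^((p^4-1)/2).

Since p^4-1 = 2·((p²+1)/2)·(p²-1) and h is odd, ψ^(p²) = ηψ. Conjugation by Φ raises ω_4 to the p-th
power, so translation by Φ² intertwines the induced representation with its η-twist
(`exists_ind_twist_map`). The character ηψ also differs from ψ, so the four conjugates of ψ are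
distinct on inertia. An eigenvector of inertia and its Frobenius translates then fill the space,
which gives irreducibility and dimension four (`ind_invariant_eq_top`).

For a model over k, the functions attached by `indOfInteger` to integers of the unramified field
form a Galois-stable 𝔽_p-space of order at most p^4. Its k-span has dimension at most four and, by
irreducibility, generates the whole space over E (`exists_smooth_model`). An intertwiner with the
twist over E descends to k by applying a linear form on E (`nonempty_equiv_twist_of_baseChange`).

Conversely, wild elements act through a p-group on a finite space of characteristic p, hence
trivially by irreducibility (`wild_apply_eq_self`). Inertia then acts through powers of one operator
σ(τ₀), whose eigenvalues form a single Frobenius orbit l, l^p, l^(p²), l^(p³) of length four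
(`exists_eigenbasis`). As η(τ₀) = -1, invariance under the twist puts -l in the orbit. The only
possibility is l^(p²) = -l (`pow_sq_eq_neg`), which makes l a value of ψ for an odd h
(`exists_odd_exponent`). An unramified twist adjusts the action of Φ^4, and Frobenius reciprocity
concludes (`exists_equiv_twist_ind`). -/

noncomputable section

namespace ModpGalois

/-! ### The integral closure as a unit ball -/

section Norm

variable {p : ℕ} [Fact p.Prime]

lemma norm_gal (g : GalQp p) (x : QpBar p) : ‖g x‖ = ‖x‖ :=
  (spectralNorm_eq_of_equiv g x).symm

lemma norm_algebraMap_qp (x : ℚ_[p]) : ‖algebraMap ℚ_[p] (QpBar p) x‖ = ‖x‖ :=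
  PadicAlgCl.norm_extends p x

lemma norm_prime_qpBar : ‖(p : QpBar p)‖ = (p : ℝ)⁻¹ := by
  rw [← map_natCast (algebraMap ℚ_[p] (QpBar p)), norm_algebraMap_qp, Padic.norm_p]

lemma norm_natCast_le_one (n : ℕ) : ‖(n : QpBar p)‖ ≤ 1 := by
  rw [← map_natCast (algebraMap ℚ_[p] (QpBar p)), norm_algebraMap_qp]
  exact_mod_cast Padic.norm_int_le_one n

/-- The spectral norm is at most one exactly when all coefficients of the minimal polynomial are. As
ℤ_p is integrally closed, this is integrality of x. -/
lemma mem_zpBar_iff {x : QpBar p} : x ∈ ZpBar p ↔ ‖x‖ ≤ 1 := by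
  have hx : IsIntegral ℚ_[p] x := Algebra.IsIntegral.isIntegral x
  have key : ‖x‖ ≤ 1 ↔ ∀ n, ‖(minpoly ℚ_[p] x).coeff n‖ ≤ 1 := by
    rw [← PadicAlgCl.spectralNorm_eq, spectralNorm, spectralValue_le_one_iff (minpoly.monic hx)]
  rw [key, mem_integralClosure_iff]
  constructor
  · intro h n
    rw [minpoly.isIntegrallyClosed_eq_field_fractions' ℚ_[p] h, Polynomial.coeff_map]
    exact PadicInt.norm_le_one _
  · intro h
    have hl : minpoly ℚ_[p] x ∈ Polynomial.lifts (algebraMap ℤ_[p] ℚ_[p]) := by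
      rw [Polynomial.lifts_iff_coeff_lifts]
      intro n
      exact ⟨⟨_, h n⟩, rfl⟩
    obtain ⟨q, hq, -, hm⟩ := Polynomial.lifts_and_natDegree_eq_and_monic hl (minpoly.monic hx)
    refine ⟨q, hm, ?_⟩
    have h2 := minpoly.aeval ℚ_[p] x
    rw [← hq, Polynomial.aeval_map_algebraMap] at h2
    exact h2

end Norm

/-! ### Reduction to the residue field -/

section Reduction

variable {p : ℕ} [Fact p.Prime] {E : Type*} [Field E] (ι : ZpBar p →+* E)

open Classical in
/-- Reduction of elements of `QpBar p` along `ι`, with the value `0` outside `ZpBar p`. -/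
def red (x : QpBar p) : E := if h : x ∈ ZpBar p then ι ⟨x, h⟩ else 0

lemma red_of_mem {x : QpBar p} (h : x ∈ ZpBar p) : red ι x = ι ⟨x, h⟩ := dif_pos h

lemma red_coe (x : ZpBar p) : red ι x = ι x := red_of_mem ι x.2

@[simp] lemma red_zero : red ι 0 = 0 := by
  rw [red_of_mem ι (zero_mem _)]
  exact map_zero ι

@[simp] lemma red_one : red ι 1 = 1 := by
  rw [red_of_mem ι (one_mem _)]
  exact map_one ι

lemma red_mul {x y : QpBar p} (hx : ‖x‖ ≤ 1) (hy : ‖y‖ ≤ 1) :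
    red ι (x * y) = red ι x * red ι y := by
  rw [← mem_zpBar_iff] at hx hy
  rw [red_of_mem ι hx, red_of_mem ι hy, red_of_mem ι (mul_mem hx hy), ← map_mul]
  rfl

lemma red_add {x y : QpBar p} (hx : ‖x‖ ≤ 1) (hy : ‖y‖ ≤ 1) :
    red ι (x + y) = red ι x + red ι y := by
  rw [← mem_zpBar_iff] at hx hy
  rw [red_of_mem ι hx, red_of_mem ι hy, red_of_mem ι (add_mem hx hy), ← map_add]
  rfl

lemma red_neg {x : QpBar p} (hx : ‖x‖ ≤ 1) : red ι (-x) = -red ι x := by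
  rw [← mem_zpBar_iff] at hx
  rw [red_of_mem ι hx, red_of_mem ι (neg_mem hx), ← map_neg]
  rfl

lemma red_sub {x y : QpBar p} (hx : ‖x‖ ≤ 1) (hy : ‖y‖ ≤ 1) :
    red ι (x - y) = red ι x - red ι y := by
  rw [sub_eq_add_neg, red_add ι hx (by rwa [norm_neg]), red_neg ι hy, sub_eq_add_neg]

lemma red_pow {x : QpBar p} (hx : ‖x‖ ≤ 1) (n : ℕ) : red ι (x ^ n) = red ι x ^ n := by
  rw [← mem_zpBar_iff] at hx
  rw [red_of_mem ι hx, red_of_mem ι (pow_mem hx n), ← map_pow]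
  rfl

lemma red_prod {α : Type*} (s : Finset α) (f : α → QpBar p) (hf : ∀ i ∈ s, ‖f i‖ ≤ 1) :
    red ι (∏ i ∈ s, f i) = ∏ i ∈ s, red ι (f i) := by
  classical
  induction s using Finset.induction_on with
  | empty => simp
  | insert a s ha ih =>
    have h2 : ‖∏ i ∈ s, f i‖ ≤ 1 := mem_zpBar_iff.mp
      (prod_mem fun i hi => mem_zpBar_iff.mpr (hf i (Finset.mem_insert_of_mem hi)))
    rw [Finset.prod_insert ha, Finset.prod_insert ha,
      red_mul ι (hf a (Finset.mem_insert_self _ _)) h2,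
      ih fun i hi => hf i (Finset.mem_insert_of_mem hi)]

lemma norm_sum_le_one {α : Type*} (s : Finset α) (f : α → QpBar p) (hf : ∀ i ∈ s, ‖f i‖ ≤ 1) :
    ‖∑ i ∈ s, f i‖ ≤ 1 :=
  mem_zpBar_iff.mp (sum_mem fun i hi => mem_zpBar_iff.mpr (hf i hi))

lemma red_sum {α : Type*} (s : Finset α) (f : α → QpBar p) (hf : ∀ i ∈ s, ‖f i‖ ≤ 1) :
    red ι (∑ i ∈ s, f i) = ∑ i ∈ s, red ι (f i) := by
  classical
  induction s using Finset.induction_on with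
  | empty => simp
  | insert a s ha ih =>
    have h2 := norm_sum_le_one s f fun i hi => hf i (Finset.mem_insert_of_mem hi)
    rw [Finset.sum_insert ha, Finset.sum_insert ha,
      red_add ι (hf a (Finset.mem_insert_self _ _)) h2,
      ih fun i hi => hf i (Finset.mem_insert_of_mem hi)]

lemma red_natCast (n : ℕ) : red ι (n : QpBar p) = n := by
  rw [red_of_mem ι (natCast_mem _ n), ← map_natCast ι]
  rfl

lemma red_inv {x : QpBar p} (hx : ‖x‖ = 1) : red ι x⁻¹ = (red ι x)⁻¹ := by
  have h0 : x ≠ 0 := by rintro rfl; simp at hx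
  refine eq_inv_of_mul_eq_one_left ?_
  rw [← red_mul ι (by rw [norm_inv, hx, inv_one]) hx.le, inv_mul_cancel₀ h0, red_one]

lemma red_ne_zero {x : QpBar p} (hx : ‖x‖ = 1) : red ι x ≠ 0 := by
  have h0 : x ≠ 0 := by rintro rfl; simp at hx
  intro h
  have h2 : red ι (x * x⁻¹) = 1 := by rw [mul_inv_cancel₀ h0, red_one]
  rw [red_mul ι hx.le (by rw [norm_inv, hx, inv_one]), h, zero_mul] at h2
  exact zero_ne_one h2

lemma red_div {x y : QpBar p} (hx : ‖x‖ ≤ 1) (hy : ‖y‖ = 1) :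
    red ι (x / y) = red ι x / red ι y := by
  rw [div_eq_mul_inv, red_mul ι hx (by rw [norm_inv, hy, inv_one]), red_inv ι hy, div_eq_mul_inv]

variable [CharP E p]

/-- If ‖x‖ < 1, some power of x is p times an integer and dies in characteristic p. If ‖x‖ = 1, x is
a unit. So the kernel of `ι` is the open unit ball. -/
lemma red_eq_zero_iff {x : QpBar p} (hx : ‖x‖ ≤ 1) : red ι x = 0 ↔ ‖x‖ < 1 := by
  refine ⟨fun h => lt_of_le_of_ne hx fun h1 => red_ne_zero ι h1 h, fun h => ?_⟩
  have hp : 0 < ‖(p : QpBar p)‖ := by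
    rw [norm_prime_qpBar]
    exact inv_pos.mpr (Nat.cast_pos.mpr (Fact.out : p.Prime).pos)
  obtain ⟨n, hn⟩ := exists_pow_lt_of_lt_one hp h
  have hp0 : (p : QpBar p) ≠ 0 := norm_pos_iff.mp hp
  have h1 : ‖x ^ n / p‖ ≤ 1 := by
    rw [norm_div, norm_pow, div_le_one hp]
    exact hn.le
  have h2 : red ι (x ^ n) = 0 := by
    rw [← mul_div_cancel₀ (x ^ n) hp0, red_mul ι (norm_natCast_le_one p) h1, red_natCast,
      CharP.cast_eq_zero, zero_mul]
  rw [red_pow ι hx] at h2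
  exact eq_zero_of_pow_eq_zero h2

lemma red_eq_red_iff {x y : QpBar p} (hx : ‖x‖ ≤ 1) (hy : ‖y‖ ≤ 1) :
    red ι x = red ι y ↔ ‖x - y‖ < 1 := by
  have h : ‖x - y‖ ≤ 1 := mem_zpBar_iff.mp (sub_mem (mem_zpBar_iff.mpr hx) (mem_zpBar_iff.mpr hy))
  rw [← red_eq_zero_iff ι h, red_sub ι hx hy, sub_eq_zero]

lemma red_div_eq_one_iff {x y : QpBar p} (hy : y ≠ 0) (hxy : ‖x‖ = ‖y‖) :
    red ι (x / y) = 1 ↔ ‖x - y‖ < ‖y‖ := by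
  have hy' : 0 < ‖y‖ := norm_pos_iff.mpr hy
  have h1 : ‖x / y‖ ≤ 1 := by rw [norm_div, hxy, div_self hy'.ne']
  rw [← red_one ι, red_eq_red_iff ι h1 (by simp), ← div_self hy, ← sub_div, norm_div,
    div_lt_one hy']

lemma norm_eq_one_of_pow_eq_one {x : QpBar p} {n : ℕ} (hn : n ≠ 0) (hx : x ^ n = 1) :
    ‖x‖ = 1 := by
  have : ‖x‖ ^ n = 1 := by rw [← norm_pow, hx, norm_one]
  exact (pow_eq_one_iff_of_nonneg (norm_nonneg _) hn).mp this

/-- Roots of unity of order prime to `p` are determined by their reduction. -/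
lemma eq_one_of_red_eq_one {x : QpBar p} {n : ℕ} (hn : ¬ p ∣ n) (hx : x ^ n = 1)
    (h : red ι x = 1) : x = 1 := by
  have hn0 : n ≠ 0 := by rintro rfl; simp at hn
  have hx1 := norm_eq_one_of_pow_eq_one hn0 hx
  by_contra hne
  -- For x ≠ 1 the geometric sum vanishes, whereas its reduction is n, which is nonzero in E.
  have h1 : ∑ i ∈ Finset.range n, x ^ i = 0 := by
    have := mul_geom_sum x n
    rw [hx, sub_self] at this
    exact (mul_eq_zero.mp this).resolve_left (sub_ne_zero.mpr hne)
  have h2 := red_sum ι (Finset.range n) (fun i => x ^ i) fun i _ => by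
    rw [norm_pow, hx1, one_pow]
  rw [h1, red_zero] at h2
  simp only [red_pow ι hx1.le, h, one_pow, Finset.sum_const, Finset.card_range, nsmul_eq_mul,
    mul_one] at h2
  exact hn ((CharP.cast_eq_zero_iff E p n).mp h2.symm)

lemma eq_of_red_eq {x y : QpBar p} {n : ℕ} (hn : ¬ p ∣ n) (hx : x ^ n = 1) (hy : y ^ n = 1)
    (h : red ι x = red ι y) : x = y := by
  have hn0 : n ≠ 0 := by rintro rfl; simp at hn
  have hx1 := norm_eq_one_of_pow_eq_one hn0 hx
  have hy1 := norm_eq_one_of_pow_eq_one hn0 hy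
  refine (div_eq_one_iff_eq (norm_ne_zero_iff.mp (by rw [hy1]; exact one_ne_zero))).mp ?_
  refine eq_one_of_red_eq_one ι hn (by rw [div_pow, hx, hy, div_one]) ?_
  rw [red_div ι hx1.le hy1, h, div_self (red_ne_zero ι hy1)]

end Reduction

/-! ### Existence of Frobenius, and Galois action on roots of unity -/

section Frobenius

variable {p : ℕ} [Fact p.Prime] {E : Type*} [Field E] [CharP E p] (ι : ZpBar p →+* E)

lemma isOpen_stabilizer_gal (x : QpBar p) : IsOpen {g : GalQp p | g x = x} :=
  stabilizer_isOpen_of_isIntegral x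

/-- There is a Galois automorphism acting as the `p`-power map on residues. -/
theorem exists_frobenius (hE : ∀ a : E, ∃ n, 0 < n ∧ a ^ p ^ n = a) :
    ∃ Φ : GalQp p, ∀ x : QpBar p, ‖x‖ ≤ 1 → red ι (Φ x) = red ι x ^ p := by
  let B := ZpBar p
  let act : MulSemiringAction (GalQp p) B :=
    IsIntegralClosure.MulSemiringAction ℤ_[p] ℚ_[p] (QpBar p) B
  have hact : ∀ (g : GalQp p) (b : B), ((g • b : B) : QpBar p) = g (b : QpBar p) := fun g b =>
    algebraMap_galRestrict_apply ℤ_[p] g b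
  let : TopologicalSpace B := ⊥
  have : DiscreteTopology B := ⟨rfl⟩
  have : SMulCommClass (GalQp p) ℤ_[p] B := ⟨fun g a b => by
    apply Subtype.ext
    rw [hact]
    change g (a • (b : QpBar p)) = a • ((g • b : B) : QpBar p)
    rw [hact, Algebra.smul_def, map_mul, Algebra.smul_def,
      IsScalarTower.algebraMap_apply ℤ_[p] ℚ_[p] (QpBar p), AlgEquiv.commutes]⟩
  have : ContinuousSMul (GalQp p) B := by
    refine (continuousSMul_iff_stabilizer_isOpen (M := GalQp p) (X := B)).mpr fun b => ?_
    convert isOpen_stabilizer_gal (b : QpBar p) using 1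
    ext g
    simp only [SetLike.mem_coe, MulAction.mem_stabilizer_iff, Set.mem_ofPred_eq, ← hact]
    exact Subtype.ext_iff
  have : Algebra.IsInvariant ℤ_[p] B (GalQp p) := ⟨fun b hb => by
    have h1 : ∀ g : GalQp p, g (b : QpBar p) = b := fun g => by rw [← hact, hb g]
    obtain ⟨y, hy⟩ := (InfiniteGalois.mem_range_algebraMap_iff_fixed (b : QpBar p)).mpr h1
    have hy1 : ‖y‖ ≤ 1 := by
      rw [← norm_algebraMap_qp, hy]
      exact mem_zpBar_iff.mp b.2
    exact ⟨⟨y, hy1⟩, Subtype.ext hy⟩⟩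
  let Q : Ideal B := RingHom.ker ι
  let P : Ideal ℤ_[p] := Q.under ℤ_[p]
  have : Q.IsPrime := RingHom.ker_isPrime ι
  have : Q.LiesOver P := ⟨rfl⟩
  let j : B ⧸ Q →+* E := RingHom.kerLift ι
  have hj : Function.Injective j := RingHom.kerLift_injective ι
  have : CharP (B ⧸ Q) p := ⟨fun n => by
    rw [← CharP.cast_eq_zero_iff E p n, ← map_natCast j, map_eq_zero_iff j hj]⟩
  -- The residue ring embeds in E, where each element satisfies a = a^(p^n) for some n > 0. This
  -- exhibits a^(p^(n-1)) as a p-th root of a.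
  have hsurj : Function.Surjective (frobenius (B ⧸ Q) p) := by
    intro a
    obtain ⟨n, hn, h⟩ := hE (j a)
    refine ⟨a ^ p ^ (n - 1), hj ?_⟩
    rw [frobenius_def, ← pow_mul, ← pow_succ, Nat.sub_add_cancel hn, map_pow, h]
  have hinj : Function.Injective (frobenius (B ⧸ Q) p) := by
    intro a b hab
    apply hj
    apply frobenius_inj E p
    simp only [frobenius_def, ← map_pow] at hab ⊢
    rw [hab]
  -- Frobenius is linear over the residue ring of ℤ_p by Fermat: r^p - r is divisible by p, and p
  -- lies in P.
  let l : (B ⧸ Q) ≃ₐ[ℤ_[p] ⧸ P] B ⧸ Q :=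
    { RingEquiv.ofBijective (frobenius (B ⧸ Q) p) ⟨hinj, hsurj⟩ with
      commutes' := by
        intro r
        obtain ⟨r, rfl⟩ := Ideal.Quotient.mk_surjective r
        change frobenius (B ⧸ Q) p (algebraMap _ _ _) = _
        rw [frobenius_def, ← map_pow]
        have h1 : (p : ℤ_[p]) ∈ P := by
          change ι (algebraMap ℤ_[p] B (p : ℤ_[p])) = 0
          rw [map_natCast, map_natCast, CharP.cast_eq_zero]
        have h2 : r ^ p - r ∈ P := by
          have h3 : PadicInt.toZMod (r ^ p - r) = 0 := by
            rw [map_sub, map_pow, ZMod.pow_card, sub_self]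
          rw [← RingHom.mem_ker, PadicInt.ker_toZMod,
            PadicInt.maximalIdeal_eq_span_p, Ideal.mem_span_singleton] at h3
          exact Ideal.mem_of_dvd _ h3 h1
        rw [← map_pow, (Ideal.Quotient.mk_eq_mk_iff_sub_mem _ _).mpr h2] }
  -- The decomposition group of Q surjects onto the automorphisms of the residue extension; Φ is a
  -- preimage of Frobenius.
  obtain ⟨⟨Φ, hΦ⟩, hΦl⟩ :=
    Ideal.Quotient.stabilizerHom_surjective_of_profinite (G := GalQp p) P Q l
  refine ⟨Φ, fun x hx => ?_⟩
  have hx' := mem_zpBar_iff.mpr hx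
  have h := congr(j ($hΦl (Ideal.Quotient.mk Q ⟨x, hx'⟩)))
  rw [Ideal.Quotient.stabilizerHom_apply] at h
  change ι (Φ • (⟨x, hx'⟩ : B)) = j (Ideal.Quotient.mk Q ⟨x, hx'⟩ ^ p) at h
  rw [map_pow] at h
  change ι (Φ • (⟨x, hx'⟩ : B)) = ι ⟨x, hx'⟩ ^ p at h
  rw [← red_coe, ← red_coe, hact] at h
  exact h

/-- A Galois automorphism acts on the residues as a power of Frobenius on each finite level. -/
theorem exists_pow_action (m : ℕ) (hm : 0 < m) (g : GalQp p) (ι : ZpBar p →+* E) :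
    ∃ j, ∀ z : QpBar p, z ^ (p ^ m - 1) = 1 → g z = z ^ p ^ j := by
  have hp : p.Prime := Fact.out
  have hN0 : p ^ m - 1 ≠ 0 := (Nat.sub_pos_of_lt (Nat.one_lt_pow hm.ne' hp.one_lt)).ne'
  have hpN : ¬ p ∣ p ^ m - 1 := by
    intro h
    have h2 := Nat.dvd_sub (dvd_pow_self p hm.ne') h
    rw [Nat.sub_sub_self (Nat.one_le_pow _ _ hp.pos)] at h2
    exact hp.one_lt.ne' (Nat.dvd_one.mp h2)
  have : NeZero ((p ^ m - 1 : ℕ) : QpBar p) := ⟨Nat.cast_ne_zero.mpr hN0⟩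
  obtain ⟨z, hz⟩ := HasEnoughRootsOfUnity.exists_primitiveRoot (QpBar p) (p ^ m - 1)
  have hz1 := norm_eq_one_of_pow_eq_one hN0 hz.pow_eq_one
  have hgz : (g z) ^ (p ^ m - 1) = 1 := by rw [← map_pow, hz.pow_eq_one, map_one]
  have hgz1 := norm_eq_one_of_pow_eq_one hN0 hgz
  set a := red ι z with ha
  have ham : a ^ p ^ m = a := by
    rw [← Nat.sub_add_cancel (Nat.one_le_pow m p hp.pos), pow_succ, ha, ← red_pow ι hz1.le,
      hz.pow_eq_one, red_one, one_mul]
  -- The roots of f are a, a^p, …, a^(p^(m-1)), permuted cyclically by Frobenius. The coefficients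
  -- therefore lie in the prime field and lift to natural numbers.
  let f : Polynomial E := ∏ j ∈ Finset.range m, (Polynomial.X - Polynomial.C (a ^ p ^ j))
  have hf : f.map (frobenius E p) = f := by
    simp only [f, Polynomial.map_prod, Polynomial.map_sub, Polynomial.map_X, Polynomial.map_C,
      frobenius_def, ← pow_mul, ← pow_succ]
    obtain ⟨m, rfl⟩ := Nat.exists_eq_succ_of_ne_zero hm.ne'
    rw [Finset.prod_range_succ, Finset.prod_range_succ', ham, pow_zero, pow_one]
  have hc : ∀ i, ∃ n : ℕ, f.coeff i = n := by
    intro i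
    have h1 : f.coeff i ^ p = f.coeff i := by
      conv_rhs => rw [← hf, Polynomial.coeff_map, frobenius_def]
    obtain ⟨n, hn⟩ := (mem_bot_iff_intCast p E).mp
      ((Subfield.mem_bot_iff_pow_eq_self E p).mpr h1)
    refine ⟨(n % p).toNat, ?_⟩
    rw [← hn, ← Int.cast_natCast, Int.toNat_of_nonneg
      (Int.emod_nonneg _ (Nat.cast_ne_zero.mpr hp.ne_zero)), CharP.intCast_eq_intCast E p]
    exact (Int.mod_modEq _ _).symm
  choose c hc using hc
  -- A lift of f with natural coefficients commutes with g, so the residue of g z is again a root of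
  -- f, that is, some a^(p^j).
  let F : QpBar p → QpBar p := fun x => ∑ i ∈ Finset.range (f.natDegree + 1), (c i) * x ^ i
  have hterm : ∀ x : QpBar p, ‖x‖ ≤ 1 → ∀ i, ‖(c i : QpBar p) * x ^ i‖ ≤ 1 := fun x hx i => by
    rw [norm_mul, norm_pow]
    exact mul_le_one₀ (norm_natCast_le_one _) (by positivity) (pow_le_one₀ (norm_nonneg _) hx)
  have hF : ∀ x : QpBar p, ‖x‖ ≤ 1 → red ι (F x) = f.eval (red ι x) := by
    intro x hx
    rw [Polynomial.eval_eq_sum_range, red_sum ι _ _ fun i _ => hterm x hx i]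
    refine Finset.sum_congr rfl fun i _ => ?_
    rw [hc, red_mul ι (norm_natCast_le_one _)
      (by rw [norm_pow]; exact pow_le_one₀ (norm_nonneg _) hx), red_natCast, red_pow ι hx]
  have hF1 : ∀ x : QpBar p, ‖x‖ ≤ 1 → ‖F x‖ ≤ 1 := fun x hx =>
    norm_sum_le_one _ _ fun i _ => hterm x hx i
  have hgF : F (g z) = g (F z) := by simp [F]
  have h0 : f.eval a = 0 := by
    simp only [f, Polynomial.eval_prod, Finset.prod_eq_zero_iff, Finset.mem_range]
    exact ⟨0, hm, by simp⟩
  have h1 : f.eval (red ι (g z)) = 0 := by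
    rw [← hF _ hgz1.le, hgF, red_eq_zero_iff ι (by rw [norm_gal]; exact hF1 z hz1.le), norm_gal,
      ← red_eq_zero_iff ι (hF1 z hz1.le), hF z hz1.le, ← ha, h0]
  simp only [f, Polynomial.eval_prod, Finset.prod_eq_zero_iff, Polynomial.eval_sub,
    Polynomial.eval_X, Polynomial.eval_C, sub_eq_zero] at h1
  obtain ⟨j, -, hj⟩ := h1
  refine ⟨j, fun x hx => ?_⟩
  have hgz2 : g z = z ^ p ^ j := by
    refine eq_of_red_eq ι hpN hgz ?_ ?_
    · rw [← pow_mul, mul_comm, pow_mul, hz.pow_eq_one, one_pow]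
    · rw [hj, red_pow ι hz1.le]
  have : NeZero (p ^ m - 1) := ⟨hN0⟩
  obtain ⟨i, -, rfl⟩ := hz.eq_pow_of_pow_eq_one hx
  rw [map_pow, hgz2, ← pow_mul, ← pow_mul, mul_comm]

end Frobenius

/-! ### Inertia, unramified subgroups and topological generation -/

section Inertia

variable {p : ℕ} [Fact p.Prime]

lemma not_dvd_pow_sub_one {m : ℕ} (hm : 0 < m) : ¬ p ∣ p ^ m - 1 := by
  have hp : p.Prime := Fact.out
  intro h
  have h2 := Nat.dvd_sub (dvd_pow_self p hm.ne') h
  rw [Nat.sub_sub_self (Nat.one_le_pow _ _ hp.pos)] at h2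
  exact hp.one_lt.ne' (Nat.dvd_one.mp h2)

lemma pow_sub_one_ne_zero {m : ℕ} (hm : 0 < m) : p ^ m - 1 ≠ 0 :=
  (Nat.sub_pos_of_lt (Nat.one_lt_pow hm.ne' (Fact.out : p.Prime).one_lt)).ne'

lemma exists_primitiveRoot_qpBar {n : ℕ} (hn : n ≠ 0) : ∃ z : QpBar p, IsPrimitiveRoot z n :=
  have : NeZero (n : QpBar p) := ⟨Nat.cast_ne_zero.mpr hn⟩
  HasEnoughRootsOfUnity.exists_primitiveRoot (QpBar p) n

lemma mem_galUnram_iff {m : ℕ} {g : GalQp p} :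
    g ∈ GalUnram p m ↔ ∀ z : QpBar p, z ^ (p ^ m - 1) = 1 → g z = z := by
  refine ⟨fun h z hz => galUnram_fix p ⟨g, h⟩ hz, fun h => ?_⟩
  have h1 : unramified p m ≤ IntermediateField.fixedField (Subgroup.zpowers g) := by
    refine IntermediateField.adjoin_le_iff.mpr fun z hz => ?_
    rintro ⟨k, hk⟩
    have h2 : Subgroup.zpowers g ≤ MulAction.stabilizer (GalQp p) z := by
      rw [Subgroup.zpowers_le]
      exact h z hz
    exact h2 hk
  rw [IntermediateField.mem_fixingSubgroup_iff]
  intro x hx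
  exact h1 hx ⟨g, Subgroup.mem_zpowers g⟩

instance galUnram_normal (m : ℕ) : (GalUnram p m).Normal := ⟨fun h hh g => by
  rw [mem_galUnram_iff] at hh ⊢
  intro z hz
  have h1 := hh (g⁻¹ z) (by rw [← map_pow, hz, map_one])
  change g (h (g⁻¹ z)) = z
  rw [h1]
  exact g.apply_symm_apply z⟩

lemma galUnram_anti {m n : ℕ} (h : m ∣ n) : GalUnram p n ≤ GalUnram p m := by
  intro g hg
  rw [mem_galUnram_iff] at hg ⊢
  intro z hz
  refine hg z ?_
  obtain ⟨c, hc⟩ := Nat.pow_sub_one_dvd_pow_sub_one p h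
  rw [hc, pow_mul, hz, one_pow]

lemma dvd_of_pow_sub_one_dvd {m j : ℕ} (h : p ^ m - 1 ∣ p ^ j - 1) : m ∣ j := by
  have hp : p.Prime := Fact.out
  have h1 := Nat.pow_sub_one_gcd_pow_sub_one p m j
  rw [Nat.gcd_eq_left h] at h1
  have h2 : p ^ m = p ^ m.gcd j := by
    have := Nat.one_le_pow m p hp.pos
    have := Nat.one_le_pow (m.gcd j) p hp.pos
    omega
  have h3 := Nat.pow_right_injective hp.two_le h2
  rw [h3]
  exact Nat.gcd_dvd_right _ _

variable {E : Type*} [Field E] (ι : ZpBar p →+* E)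

/-- The inertia group: automorphisms acting trivially on residues. -/
def inertia : Subgroup (GalQp p) where
  carrier := {g | ∀ x : QpBar p, ‖x‖ ≤ 1 → red ι (g x) = red ι x}
  one_mem' _ _ := rfl
  mul_mem' {a b} ha hb x hx := (ha (b x) (by rwa [norm_gal])).trans (hb x hx)
  inv_mem' {a} ha x hx := by
    rw [← ha (a⁻¹ x) (by rwa [norm_gal])]
    congr 1
    exact a.apply_symm_apply x

/-- An arithmetic Frobenius: an automorphism acting on residues as the `p`-power map. -/
def IsFrobenius (Φ : GalQp p) : Prop :=
  ∀ x : QpBar p, ‖x‖ ≤ 1 → red ι (Φ x) = red ι x ^ p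

variable {ι}

lemma IsFrobenius.pow_apply {Φ : GalQp p} (hΦ : IsFrobenius ι Φ) (n : ℕ) {x : QpBar p}
    (hx : ‖x‖ ≤ 1) : red ι ((Φ ^ n) x) = red ι x ^ p ^ n := by
  induction n generalizing x with
  | zero => simp
  | succ n ih =>
    rw [pow_succ, AlgEquiv.mul_apply, ih (by rwa [norm_gal]), hΦ x hx, ← pow_mul, ← pow_succ']

variable [CharP E p]

lemma inertia_apply_root {τ : GalQp p} (hτ : τ ∈ inertia ι) {n : ℕ} (hn : ¬ p ∣ n) {z : QpBar p}
    (hz : z ^ n = 1) : τ z = z := by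
  refine eq_of_red_eq ι hn (by rw [← map_pow, hz, map_one]) hz (hτ z ?_)
  exact (norm_eq_one_of_pow_eq_one (by rintro rfl; simp at hn) hz).le

lemma inertia_le_galUnram {m : ℕ} (hm : 0 < m) : inertia ι ≤ GalUnram p m := fun _ hτ =>
  mem_galUnram_iff.mpr fun _ hz => inertia_apply_root hτ (not_dvd_pow_sub_one hm) hz

lemma IsFrobenius.pow_apply_root {Φ : GalQp p} (hΦ : IsFrobenius ι Φ) (j : ℕ) {n : ℕ}
    (hn : ¬ p ∣ n) {z : QpBar p} (hz : z ^ n = 1) : (Φ ^ j) z = z ^ p ^ j := by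
  have h1 := (norm_eq_one_of_pow_eq_one (by rintro rfl; simp at hn) hz).le
  refine eq_of_red_eq ι hn (by rw [← map_pow, hz, map_one])
    (by rw [← pow_mul, mul_comm, pow_mul, hz, one_pow]) ?_
  rw [hΦ.pow_apply j h1, red_pow ι h1]

lemma IsFrobenius.pow_mem_galUnram {Φ : GalQp p} (hΦ : IsFrobenius ι Φ) {m : ℕ} (hm : 0 < m) :
    Φ ^ m ∈ GalUnram p m := by
  rw [mem_galUnram_iff]
  intro z hz
  rw [hΦ.pow_apply_root m (not_dvd_pow_sub_one hm) hz]
  nth_rw 1 [← Nat.sub_add_cancel (Nat.one_le_pow m p (Fact.out : p.Prime).pos)]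
  rw [pow_succ, hz, one_mul]

/-- Reduction maps primitive roots of unity of order prime to `p` to primitive roots. -/
lemma isPrimitiveRoot_red {n : ℕ} (hn : ¬ p ∣ n) {z : QpBar p} (hz : IsPrimitiveRoot z n) :
    IsPrimitiveRoot (red ι z) n := by
  have h1 := norm_eq_one_of_pow_eq_one (by rintro rfl; simp at hn) hz.pow_eq_one
  refine ⟨by rw [← red_pow ι h1.le, hz.pow_eq_one, red_one], fun l hl => ?_⟩
  refine hz.dvd_of_pow_eq_one _ (eq_one_of_red_eq_one ι hn ?_ ?_)
  · rw [← pow_mul, mul_comm, pow_mul, hz.pow_eq_one, one_pow]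
  · rw [red_pow ι h1.le, hl]

variable (ι) in
/-- Roots of unity of order prime to `p` lift along the reduction. -/
lemma exists_root_red_eq {n : ℕ} (hn : ¬ p ∣ n) {a : E} (ha : a ^ n = 1) :
    ∃ z : QpBar p, z ^ n = 1 ∧ red ι z = a := by
  have hn0 : n ≠ 0 := by rintro rfl; simp at hn
  obtain ⟨z, hz⟩ := exists_primitiveRoot_qpBar (p := p) hn0
  have : NeZero n := ⟨hn0⟩
  obtain ⟨i, -, rfl⟩ := (isPrimitiveRoot_red (ι := ι) hn hz).eq_pow_of_pow_eq_one ha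
  exact ⟨z ^ i, by rw [← pow_mul, mul_comm, pow_mul, hz.pow_eq_one, one_pow],
    red_pow ι (norm_eq_one_of_pow_eq_one hn0 hz.pow_eq_one).le i⟩

/-- A nonzero residue is a root of unity of order prime to p, so x is congruent to a root of unity z
fixed by g. As g is an isometry, g x is still congruent to z. -/
lemma mem_inertia_of_forall_mem_galUnram (hE : ∀ a : E, ∃ n, 0 < n ∧ a ^ p ^ n = a)
    {g : GalQp p} (hg : ∀ m, 0 < m → g ∈ GalUnram p m) : g ∈ inertia ι := by
  intro x hx
  rcases eq_or_ne (red ι x) 0 with h0 | h0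
  · rw [h0, red_eq_zero_iff ι (by rwa [norm_gal]), norm_gal]
    exact (red_eq_zero_iff ι hx).mp h0
  · obtain ⟨n, hn, ha⟩ := hE (red ι x)
    have h1 : red ι x ^ (p ^ n - 1) = 1 := by
      rw [← Nat.sub_add_cancel (Nat.one_le_pow n p (Fact.out : p.Prime).pos), pow_succ] at ha
      exact mul_right_cancel₀ h0 (ha.trans (one_mul _).symm)
    obtain ⟨z, hz, hzx⟩ := exists_root_red_eq ι (not_dvd_pow_sub_one hn) h1
    have hz1 := (norm_eq_one_of_pow_eq_one (pow_sub_one_ne_zero hn) hz).le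
    rw [← hzx, red_eq_red_iff ι (by rwa [norm_gal]) hz1]
    rw [eq_comm, red_eq_red_iff ι hx hz1] at hzx
    rwa [← mem_galUnram_iff.mp (hg n hn) z hz, ← map_sub, norm_gal]

/-- The complement of U is compact, and the closed directed family of unramified subgroups has
intersection inside inertia, hence inside U. Some member already misses the complement. -/
lemma exists_galUnram_le (hE : ∀ a : E, ∃ n, 0 < n ∧ a ^ p ^ n = a) {U : Subgroup (GalQp p)}
    (hU : IsOpen (U : Set (GalQp p))) (hI : inertia ι ≤ U) :
    ∃ m, 0 < m ∧ GalUnram p m ≤ U := by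
  obtain ⟨⟨m, hm⟩, h⟩ := IsCompact.elim_directed_family_closed (ι := {m : ℕ // 0 < m})
    (hs := hU.isClosed_compl.isCompact) (fun m => (GalUnram p m : Set (GalQp p)))
    (fun m => InfiniteGalois.fixingSubgroup_isClosed _) (by
      rw [Set.eq_empty_iff_forall_notMem]
      rintro g ⟨hg, hg2⟩
      refine hg (hI (mem_inertia_of_forall_mem_galUnram hE fun m hm => ?_))
      exact Set.mem_iInter.mp hg2 ⟨m, hm⟩) (by
      rintro ⟨a, ha⟩ ⟨b, hb⟩
      exact ⟨⟨a * b, Nat.mul_pos ha hb⟩, galUnram_anti (dvd_mul_right a b),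
        galUnram_anti (dvd_mul_left b a)⟩)
  refine ⟨m, hm, fun g hg => ?_⟩
  by_contra hgU
  exact (Set.eq_empty_iff_forall_notMem.mp h g) ⟨hgU, hg⟩

/-- An open subgroup containing inertia and `Φ ^ m` contains the Galois group of the unramified
extension of degree `m`. -/
theorem IsFrobenius.galUnram_le (hE : ∀ a : E, ∃ n, 0 < n ∧ a ^ p ^ n = a) {Φ : GalQp p}
    (hΦ : IsFrobenius ι Φ) {U : Subgroup (GalQp p)} (hU : IsOpen (U : Set (GalQp p)))
    (hI : inertia ι ≤ U) {m : ℕ} (hm : 0 < m) (hΦU : Φ ^ m ∈ U) : GalUnram p m ≤ U := by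
  obtain ⟨n, hn, hnU⟩ := exists_galUnram_le hE hU hI
  intro g hg
  have hmn := Nat.mul_pos hm hn
  -- At level mn, g acts as Φ^j. Being trivial at level m forces m ∣ j, so Φ^j is a power of Φ^m and
  -- lies in U.
  obtain ⟨j, hj⟩ := exists_pow_action (m * n) hmn g ι
  have hmj : m ∣ j := by
    obtain ⟨z, hz⟩ := exists_primitiveRoot_qpBar (p := p)
      (pow_sub_one_ne_zero (p := p) hm)
    have h1 := hj z (by
      obtain ⟨c, hc⟩ := Nat.pow_sub_one_dvd_pow_sub_one p (dvd_mul_right m n)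
      rw [hc, pow_mul, hz.pow_eq_one, one_pow])
    rw [mem_galUnram_iff.mp hg z hz.pow_eq_one] at h1
    refine dvd_of_pow_sub_one_dvd (hz.dvd_of_pow_eq_one _ ?_)
    have h3 : 1 ≤ p ^ j := Nat.one_le_pow j p (Fact.out : p.Prime).pos
    rw [← Nat.sub_add_cancel h3, pow_succ] at h1
    exact mul_right_cancel₀ (hz.ne_zero (pow_sub_one_ne_zero hm)) (h1.symm.trans (one_mul _).symm)
  have h2 : (Φ ^ j)⁻¹ * g ∈ GalUnram p (m * n) := by
    rw [mem_galUnram_iff]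
    intro z hz
    rw [AlgEquiv.mul_apply, hj z hz, ← hΦ.pow_apply_root j (not_dvd_pow_sub_one hmn) hz]
    exact (Φ ^ j).symm_apply_apply z
  obtain ⟨c, rfl⟩ := hmj
  have h3 := U.mul_mem (U.pow_mem hΦU c) (hnU (galUnram_anti (dvd_mul_left n m) h2))
  rwa [← pow_mul, mul_inv_cancel_left] at h3

/-- Galois acts on the (p-1)-st roots of unity by p-power exponents, and z^p = z for such z. -/
lemma galUnram_one (ι : ZpBar p →+* E) : GalUnram p 1 = ⊤ := by
  refine top_unique fun g _ => mem_galUnram_iff.mpr fun z hz => ?_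
  obtain ⟨j, hj⟩ := exists_pow_action 1 one_pos g ι
  have h1 : z ^ p = z := by
    rw [pow_one] at hz
    calc z ^ p = z ^ (p - 1) * z := by
          rw [← pow_succ, Nat.sub_add_cancel (Fact.out : p.Prime).one_le]
      _ = z := by rw [hz, one_mul]
  rw [hj z hz]
  clear hj
  induction j with
  | zero => simp
  | succ j ih => rw [pow_succ, pow_mul, ih, h1]

/-- An open subgroup containing inertia and a Frobenius is everything. -/
theorem IsFrobenius.eq_top (hE : ∀ a : E, ∃ n, 0 < n ∧ a ^ p ^ n = a) {Φ : GalQp p}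
    (hΦ : IsFrobenius ι Φ) {U : Subgroup (GalQp p)} (hU : IsOpen (U : Set (GalQp p)))
    (hI : inertia ι ≤ U) (hΦU : Φ ∈ U) : U = ⊤ := by
  rw [eq_top_iff, ← galUnram_one ι]
  exact hΦ.galUnram_le hE hU hI one_pos (by rwa [pow_one])

end Inertia

/-! ### Tame characters of inertia and their surjectivity -/

section Tame

variable {p : ℕ} [Fact p.Prime]

lemma norm_prime_pos : 0 < ‖(p : QpBar p)‖ := by
  rw [norm_prime_qpBar]
  exact inv_pos.mpr (Nat.cast_pos.mpr (Fact.out : p.Prime).pos)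

lemma norm_prime_lt_one : ‖(p : QpBar p)‖ < 1 := by
  rw [norm_prime_qpBar]
  exact inv_lt_one_of_one_lt₀ (Nat.one_lt_cast.mpr (Fact.out : p.Prime).one_lt)

lemma exists_norm_algebraMap_eq {x : ℚ_[p]} (hx : x ≠ 0) :
    ∃ m : ℤ, ‖algebraMap ℚ_[p] (QpBar p) x‖ = ‖(p : QpBar p)‖ ^ m := by
  refine ⟨x.valuation, ?_⟩
  rw [norm_algebraMap_qp, Padic.norm_eq_zpow_neg_valuation hx, norm_prime_qpBar, inv_zpow, zpow_neg]

/-- The spectral norm of x, raised to the degree, is the norm of the constant coefficient of the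
minimal polynomial. -/
lemma exists_norm_pow_natDegree_eq {x : QpBar p} (hx : x ≠ 0) :
    ∃ m : ℤ, ‖x‖ ^ (minpoly ℚ_[p] x).natDegree = ‖(p : QpBar p)‖ ^ m := by
  have hi : IsIntegral ℚ_[p] x := Algebra.IsIntegral.isIntegral x
  obtain ⟨m, hm⟩ := exists_norm_algebraMap_eq (minpoly.coeff_zero_ne_zero hi hx)
  refine ⟨m, ?_⟩
  rw [← hm, norm_algebraMap_qp, ← PadicAlgCl.spectralNorm_eq,
    spectralNorm.spectralNorm_eq_norm_coeff_zero_rpow, one_div,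
    Real.rpow_inv_natCast_pow (norm_nonneg _) (minpoly.natDegree_pos hi).ne']

variable {E : Type*} [Field E] (ι : ZpBar p →+* E)

/-- The residue of `g x / x`. -/
def resChar (g : GalQp p) (x : QpBar p) : E := red ι (g x / x)

variable {ι}

lemma norm_apply_div (g : GalQp p) {x : QpBar p} (hx : x ≠ 0) : ‖g x / x‖ = 1 := by
  rw [norm_div, norm_gal, div_self (norm_ne_zero_iff.mpr hx)]

lemma resChar_ne_zero (g : GalQp p) {x : QpBar p} (hx : x ≠ 0) : resChar ι g x ≠ 0 :=
  red_ne_zero ι (norm_apply_div g hx)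

lemma resChar_mul (g : GalQp p) {x y : QpBar p} (hx : x ≠ 0) (hy : y ≠ 0) :
    resChar ι g (x * y) = resChar ι g x * resChar ι g y := by
  rw [resChar, map_mul, mul_div_mul_comm,
    red_mul ι (norm_apply_div g hx).le (norm_apply_div g hy).le]
  rfl

lemma resChar_pow (g : GalQp p) {x : QpBar p} (hx : x ≠ 0) (n : ℕ) :
    resChar ι g (x ^ n) = resChar ι g x ^ n := by
  rw [resChar, map_pow, ← div_pow, red_pow ι (norm_apply_div g hx).le]
  rfl

lemma resChar_comp (g h : GalQp p) {x : QpBar p} (hx : x ≠ 0) :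
    resChar ι (g * h) x = red ι (g (h x / x)) * resChar ι g x := by
  have hgx : g x ≠ 0 := by simpa using hx
  rw [resChar, resChar, ← red_mul ι (by rw [norm_gal, norm_apply_div h hx])
    (norm_apply_div g hx).le, map_div₀, div_mul_div_cancel₀ hgx]
  rfl

lemma resChar_inertia_mul {τ : GalQp p} (hτ : τ ∈ inertia ι) (g : GalQp p) {x : QpBar p}
    (hx : x ≠ 0) : resChar ι (τ * g) x = resChar ι g x * resChar ι τ x := by
  rw [resChar_comp τ g hx, hτ _ (norm_apply_div g hx).le]
  rfl

lemma resChar_eq_one_of_norm_eq_one {τ : GalQp p} (hτ : τ ∈ inertia ι) {x : QpBar p}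
    (hx : ‖x‖ = 1) : resChar ι τ x = 1 := by
  rw [resChar, red_div ι (by rw [norm_gal, hx]) hx, hτ x hx.le, div_self (red_ne_zero ι hx)]

/-- Inertia fixes residues of units, so a unit factor x/y contributes nothing: the tame character
sees only the valuation. -/
lemma resChar_eq_of_norm_eq {τ : GalQp p} (hτ : τ ∈ inertia ι) {x y : QpBar p}
    (hy : y ≠ 0) (hxy : ‖x‖ = ‖y‖) : resChar ι τ x = resChar ι τ y := by
  have h1 : ‖x / y‖ = 1 := by rw [norm_div, hxy, div_self (norm_ne_zero_iff.mpr hy)]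
  have h2 : x / y ≠ 0 := norm_ne_zero_iff.mp (by rw [h1]; exact one_ne_zero)
  rw [← div_mul_cancel₀ x hy, resChar_mul τ h2 hy, resChar_eq_one_of_norm_eq_one hτ h1, one_mul]

/-- Conjugation replaces x by Φ⁻¹x, which has the same norm and so the same tame value, and then
applies Φ to the residue. This is the tame relation ΦτΦ⁻¹ = τ^p at the level of characters. -/
lemma IsFrobenius.resChar_conj {Φ : GalQp p} (hΦ : IsFrobenius ι Φ) {τ : GalQp p}
    (hτ : τ ∈ inertia ι) {x : QpBar p} (hx : x ≠ 0) :
    resChar ι (Φ * τ * Φ⁻¹) x = resChar ι τ x ^ p := by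
  have h2 : Φ (Φ⁻¹ x) = x := Φ.apply_symm_apply x
  have h3 : Φ⁻¹ x ≠ 0 := by simpa using hx
  rw [← resChar_eq_of_norm_eq hτ hx (norm_gal Φ⁻¹ x)]
  rw [resChar, resChar, ← hΦ _ (norm_apply_div τ h3).le, map_div₀, h2]
  rfl

variable (ι) in
/-- The residue character of inertia attached to a nonzero element. -/
def inertiaHom {y : QpBar p} (hy : y ≠ 0) : inertia ι →* Eˣ :=
  MonoidHom.toHomUnits
    { toFun := fun τ => resChar ι (τ : GalQp p) y
      map_one' := by simp [resChar, div_self hy]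
      map_mul' := fun σ τ => by
        rw [Subgroup.coe_mul, resChar_inertia_mul σ.2 _ hy, mul_comm] }

lemma inertiaHom_apply {y : QpBar p} (hy : y ≠ 0) (τ : inertia ι) :
    (inertiaHom ι hy τ : E) = resChar ι (τ : GalQp p) y := rfl

lemma kummer_ne_zero {y : QpBar p} {d : ℕ} (hd : d ≠ 0) (hy : y ^ d = -(p : QpBar p)) : y ≠ 0 := by
  rintro rfl
  rw [zero_pow hd] at hy
  exact neg_p_ne_zero p hy.symm

lemma kummer_apply_div_pow {y : QpBar p} {d : ℕ} (hy : y ^ d = -(p : QpBar p))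
    (g : GalQp p) : (g y / y) ^ d = 1 := by
  rw [div_pow, ← map_pow, hy, map_neg, map_natCast, div_self (neg_p_ne_zero p)]

variable [CharP E p]

instance inertia_normal : (inertia ι).Normal := ⟨fun τ hτ g x hx => by
  have h1 : ‖g⁻¹ x‖ ≤ 1 := by rwa [norm_gal]
  have h2 : g (g⁻¹ x) = x := g.apply_symm_apply x
  rw [red_eq_red_iff ι (by rwa [norm_gal]) hx]
  nth_rw 2 [← h2]
  rw [AlgEquiv.mul_apply, AlgEquiv.mul_apply, ← map_sub, norm_gal,
    ← red_eq_red_iff ι (by rwa [norm_gal]) h1]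
  exact hτ _ h1⟩

/-- Elements fixed by inertia have norm an integral power of `‖p‖`. -/
theorem exists_norm_eq_zpow_of_inertia_fixed (hp2 : Odd p)
    (hE : ∀ a : E, ∃ n, 0 < n ∧ a ^ p ^ n = a) {Φ : GalQp p} (hΦ : IsFrobenius ι Φ) {x : QpBar p}
    (hx : x ≠ 0) (hI : ∀ τ ∈ inertia ι, τ x = x) : ∃ m : ℤ, ‖x‖ = ‖(p : QpBar p)‖ ^ m := by
  have hp : p.Prime := Fact.out
  have hp3 : 3 ≤ p := by
    have := hp.two_le
    rcases hp2 with ⟨k, hk⟩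
    omega
  obtain ⟨f, hf, hfU⟩ := exists_galUnram_le hE (U := MulAction.stabilizer (GalQp p) x)
    (isOpen_stabilizer_gal x) hI
  have hfx : (Φ ^ f) x = x := hfU (hΦ.pow_mem_galUnram hf)
  -- The value of P at the residue of a root of unity u is the residue of t/x, where t is the sum of
  -- (Φ^i)(x·u) over i < f.
  let P : Polynomial E :=
    ∑ i ∈ Finset.range f, Polynomial.monomial (p ^ i) (resChar ι (Φ ^ i) x)
  have hP0 : P ≠ 0 := by
    intro h
    have h1 : P.coeff (p ^ 0) = resChar ι (Φ ^ 0) x := by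
      simp only [P, Polynomial.finsetSum_coeff, Polynomial.coeff_monomial]
      rw [Finset.sum_eq_single_of_mem 0 (Finset.mem_range.mpr hf)]
      · simp
      · intro i _ hi
        rw [if_neg fun h => hi (Nat.pow_right_injective hp.two_le h)]
    rw [h, Polynomial.coeff_zero] at h1
    exact resChar_ne_zero _ hx h1.symm
  have hPd : P.natDegree ≤ p ^ (f - 1) := by
    refine Polynomial.natDegree_sum_le_of_forall_le _ _ fun i hi => ?_
    refine (Polynomial.natDegree_monomial_le _).trans (Nat.pow_le_pow_right hp.pos ?_)
    have := Finset.mem_range.mp hi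
    omega
  -- This bound needs p ≥ 3. It leaves fewer roots of P than there are (p^f-1)-st roots of unity, so
  -- u can be chosen with P nonzero at its residue.
  have hlt : p ^ (f - 1) < p ^ f - 1 := by
    have h1 : p ^ f = p ^ (f - 1) * p := by rw [← pow_succ, Nat.sub_add_cancel hf]
    have h2 : 1 ≤ p ^ (f - 1) := Nat.one_le_pow _ _ hp.pos
    have h3 : p ^ (f - 1) * 3 ≤ p ^ (f - 1) * p := Nat.mul_le_mul_left _ hp3
    omega
  have hN := not_dvd_pow_sub_one (p := p) hf
  obtain ⟨b, hb, hPb⟩ : ∃ b : E, b ^ (p ^ f - 1) = 1 ∧ P.eval b ≠ 0 := by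
    by_contra! hcon
    obtain ⟨z, hz⟩ := exists_primitiveRoot_qpBar (p := p) (pow_sub_one_ne_zero (p := p) hf)
    refine hP0 (Polynomial.eq_zero_of_natDegree_lt_card_of_eval_eq_zero' P
      (Polynomial.nthRootsFinset (p ^ f - 1) (1 : E)) (fun b hb => hcon b ?_) ?_)
    · exact (Polynomial.mem_nthRootsFinset (Nat.pos_of_ne_zero (pow_sub_one_ne_zero hf)) _).mp hb
    · rw [(isPrimitiveRoot_red (ι := ι) hN hz).card_nthRootsFinset]
      omega
  obtain ⟨u, hu, rfl⟩ := exists_root_red_eq ι hN hb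
  have hu1 : ‖u‖ = 1 := norm_eq_one_of_pow_eq_one (pow_sub_one_ne_zero hf) hu
  let t : QpBar p := ∑ i ∈ Finset.range f, (Φ ^ i) (x * u)
  have hxu : ∀ τ ∈ inertia ι, τ (x * u) = x * u := fun τ hτ => by
    rw [map_mul, hI τ hτ, inertia_apply_root hτ hN hu]
  have htx : t / x = ∑ i ∈ Finset.range f, (Φ ^ i) x / x * (Φ ^ i) u := by
    simp only [t, map_mul, Finset.sum_div]
    exact Finset.sum_congr rfl fun i _ => by ring
  have hterm : ∀ i ∈ Finset.range f, ‖(Φ ^ i) x / x * (Φ ^ i) u‖ ≤ 1 := fun i _ => by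
    rw [norm_mul, norm_apply_div _ hx, norm_gal, hu1, one_mul]
  have hred : red ι (t / x) ≠ 0 := by
    rw [htx, red_sum ι _ _ hterm]
    convert hPb using 1
    simp only [P, Polynomial.eval_finsetSum, Polynomial.eval_monomial]
    refine Finset.sum_congr rfl fun i _ => ?_
    rw [red_mul ι (norm_apply_div _ hx).le (by rw [norm_gal, hu1]), hΦ.pow_apply i hu1.le]
    rfl
  have htx1 : ‖t / x‖ = 1 := by
    have h1 : ‖t / x‖ ≤ 1 := by rw [htx]; exact norm_sum_le_one _ _ hterm
    exact le_antisymm h1 (not_lt.mp fun h => hred ((red_eq_zero_iff ι h1).mpr h))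
  have hnorm : ‖t‖ = ‖x‖ := by
    rwa [norm_div, div_eq_one_iff_eq (norm_ne_zero_iff.mpr hx)] at htx1
  -- Both inertia and Φ fix the trace t, so t lies in ℚ_p. Its norm, equal to that of x, is then an
  -- integral power of ‖p‖.
  have htop : MulAction.stabilizer (GalQp p) t = ⊤ := by
    refine hΦ.eq_top hE (isOpen_stabilizer_gal t) (fun τ hτ => ?_) ?_
    · change τ t = t
      simp only [t, map_sum]
      refine Finset.sum_congr rfl fun i _ => ?_
      have h1 := hxu _ (inertia_normal.conj_mem τ hτ (Φ ^ i)⁻¹)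
      rw [inv_inv] at h1
      have h2 := congrArg (Φ ^ i) h1
      rw [← AlgEquiv.mul_apply, ← mul_assoc, ← mul_assoc, mul_inv_cancel, one_mul] at h2
      exact h2
    · change Φ t = t
      simp only [t, map_sum]
      have h1 : ∀ i, Φ ((Φ ^ i) (x * u)) = (Φ ^ (i + 1)) (x * u) := fun i => by
        rw [pow_succ', AlgEquiv.mul_apply]
      simp only [h1]
      have h2 := Finset.sum_range_succ (fun i => (Φ ^ i) (x * u)) f
      rw [Finset.sum_range_succ'] at h2
      have h3 : (Φ ^ f) (x * u) = (Φ ^ 0) (x * u) := by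
        rw [map_mul, hfx, mem_galUnram_iff.mp (hΦ.pow_mem_galUnram hf) u hu]
        rfl
      rw [h3] at h2
      exact add_right_cancel h2
  obtain ⟨s, hs⟩ := (InfiniteGalois.mem_range_algebraMap_iff_fixed t).mpr fun g => by
    have : g ∈ MulAction.stabilizer (GalQp p) t := htop ▸ Subgroup.mem_top g
    exact this
  have hs0 : s ≠ 0 := by
    rintro rfl
    rw [map_zero] at hs
    rw [← hs, norm_zero] at hnorm
    exact hx (norm_eq_zero.mp hnorm.symm)
  rw [← hnorm, ← hs]
  exact exists_norm_algebraMap_eq hs0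

/-- Inertia surjects onto the roots of unity of order prime to `p` by the tame character. -/
theorem exists_inertia_resChar_eq (hp2 : Odd p)
    (hE : ∀ a : E, ∃ n, 0 < n ∧ a ^ p ^ n = a) {Φ : GalQp p} (hΦ : IsFrobenius ι Φ)
    {y : QpBar p} {d : ℕ} (hd : ¬ p ∣ d) (hy : y ^ d = -(p : QpBar p)) {a : E} (ha : a ^ d = 1) :
    ∃ τ ∈ inertia ι, resChar ι τ y = a := by
  have hd0 : d ≠ 0 := by rintro rfl; simp at hd
  have : NeZero d := ⟨hd0⟩
  have hy0 := kummer_ne_zero hd0 hy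
  let H := (inertiaHom ι hy0).range
  have hHle : H ≤ rootsOfUnity d E := by
    rintro _ ⟨τ, rfl⟩
    rw [mem_rootsOfUnity', inertiaHom_apply, resChar, ← red_pow ι (norm_apply_div _ hy0).le,
      kummer_apply_div_pow hy, red_one]
  have : Finite H := Finite.of_injective _ (Subgroup.inclusion_injective hHle)
  have hm0 : Nat.card H ≠ 0 := Nat.card_pos.ne'
  -- If H is the image of the tame character, y^|H| is fixed by inertia. Its norm is therefore an
  -- integral power of ‖p‖, while ‖y‖^d = ‖p‖; this forces d ∣ |H|, hence H is all of the d-th roots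
  -- of unity.
  have hfix : ∀ τ ∈ inertia ι, τ (y ^ Nat.card H) = y ^ Nat.card H := by
    intro τ hτ
    have h1 : resChar ι τ y ^ Nat.card H = 1 := by
      have h2 := pow_card_eq_one' (x := (⟨inertiaHom ι hy0 ⟨τ, hτ⟩, ⟨τ, hτ⟩, rfl⟩ : H))
      have h3 : ((inertiaHom ι hy0 ⟨τ, hτ⟩ ^ Nat.card H : Eˣ) : E) = 1 :=
        congrArg (fun x : H => ((x : Eˣ) : E)) h2
      rwa [Units.val_pow_eq_pow_val, inertiaHom_apply] at h3
    rw [← resChar_pow τ hy0] at h1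
    have h4 := eq_one_of_red_eq_one ι hd (x := τ (y ^ Nat.card H) / y ^ Nat.card H) (by
      rw [map_pow, ← div_pow, ← pow_mul, mul_comm, pow_mul, kummer_apply_div_pow hy,
        one_pow]) h1
    exact (div_eq_one_iff_eq (pow_ne_zero _ hy0)).mp h4
  obtain ⟨k, hk⟩ := exists_norm_eq_zpow_of_inertia_fixed hp2 hE hΦ (pow_ne_zero _ hy0) hfix
  have hdvd : d ∣ Nat.card H := by
    have h1 : ‖(p : QpBar p)‖ ^ (Nat.card H : ℤ) = ‖(p : QpBar p)‖ ^ (k * d) := by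
      rw [zpow_mul, ← hk, zpow_natCast, zpow_natCast, ← norm_pow, ← norm_pow, ← pow_mul, mul_comm,
        pow_mul, hy, norm_pow, norm_pow, norm_neg]
    have h2 := zpow_right_injective₀ norm_prime_pos norm_prime_lt_one.ne h1
    exact Int.natCast_dvd_natCast.mp ⟨k, by rw [h2, mul_comm]⟩
  have hH : H = rootsOfUnity d E := Subgroup.eq_of_le_of_card_ge hHle
    ((card_rootsOfUnity E d).trans (Nat.le_of_dvd Nat.card_pos hdvd))
  obtain ⟨a', rfl⟩ : ∃ a' : Eˣ, (a' : E) = a :=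
    ⟨Units.ofPowEqOne a d ha hd0, rfl⟩
  have h5 : a' ∈ H := by rw [hH, mem_rootsOfUnity', ha]
  obtain ⟨τ, hτ⟩ := h5
  exact ⟨τ, τ.2, by rw [← hτ, inertiaHom_apply]⟩

end Tame

/-! ### Wild elements relative to an open normal subgroup -/

section Wild

variable {p : ℕ} [Fact p.Prime]

/-- `τ` is wild on the fixed field of `N` if it moves each of its nonzero elements by a quantity of
strictly smaller norm. -/
def IsWildOn (N : Subgroup (GalQp p)) (τ : GalQp p) : Prop :=
  ∀ x ∈ IntermediateField.fixedField N, x ≠ 0 → ‖τ x - x‖ < ‖x‖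

lemma apply_mem_fixedField (N : Subgroup (GalQp p)) [N.Normal] (g : GalQp p) {x : QpBar p}
    (hx : x ∈ IntermediateField.fixedField N) : g x ∈ IntermediateField.fixedField N := by
  rw [IntermediateField.mem_fixedField_iff] at hx ⊢
  intro n hn
  have h1 := hx _ (Subgroup.Normal.conj_mem' ‹N.Normal› n hn g)
  have h2 := congrArg g h1
  rw [← AlgEquiv.mul_apply, ← mul_assoc, ← mul_assoc, mul_inv_cancel, one_mul] at h2
  exact h2

lemma IsWildOn.one (N : Subgroup (GalQp p)) : IsWildOn N 1 := fun x _ hx0 => by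
  rw [AlgEquiv.one_apply, sub_self, norm_zero]
  exact norm_pos_iff.mpr hx0

lemma IsWildOn.mul {N : Subgroup (GalQp p)} [N.Normal] {σ τ : GalQp p} (hσ : IsWildOn N σ)
    (hτ : IsWildOn N τ) : IsWildOn N (σ * τ) := fun x hx hx0 => by
  have h1 := hσ (τ x) (apply_mem_fixedField N τ hx) (by simpa using hx0)
  rw [norm_gal] at h1
  rw [AlgEquiv.mul_apply, ← sub_add_sub_cancel _ (τ x)]
  exact (IsUltrametricDist.norm_add_le_max _ _).trans_lt (max_lt h1 (hτ x hx hx0))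

lemma IsWildOn.inv {N : Subgroup (GalQp p)} [N.Normal] {τ : GalQp p} (hτ : IsWildOn N τ) :
    IsWildOn N τ⁻¹ := fun x hx hx0 => by
  have h1 : τ (τ⁻¹ x) = x := τ.apply_symm_apply x
  have h2 := hτ (τ⁻¹ x) (apply_mem_fixedField N _ hx) (by simpa using hx0)
  rwa [h1, norm_gal, norm_sub_rev] at h2

/-- The group of automorphisms that are wild on the fixed field of `N`. -/
def wild (N : Subgroup (GalQp p)) [N.Normal] : Subgroup (GalQp p) where
  carrier := {τ | IsWildOn N τ}
  one_mem' := IsWildOn.one N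
  mul_mem' := IsWildOn.mul
  inv_mem' := IsWildOn.inv

instance wild_normal (N : Subgroup (GalQp p)) [N.Normal] : (wild N).Normal :=
  ⟨fun τ hτ g x hx hx0 => by
    have h2 : g (g⁻¹ x) = x := g.apply_symm_apply x
    have h3 := hτ (g⁻¹ x) (apply_mem_fixedField N _ hx) (by simpa using hx0)
    rw [norm_gal, ← norm_gal g, map_sub, h2] at h3
    exact h3⟩

/-- Wild elements have `p`-power order modulo `N`. -/
theorem exists_pow_mem_of_mem_wild {N : Subgroup (GalQp p)} [N.Normal]
    (hN : IsOpen (N : Set (GalQp p))) {τ : GalQp p} (hτ : τ ∈ wild N) :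
    ∃ a, τ ^ p ^ a ∈ N := by
  have hquot : Finite (GalQp p ⧸ N) := N.quotient_finite_of_isOpen hN
  have hfin : N.FiniteIndex := Subgroup.finiteIndex_of_finite_quotient
  obtain ⟨n, hn0, -, hn⟩ := Subgroup.exists_pow_mem_of_index_ne_zero hfin.index_ne_zero τ
  obtain ⟨a, q, hq, rfl⟩ := Nat.exists_eq_pow_mul_and_not_dvd hn0.ne' p
    (Fact.out : p.Prime).ne_one
  refine ⟨a, ?_⟩
  set σ := τ ^ p ^ a with hσ
  have hq0 : q ≠ 0 := by rintro rfl; simp at hq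
  have hσq : σ ^ q ∈ N := by rwa [hσ, ← pow_mul]
  have hcl : (IntermediateField.fixedField N).fixingSubgroup = N :=
    InfiniteGalois.fixingSubgroup_fixedField ⟨N, N.isClosed_of_isOpen hN⟩
  rw [← hcl, IntermediateField.mem_fixingSubgroup_iff]
  intro x hx
  let T : QpBar p → QpBar p := fun x => ∑ i ∈ Finset.range q, (σ ^ i) x
  have hT : σ (T x) = T x := by
    have h1 : ∀ i, σ ((σ ^ i) x) = (σ ^ (i + 1)) x := fun i => by
      rw [pow_succ', AlgEquiv.mul_apply]
    simp only [T, map_sum, h1]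
    have h2 := Finset.sum_range_succ (fun i => (σ ^ i) x) q
    rw [Finset.sum_range_succ'] at h2
    have h3 : (σ ^ q) x = (σ ^ 0) x := (IntermediateField.mem_fixedField_iff _ _).mp hx _ hσq
    rw [h3] at h2
    exact add_right_cancel h2
  have hTi : ∀ i, (σ ^ i) (T x) = T x := fun i => by
    induction i with
    | zero => rfl
    | succ i ih => rw [pow_succ, AlgEquiv.mul_apply, hT, ih]
  have hqnorm : ‖(q : QpBar p)‖ = 1 := by
    rw [← map_natCast (algebraMap ℚ_[p] (QpBar p)), norm_algebraMap_qp,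
      Padic.norm_natCast_eq_one_iff]
    exact (Nat.Prime.coprime_iff_not_dvd Fact.out).mpr hq
  have hqne : (q : QpBar p) ≠ 0 := Nat.cast_ne_zero.mpr hq0
  -- The part of q·x of trace zero under σ. If y ≠ 0, then q·y = -∑ (σ^i y - y) has norm less than
  -- ‖y‖ by wildness, contradicting ‖q‖ = 1. So q·x equals the trace and is fixed by σ.
  let y : QpBar p := q * x - T x
  have hyL : y ∈ IntermediateField.fixedField N :=
    sub_mem (mul_mem (natCast_mem _ q) hx) (sum_mem fun i _ => apply_mem_fixedField N _ hx)
  have hTy : T y = 0 := by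
    have h1 : ∀ i, (σ ^ i) y = q * (σ ^ i) x - T x := fun i => by
      simp only [y, map_sub, map_mul, map_natCast, hTi]
    change ∑ i ∈ Finset.range q, (σ ^ i) y = 0
    simp only [h1, Finset.sum_sub_distrib, ← Finset.mul_sum, Finset.sum_const, Finset.card_range,
      nsmul_eq_mul]
    exact sub_self _
  have hy0 : y = 0 := by
    by_contra hy
    have h1 : (q : QpBar p) * y = -∑ i ∈ Finset.range q, ((σ ^ i) y - y) := by
      rw [Finset.sum_sub_distrib, Finset.sum_const, Finset.card_range, nsmul_eq_mul]
      change _ = -(T y - _)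
      rw [hTy, zero_sub, neg_neg]
    have h2 : ‖∑ i ∈ Finset.range q, ((σ ^ i) y - y)‖ < ‖y‖ := by
      obtain ⟨i, -, hi⟩ := IsUltrametricDist.exists_norm_finsetSum_le_of_nonempty
        (Finset.nonempty_range_iff.mpr hq0) (fun i => (σ ^ i) y - y)
      exact hi.trans_lt ((wild N).pow_mem ((wild N).pow_mem hτ _) i y hyL hy)
    rw [← norm_neg, ← h1, norm_mul, hqnorm, one_mul] at h2
    exact lt_irrefl _ h2
  have h3 : (q : QpBar p) * x = T x := sub_eq_zero.mp hy0
  have h4 : σ (q * x) = q * x := by rw [h3, hT]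
  rw [map_mul, map_natCast] at h4
  exact mul_left_cancel₀ hqne h4

variable {E : Type*} [Field E] [CharP E p] {ι : ZpBar p →+* E}

/-- On the fixed field of an open subgroup, inertia acts modulo wild elements through one tame
character. -/
theorem exists_tame_level {N : Subgroup (GalQp p)} [N.Normal] (hN : IsOpen (N : Set (GalQp p)))
    {e : ℕ} (he0 : e ≠ 0) (he : ¬ p ∣ e) :
    ∃ d, ¬ p ∣ d ∧ e ∣ d ∧ ∀ y : QpBar p, y ^ d = -(p : QpBar p) → ∀ τ ∈ inertia ι,
      resChar ι τ y = 1 → τ ∈ wild N := by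
  let L := IntermediateField.fixedField N
  have hcl : L.fixingSubgroup = N :=
    InfiniteGalois.fixingSubgroup_fixedField ⟨N, N.isClosed_of_isOpen hN⟩
  have hfd : FiniteDimensional ℚ_[p] L := (InfiniteGalois.isOpen_iff_finite L).mp (by
    rw [hcl]
    exact hN)
  -- The factorial is a common multiple of the degrees of all elements of L; d is the prime-to-p
  -- part, and the factor e ensures e ∣ d.
  obtain ⟨a, d, hd, hDd⟩ := Nat.exists_eq_pow_mul_and_not_dvd
    (mul_ne_zero (Nat.factorial_ne_zero (Module.finrank ℚ_[p] L)) he0) p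
    (Fact.out : p.Prime).ne_one
  have hed : e ∣ d := by
    have h1 : e ∣ p ^ a * d := hDd ▸ dvd_mul_left _ _
    exact (Nat.Coprime.pow_right a ((Nat.Prime.coprime_iff_not_dvd Fact.out).mpr he).symm).dvd_of_dvd_mul_left h1
  have hd0 : d ≠ 0 := by rintro rfl; simp at hd
  refine ⟨d, hd, hed, fun y hy τ hτ hτy x hx hx0 => ?_⟩
  have hy0 := kummer_ne_zero hd0 hy
  obtain ⟨m, hm⟩ := exists_norm_pow_natDegree_eq hx0
  have hdeg : (minpoly ℚ_[p] x).natDegree ∣ p ^ a * d := by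
    rw [← hDd]
    refine Dvd.dvd.mul_right (Nat.dvd_factorial
      (minpoly.natDegree_pos (Algebra.IsIntegral.isIntegral x)) ?_) _
    have h1 := minpoly.natDegree_le (A := ℚ_[p]) (⟨x, hx⟩ : L)
    rwa [IntermediateField.minpoly_eq] at h1
  obtain ⟨c, hc⟩ := hdeg
  -- Up to the p-power p^a, the valuation of x is a multiple of that of y, so the tame value of x is
  -- controlled by that of y.
  have hnorm : ‖x ^ p ^ a‖ = ‖y ^ (m * c)‖ := by
    have h1 : ‖x ^ p ^ a‖ ^ d = ‖y ^ (m * c)‖ ^ d := by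
      rw [← norm_pow, ← pow_mul, hc, pow_mul, norm_pow, norm_pow, hm, norm_zpow, ← zpow_natCast,
        ← zpow_natCast, ← zpow_mul, ← zpow_mul, mul_comm (m * c), zpow_mul _ (d : ℤ), zpow_natCast,
        ← norm_pow, hy, norm_neg]
    exact (pow_left_inj₀ (norm_nonneg _) (norm_nonneg _) hd0).mp h1
  have hyτ : τ y = y := by
    have h1 := eq_one_of_red_eq_one ι hd (kummer_apply_div_pow hy τ) hτy
    exact (div_eq_one_iff_eq hy0).mp h1
  have h2 : resChar ι τ x ^ p ^ a = 1 := by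
    have h3 : y ^ (m * c) ≠ 0 := zpow_ne_zero _ hy0
    rw [← resChar_pow τ hx0, resChar_eq_of_norm_eq hτ h3 hnorm, resChar, map_zpow₀, hyτ,
      div_self h3, red_one]
  -- In characteristic p the only p^a-th root of 1 is 1.
  have h3 : resChar ι τ x = 1 := by
    have := sub_eq_zero.mpr h2
    rw [← one_pow (p ^ a), ← sub_pow_char_pow] at this
    exact sub_eq_zero.mp (eq_zero_of_pow_eq_zero this)
  rwa [resChar, red_div_eq_one_iff ι hx0 (norm_gal τ x)] at h3

end Wild

/-! ### Fundamental characters and conjugation -/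

section FundamentalCharacter

variable {p : ℕ} [Fact p.Prime] {E : Type*} [Field E] (ι : ZpBar p →+* E)

lemma fundChar_apply {n : ℕ} [NeZero n] (g : GalUnram p n) {π : QpBar p}
    (hπ : π ^ (p ^ n - 1) = -(p : QpBar p)) : (fundChar p ι n g : E) = resChar ι g π := by
  have h0 := ne_zero_of_pow_eq p hπ
  rw [resChar, fundCharLift_spec p n g π hπ, mul_div_cancel_right₀ _ h0, red_coe]
  rfl

variable {ι}

/-- Conjugation replaces π by g⁻¹π, which is another root of -p and gives the same character, and
then applies g to the residue. -/
lemma fundChar_conj {g : GalQp p} {q : ℕ} (hg : ∀ x, ‖x‖ ≤ 1 → red ι (g x) = red ι x ^ q)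
    {n : ℕ} [NeZero n] (h : GalUnram p n) (hc : g * h * g⁻¹ ∈ GalUnram p n) :
    fundChar p ι n ⟨g * h * g⁻¹, hc⟩ = fundChar p ι n h ^ q := by
  have hπ := kummerRoot_pow p n
  have hπ0 := ne_zero_of_pow_eq p hπ
  have h1 : g (g⁻¹ (kummerRoot p n)) = kummerRoot p n := g.apply_symm_apply _
  have h2 : g⁻¹ (kummerRoot p n) ≠ 0 := by simpa using hπ0
  ext
  rw [Units.val_pow_eq_pow_val, fundChar_apply ι _ hπ,
    fundChar_apply ι h (apply_pow_eq p hπ g⁻¹), resChar, resChar,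
    ← hg _ (norm_apply_div _ h2).le, map_div₀, h1]
  rfl

lemma isSmoothChar_of_eq_one {G F : Type*} [Group G] [TopologicalSpace G] [IsTopologicalGroup G]
    [Field F] {χ : G →* Fˣ} {U : Subgroup G} (hU : IsOpen (U : Set G)) (h : ∀ g ∈ U, χ g = 1) :
    IsSmoothChar χ :=
  Subgroup.isOpen_mono (H₁ := U) h hU

end FundamentalCharacter

/-! ### The cyclotomic character as a fundamental character -/

section Cyclotomic

variable {p : ℕ} [Fact p.Prime] {E : Type*} [Field E] [CharP E p] (ι : ZpBar p →+* E)

lemma map_cyclo {k K : Type*} [Field k] [CharP k p] [Field K] [CharP K p] [Algebra k K]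
    (g : GalQp p) : algebraMap k K (cyclo p k g) = cyclo p K g := by
  change (algebraMap k K) (ZMod.castHom dvd_rfl k _) = ZMod.castHom dvd_rfl K _
  rw [← RingHom.comp_apply]
  congr 1
  exact Subsingleton.elim _ _

lemma red_zeta_eq_one {z : QpBar p} (hz : z ^ p = 1) : red ι z = 1 := by
  have h1 := (norm_eq_one_of_pow_eq_one (Fact.out : p.Prime).ne_zero hz).le
  refine frobenius_inj E p ?_
  rw [frobenius_def, frobenius_def, ← red_pow ι h1, hz, red_one, one_pow]

lemma red_geom_zeta {z : QpBar p} (hz : z ^ p = 1) (n : ℕ) :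
    red ι (∑ i ∈ Finset.range n, z ^ i) = n := by
  have h1 := (norm_eq_one_of_pow_eq_one (Fact.out : p.Prime).ne_zero hz).le
  rw [red_sum ι _ _ fun i _ => by rw [norm_pow]; exact pow_le_one₀ (norm_nonneg _) h1]
  simp only [red_pow ι h1, red_zeta_eq_one ι hz, one_pow, Finset.sum_const, Finset.card_range,
    nsmul_eq_mul, mul_one]

/-- If g z = z^c, then g(z-1)/(z-1) = 1 + z + … + z^(c-1), and every term reduces to 1. -/
lemma cyclo_eq_resChar_sub_one (g : GalQp p) {z : QpBar p} (hz : IsPrimitiveRoot z p) :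
    (cyclo p E g : E) = resChar ι g (z - 1) := by
  let c : (ZMod p)ˣ := modularCyclotomicCharacter (QpBar p) (card_rootsOfUnity_p p)
    (MulSemiringAction.toRingAut (GalQp p) (QpBar p) g)
  have hg : g z = z ^ (c : ZMod p).val :=
    modularCyclotomicCharacter.spec (QpBar p) (card_rootsOfUnity_p p)
      (MulSemiringAction.toRingAut (GalQp p) (QpBar p) g)
      (t := (hz.isUnit (Fact.out : p.Prime).ne_zero).unit) (by
        rw [mem_rootsOfUnity']
        exact hz.pow_eq_one)
  have hz1 : z - 1 ≠ 0 := sub_ne_zero.mpr (hz.ne_one (Fact.out : p.Prime).one_lt)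
  rw [resChar, map_sub, map_one, hg, ← mul_geom_sum, mul_div_cancel_left₀ _ hz1,
    red_geom_zeta ι hz.pow_eq_one]
  change ZMod.castHom dvd_rfl E (c : ZMod p) = _
  conv_lhs => rw [← ZMod.natCast_zmod_val (c : ZMod p)]
  rw [map_natCast]

/-- The mod `p` cyclotomic character is the fundamental character of level one. -/
theorem cyclo_eq_resChar (hp2 : Odd p) (g : GalQp p) {π : QpBar p}
    (hπ : π ^ (p - 1) = -(p : QpBar p)) : (cyclo p E g : E) = resChar ι g π := by
  have hp : p.Prime := Fact.out
  have hp1 : p - 1 ≠ 0 := (Nat.sub_pos_of_lt hp.one_lt).ne'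
  obtain ⟨z, hz⟩ := exists_primitiveRoot_qpBar (p := p) hp.ne_zero
  have hz1 : z - 1 ≠ 0 := sub_ne_zero.mpr (hz.ne_one hp.one_lt)
  have hπ0 := kummer_ne_zero hp1 hπ
  let s : ℕ → QpBar p := fun k => ∑ i ∈ Finset.range (k + 1), z ^ i
  have hs : ∀ k, ‖s k‖ ≤ 1 := fun k => norm_sum_le_one _ _ fun i _ => by
    rw [norm_pow, norm_eq_one_of_pow_eq_one hp.ne_zero hz.pow_eq_one, one_pow]
  have heven : Even (p - 1) := Nat.Odd.sub_odd hp2 odd_one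
  have hprod : (p : QpBar p) = (z - 1) ^ (p - 1) * ∏ k ∈ Finset.range (p - 1), s k := by
    have h1 := IsPrimitiveRoot.prod_pow_sub_one_eq_order (n := p - 1) (μ := z)
      (by rwa [Nat.sub_add_cancel hp.one_le])
    rw [heven.neg_one_pow, one_mul, ← Nat.cast_add_one, Nat.sub_add_cancel hp.one_le] at h1
    rw [← h1]
    simp only [← mul_geom_sum, Finset.prod_mul_distrib, Finset.prod_const, Finset.card_range, s]
  -- Each s_k reduces to k+1, so the product reduces to (p-1)!, which is -1 by Wilson. Hence π and
  -- z-1 differ by a unit t with t^(p-1) reducing to 1.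
  have hred : red ι (∏ k ∈ Finset.range (p - 1), s k) = -1 := by
    rw [red_prod ι _ _ fun k _ => hs k]
    simp only [s, red_geom_zeta ι hz.pow_eq_one]
    rw [← Nat.cast_prod, Finset.prod_range_add_one_eq_factorial]
    have h1 := congrArg (ZMod.castHom dvd_rfl E) (ZMod.wilsons_lemma p)
    rwa [map_natCast, map_neg, map_one] at h1
  let t := π / (z - 1)
  have ht0 : t ≠ 0 := div_ne_zero hπ0 hz1
  have ht : t ^ (p - 1) = -∏ k ∈ Finset.range (p - 1), s k := by
    rw [div_pow, hπ, hprod, neg_div, mul_div_cancel_left₀ _ (pow_ne_zero _ hz1)]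
  have hprodle : ‖∏ k ∈ Finset.range (p - 1), s k‖ ≤ 1 := by
    rw [norm_prod]
    exact Finset.prod_le_one (fun _ _ => norm_nonneg _) fun k _ => hs k
  have ht1 : ‖t‖ = 1 := by
    have h1 : ‖∏ k ∈ Finset.range (p - 1), s k‖ = 1 := by
      refine le_antisymm hprodle (not_lt.mp fun h => ?_)
      rw [← red_eq_zero_iff ι hprodle, hred] at h
      exact one_ne_zero (neg_eq_zero.mp h)
    rw [← norm_neg, ← ht, norm_pow] at h1
    exact (pow_eq_one_iff_of_nonneg (norm_nonneg _) hp1).mp h1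
  have htred : red ι t ^ (p - 1) = 1 := by
    rw [← red_pow ι ht1.le, ht, red_neg ι hprodle, hred, neg_neg]
  -- The residue of t is that of a (p-1)-st root of unity, which the whole Galois group fixes. So π
  -- and z-1 give the same residue character.
  have hgt : red ι (g t) = red ι t := by
    have hN := not_dvd_pow_sub_one (p := p) one_pos
    obtain ⟨u, hu, hut⟩ := exists_root_red_eq ι hN (a := red ι t) (by rwa [pow_one])
    have hu1 := (norm_eq_one_of_pow_eq_one (pow_sub_one_ne_zero one_pos) hu).le
    have hgu : g u = u := mem_galUnram_iff.mp (galUnram_one ι ▸ Subgroup.mem_top g) u hu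
    rw [← hut, eq_comm]
    rw [red_eq_red_iff ι hu1 ht1.le] at hut
    rwa [red_eq_red_iff ι hu1 (by rw [norm_gal, ht1]), ← hgu, ← map_sub, norm_gal]
  have h1 : resChar ι g t = 1 := by
    rw [resChar, red_div ι (by rw [norm_gal, ht1]) ht1, hgt, div_self (red_ne_zero ι ht1)]
  rw [cyclo_eq_resChar_sub_one ι g hz, ← one_mul (resChar ι g (z - 1)), ← h1,
    ← resChar_mul g ht0 hz1, div_mul_cancel₀ _ hz1]

/-- The power of the cyclotomic character of order two, on the level of a root of `-p`. -/
theorem cyclo_pow_eq_resChar_pow (hp2 : Odd p) (g : GalQp p) {n : ℕ} (hn : n ≠ 0) {π : QpBar p}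
    (hπ : π ^ (p ^ n - 1) = -(p : QpBar p)) :
    ((cyclo p E ^ ((p - 1) / 2)) g : E) = resChar ι g π ^ ((p ^ n - 1) / 2) := by
  have hπ0 := kummer_ne_zero (pow_sub_one_ne_zero (Nat.pos_of_ne_zero hn)) hπ
  obtain ⟨M, hM⟩ : p - 1 ∣ p ^ n - 1 := by
    simpa using Nat.pow_sub_one_dvd_pow_sub_one p (one_dvd n)
  obtain ⟨r, hr⟩ := (Nat.Odd.sub_odd hp2 odd_one).two_dvd
  have h1 : (π ^ M) ^ (p - 1) = -(p : QpBar p) := by rw [← pow_mul, mul_comm, ← hM, hπ]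
  rw [MonoidHom.pow_apply, Units.val_pow_eq_pow_val, cyclo_eq_resChar ι hp2 g h1,
    resChar_pow g hπ0, ← pow_mul, hM, hr, mul_assoc, Nat.mul_div_cancel_left _ two_pos,
    Nat.mul_div_cancel_left _ two_pos, mul_comm]

end Cyclotomic

/-! ### Irreducibility, twists and extension of scalars -/

section Generalities

variable {F G V W : Type*} [Field F] [Group G] [AddCommGroup V] [Module F V] [AddCommGroup W]
  [Module F W]

lemma isIrreducible_of_forall [Nontrivial V] {ρ : Representation F G V}
    (h : ∀ S : Submodule F V, (∀ g, ∀ v ∈ S, ρ g v ∈ S) → S = ⊥ ∨ S = ⊤) : ρ.IsIrreducible where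
  exists_pair_ne := ⟨⊥, ⊤, fun h => bot_ne_top (α := Submodule F V)
    (congrArg Subrepresentation.toSubmodule h)⟩
  eq_bot_or_eq_top S := (h S.toSubmodule fun g _ hv => S.apply_mem_toSubmodule g hv).imp
    (fun h => Subrepresentation.toSubmodule_injective h)
    (fun h => Subrepresentation.toSubmodule_injective h)

lemma eq_bot_or_eq_top_of_isIrreducible {ρ : Representation F G V} (hρ : ρ.IsIrreducible)
    (S : Submodule F V) (hS : ∀ g, ∀ v ∈ S, ρ g v ∈ S) : S = ⊥ ∨ S = ⊤ :=
  (hρ.eq_bot_or_eq_top ⟨S, hS⟩).imp (congrArg Subrepresentation.toSubmodule)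
    (congrArg Subrepresentation.toSubmodule)

lemma nontrivial_of_isIrreducible {ρ : Representation F G V} (hρ : ρ.IsIrreducible) :
    Nontrivial V := by
  by_contra h
  rw [not_nontrivial_iff_subsingleton] at h
  obtain ⟨S, T, hST⟩ := hρ.exists_pair_ne
  exact hST (Subrepresentation.toSubmodule_injective (Subsingleton.elim _ _))

lemma nonempty_equiv_of_bijective {ρ : Representation F G V} {σ : Representation F G W}
    (f : V →ₗ[F] W) (hf : ∀ g v, f (ρ g v) = σ g (f v)) (hb : Function.Bijective f) :
    Nonempty (ρ.Equiv σ) :=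
  ⟨Representation.Equiv.mk (LinearEquiv.ofBijective f hb) fun g => LinearMap.ext (hf g)⟩

lemma equiv_apply_apply {ρ : Representation F G V} {σ : Representation F G W} (e : ρ.Equiv σ)
    (g : G) (v : V) : e.toLinearEquiv (ρ g v) = σ g (e.toLinearEquiv v) :=
  Representation.IntertwiningMap.isIntertwining _ _ e.toIntertwiningMap g v

lemma isIrreducible_of_equiv {ρ : Representation F G V} {σ : Representation F G W}
    (e : ρ.Equiv σ) (hσ : σ.IsIrreducible) : ρ.IsIrreducible := by
  have := nontrivial_of_isIrreducible hσ
  have : Nontrivial V := e.toLinearEquiv.toEquiv.nontrivial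
  refine isIrreducible_of_forall fun S hS => ?_
  have h1 := eq_bot_or_eq_top_of_isIrreducible hσ (S.map e.toLinearEquiv.toLinearMap) (by
    rintro g _ ⟨v, hv, rfl⟩
    exact ⟨ρ g v, hS g v hv, equiv_apply_apply e g v⟩)
  refine h1.imp (fun h => ?_) (fun h => ?_)
  · rwa [Submodule.map_eq_bot_iff] at h
  · refine Submodule.map_injective_of_injective e.toLinearEquiv.injective ?_
    exact h.trans (by rw [Submodule.map_top, LinearEquiv.range])

lemma isIrreducible_twist {ρ : Representation F G V} (χ : G →* Fˣ) (hρ : ρ.IsIrreducible) :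
    (twist χ ρ).IsIrreducible := by
  have := nontrivial_of_isIrreducible hρ
  refine isIrreducible_of_forall fun S hS => eq_bot_or_eq_top_of_isIrreducible hρ S fun g v hv => ?_
  exact (Submodule.smul_mem_iff S (χ g).ne_zero).mp (hS g v hv)

lemma twist_apply (χ : G →* Fˣ) (ρ : Representation F G V) (g : G) (v : V) :
    twist χ ρ g v = (χ g : F) • ρ g v := rfl

variable (K : Type*) [Field K] [Algebra F K]

lemma baseChange_tmul (ρ : Representation F G V) (g : G) (a : K) (v : V) :
    baseChange K ρ g (a ⊗ₜ v) = a ⊗ₜ ρ g v := rfl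

lemma baseChange_twist_apply (ρ : Representation F G V) (χ : G →* Fˣ) (g : G) (x : K ⊗[F] V) :
    baseChange K (twist χ ρ) g x = algebraMap F K (χ g) • baseChange K ρ g x := by
  induction x using TensorProduct.induction_on with
  | zero => simp
  | add x y hx hy => rw [map_add, hx, hy, map_add, smul_add]
  | tmul a v =>
    rw [baseChange_tmul, baseChange_tmul, twist_apply, TensorProduct.tmul_smul,
      algebraMap_smul]

lemma one_tmul_injective : Function.Injective fun v : V => (1 : K) ⊗ₜ[F] v :=
  Module.FaithfullyFlat.tensorProduct_mk_injective V

/-- A nonzero intertwiner with a twist, defined over an extension over which the representation is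
irreducible, gives an isomorphism with the twist over the base field. -/
lemma nonempty_equiv_twist_of_baseChange [FiniteDimensional F V] {ρ : Representation F G V}
    {χ : G →* Fˣ}
    (hρ : (baseChange K ρ).IsIrreducible) (T : K ⊗[F] V →ₗ[K] K ⊗[F] V) (hT0 : T ≠ 0)
    (hT : ∀ g x, T (baseChange K ρ g x) = algebraMap F K (χ g) • baseChange K ρ g (T x)) :
    Nonempty (ρ.Equiv (twist χ ρ)) := by
  obtain ⟨v, hv⟩ : ∃ v : V, T (1 ⊗ₜ v) ≠ 0 := by
    by_contra! hcon
    refine hT0 (LinearMap.ext fun x => ?_)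
    induction x using TensorProduct.induction_on with
    | zero => simp
    | add x y hx hy => rw [map_add, hx, hy, map_add]
    | tmul a v =>
      rw [← mul_one a, ← smul_eq_mul, ← TensorProduct.smul_tmul', map_smul, hcon, smul_zero,
        LinearMap.zero_apply]
  let b := Module.Basis.ofVectorSpace F K
  -- A suitable coordinate of K over F does not kill T(1 ⊗ v). Composing with it gives an F-linear
  -- map S that is still nonzero and still intertwines, because χ has values in F.
  obtain ⟨f, hf⟩ : ∃ f : K →ₗ[F] F, TensorProduct.lid F V (f.rTensor V (T (1 ⊗ₜ v))) ≠ 0 := by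
    classical
    by_contra! hcon
    refine hv ((TensorProduct.equivFinsuppOfBasisLeft b).injective ?_)
    rw [map_zero]
    ext i
    rw [TensorProduct.equivFinsuppOfBasisLeft_apply]
    exact hcon (b.coord i)
  let S : V →ₗ[F] V := (TensorProduct.lid F V).toLinearMap ∘ₗ f.rTensor V ∘ₗ
    (T.restrictScalars F) ∘ₗ TensorProduct.mk F K V 1
  have hfρ : ∀ g (x : K ⊗[F] V), TensorProduct.lid F V (f.rTensor V (baseChange K ρ g x)) =
      ρ g (TensorProduct.lid F V (f.rTensor V x)) := by
    intro g x
    induction x using TensorProduct.induction_on with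
    | zero => simp
    | add x y hx hy => simp only [map_add, hx, hy]
    | tmul a v => simp [baseChange_tmul]
  have hS : ∀ g v, S (ρ g v) = twist χ ρ g (S v) := by
    intro g v
    change TensorProduct.lid F V (f.rTensor V (T (1 ⊗ₜ ρ g v))) = _
    rw [← baseChange_tmul, hT, algebraMap_smul, map_smul, map_smul, hfρ]
    rfl
  have hSK : S.baseChange K ≠ 0 := fun h => by
    have h1 := LinearMap.congr_fun h (1 ⊗ₜ v)
    rw [LinearMap.baseChange_tmul, LinearMap.zero_apply] at h1
    exact hf (one_tmul_injective K (h1.trans (TensorProduct.tmul_zero _ _).symm))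
  have hSKρ : ∀ g x, S.baseChange K (baseChange K ρ g x) =
      algebraMap F K (χ g) • baseChange K ρ g (S.baseChange K x) := by
    intro g x
    rw [← baseChange_twist_apply]
    induction x using TensorProduct.induction_on with
    | zero => simp
    | add x y hx hy => simp only [map_add, hx, hy]
    | tmul a v => rw [baseChange_tmul, LinearMap.baseChange_tmul, LinearMap.baseChange_tmul,
        baseChange_tmul, hS]
  -- The kernel of the extended S is an invariant subspace over K, where irreducibility is
  -- available; injectivity then descends to S.
  have hker : LinearMap.ker (S.baseChange K) = ⊥ := by
    refine (eq_bot_or_eq_top_of_isIrreducible hρ _ fun g x hx => ?_).resolve_right fun h =>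
      hSK (LinearMap.ker_eq_top.mp h)
    rw [LinearMap.mem_ker] at hx ⊢
    rw [hSKρ, hx, map_zero, smul_zero]
  have hinj : Function.Injective S := by
    intro u u' h
    apply one_tmul_injective (F := F) K
    apply LinearMap.ker_eq_bot.mp hker
    rw [LinearMap.baseChange_tmul, LinearMap.baseChange_tmul, h]
  exact nonempty_equiv_of_bijective S hS ⟨hinj, LinearMap.injective_iff_surjective.mp hinj⟩

end Generalities

/-! ### Frobenius orbits of eigenvalues -/

section EigenChain

variable {p : ℕ} {F V : Type*} [Field F] [AddCommGroup V] [Module F V]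

/-- Here A is a tame inertia element and B the inverse of Frobenius. The tame relation AB = BA^p
turns an eigenvalue into its p-th power each time B is applied. -/
lemma chain_eigen {A B : Module.End F V} (hAB : ∀ v, A (B v) = B ((A ^ p) v)) {w : V} {l : F}
    (hw : A w = l • w) (i : ℕ) : A ((B ^ i) w) = l ^ p ^ i • (B ^ i) w := by
  have hpow : ∀ (m : F) (u : V), A u = m • u → ∀ n, (A ^ n) u = m ^ n • u := by
    intro m u hu n
    induction n with
    | zero => simp
    | succ n ih => rw [pow_succ, Module.End.mul_apply, hu, map_smul, ih, smul_smul, ← pow_succ']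
  induction i with
  | zero => simpa using hw
  | succ i ih =>
    rw [pow_succ', Module.End.mul_apply, hAB, hpow _ _ ih p, map_smul, ← pow_mul, ← pow_succ]

/-- The periods of l under Frobenius include 4; together with 4, any period i with 0 < i < 4
generates the period 2. -/
lemma orbit_ne_of_sq_ne {l : F} (h4 : l ^ p ^ 4 = l) (h2 : l ^ p ^ 2 ≠ l) (i : ℕ) (hi : 0 < i)
    (hi4 : i < 4) : l ^ p ^ i ≠ l := by
  intro h
  apply h2
  interval_cases i
  · rw [pow_one] at h
    rw [pow_two, pow_mul, h, h]
  · exact h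
  · calc l ^ p ^ 2 = (l ^ p ^ 4) ^ p ^ 2 := by rw [h4]
      _ = (l ^ p ^ 3) ^ p ^ 3 := by rw [← pow_mul, ← pow_mul]; congr 1; ring
      _ = l := by rw [h, h]

variable [Fact p.Prime] [CharP F p]

lemma frobenius_orbit_injective {l : F} {f : ℕ} (hf : ∀ i, 0 < i → i < f → l ^ p ^ i ≠ l) :
    Function.Injective fun i : Fin f => l ^ p ^ (i : ℕ) := by
  have key : ∀ i j : ℕ, i < j → j < f → l ^ p ^ i ≠ l ^ p ^ j := by
    intro i j hij hj h
    refine hf (j - i) (by omega) (by omega) (iterateFrobenius_inj F p i ?_)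
    rw [iterateFrobenius_def, iterateFrobenius_def, ← pow_mul, ← pow_add,
      Nat.sub_add_cancel hij.le, h]
  intro i j h
  rcases lt_trichotomy (i : ℕ) j with hij | hij | hij
  · exact absurd h (key i j hij j.2)
  · exact Fin.ext hij
  · exact absurd h.symm (key j i hij i.2)

lemma chain_linearIndependent {A B : Module.End F V} (hAB : ∀ v, A (B v) = B ((A ^ p) v))
    (hB : Function.Injective B) {w : V} (hw0 : w ≠ 0) {l : F} (hw : A w = l • w) {f : ℕ}
    (hf : ∀ i, 0 < i → i < f → l ^ p ^ i ≠ l) :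
    LinearIndependent F fun i : Fin f => (B ^ (i : ℕ)) w := by
  refine Module.End.eigenvectors_linearIndependent' A (fun i : Fin f => l ^ p ^ (i : ℕ))
    (frobenius_orbit_injective hf) _ fun i => ?_
  refine Module.End.hasEigenvector_iff.mpr ⟨Module.End.mem_eigenspace_iff.mpr (chain_eigen hAB hw i), ?_⟩
  intro h
  refine hw0 ?_
  have hBi : Function.Injective (B ^ (i : ℕ)) := by
    rw [Module.End.coe_pow]
    exact hB.iterate _
  exact hBi (h.trans (map_zero _).symm)

end EigenChain

/-! ### Induced representations and irreducibility at level four -/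

section Induction

variable {F G : Type*} [Field F] [Group G] {H : Subgroup G} {ψ : H →* Fˣ}

lemma indSpace_apply_mul (f : IndSpace H ψ) {h : G} (hh : h ∈ H) (g : G) :
    f.1 (h * g) = ψ ⟨h, hh⟩ * f.1 g := f.2 ⟨h, hh⟩ g

lemma ind_apply (g : G) (f : IndSpace H ψ) (x : G) : (ind H ψ g f).1 x = f.1 (x * g) := rfl

/-- The element of the induced representation given by an equivariant function. -/
def IndSpace.mk (f : G → F) (hf : ∀ (h : H) (g : G), f (h * g) = ψ h * f g) : IndSpace H ψ := ⟨f, hf⟩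

end Induction

section GaloisInduction

variable {p : ℕ} [Fact p.Prime] {E : Type*} [Field E] [CharP E p] {ι : ZpBar p →+* E}

lemma IsFrobenius.exists_eq_mul_pow {Φ : GalQp p} (hΦ : IsFrobenius ι Φ) {n : ℕ} (hn : 0 < n)
    (g : GalQp p) : ∃ i < n, ∃ h ∈ GalUnram p n, g = h * Φ ^ i := by
  obtain ⟨j, hj⟩ := exists_pow_action n hn g ι
  have h1 : g * (Φ ^ j)⁻¹ ∈ GalUnram p n := by
    rw [mem_galUnram_iff]
    intro z hz
    have hz' : ((Φ ^ j)⁻¹ z) ^ (p ^ n - 1) = 1 := by rw [← map_pow, hz, map_one]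
    rw [AlgEquiv.mul_apply, hj _ hz', ← hΦ.pow_apply_root j (not_dvd_pow_sub_one hn) hz']
    exact (Φ ^ j).apply_symm_apply z
  refine ⟨j % n, Nat.mod_lt _ hn, g * (Φ ^ j)⁻¹ * (Φ ^ n) ^ (j / n),
    Subgroup.mul_mem _ h1 (Subgroup.pow_mem _ (hΦ.pow_mem_galUnram hn) _), ?_⟩
  rw [mul_assoc, ← pow_mul, ← pow_add, Nat.div_add_mod, inv_mul_cancel_right]

variable {n : ℕ} [NeZero n] {ψ : GalUnram p n →* Eˣ}

lemma IsFrobenius.indSpace_ext {Φ : GalQp p} (hΦ : IsFrobenius ι Φ)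
    {f f' : IndSpace (GalUnram p n) ψ} (h : ∀ i < n, f.1 (Φ ^ i) = f'.1 (Φ ^ i)) : f = f' := by
  refine Subtype.ext (funext fun g => ?_)
  obtain ⟨i, hi, u, hu, rfl⟩ := hΦ.exists_eq_mul_pow (Nat.pos_of_ne_zero (NeZero.ne n)) g
  rw [indSpace_apply_mul f hu, indSpace_apply_mul f' hu, h i hi]

/-- Evaluation of induced functions at the powers of a Frobenius. -/
def indEval (Φ : GalQp p) (ψ : GalUnram p n →* Eˣ) :
    IndSpace (GalUnram p n) ψ →ₗ[E] Fin n → E where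
  toFun f i := f.1 (Φ ^ (i : ℕ))
  map_add' _ _ := rfl
  map_smul' _ _ := rfl

lemma IsFrobenius.indEval_injective {Φ : GalQp p} (hΦ : IsFrobenius ι Φ) :
    Function.Injective (indEval Φ ψ) := fun _ _ h =>
  hΦ.indSpace_ext fun i hi => congrFun h ⟨i, hi⟩

lemma IsFrobenius.finite_indSpace {Φ : GalQp p} (hΦ : IsFrobenius ι Φ) :
    FiniteDimensional E (IndSpace (GalUnram p n) ψ) :=
  Module.Finite.of_injective _ (hΦ.indEval_injective (ψ := ψ))

/-- Only the upper bound is needed: at level four the reverse inequality comes from four independent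
eigenvectors. -/
lemma IsFrobenius.finrank_indSpace_le {Φ : GalQp p} (hΦ : IsFrobenius ι Φ) :
    Module.finrank E (IndSpace (GalUnram p n) ψ) ≤ n := by
  have h := LinearMap.finrank_le_finrank_of_injective (hΦ.indEval_injective (ψ := ψ))
  rwa [Module.finrank_fin_fun] at h

/-- Moving τ across Φ^i conjugates it, so on inertia the induced representation is diagonal in the
values at powers of Φ, with the Frobenius conjugates of the inducing character as entries. -/
lemma IsFrobenius.ind_inertia_apply {Φ : GalQp p} (hΦ : IsFrobenius ι Φ) {e : ℕ} {τ : GalQp p}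
    (hτ : τ ∈ inertia ι) {π : QpBar p} (hπ : π ^ (p ^ n - 1) = -(p : QpBar p))
    (f : IndSpace (GalUnram p n) (fundChar p ι n ^ e)) (i : ℕ) :
    (ind (GalUnram p n) (fundChar p ι n ^ e) τ f).1 (Φ ^ i) =
      (resChar ι τ π ^ e) ^ p ^ i * f.1 (Φ ^ i) := by
  have hτn := inertia_le_galUnram (Nat.pos_of_ne_zero (NeZero.ne n)) hτ
  have hc : Φ ^ i * τ * (Φ ^ i)⁻¹ ∈ GalUnram p n := (galUnram_normal n).conj_mem τ hτn _
  have h1 : Φ ^ i * τ = Φ ^ i * τ * (Φ ^ i)⁻¹ * Φ ^ i := by rw [inv_mul_cancel_right]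
  rw [ind_apply, h1, indSpace_apply_mul f hc, MonoidHom.pow_apply,
    fundChar_conj (fun x hx => hΦ.pow_apply i hx) ⟨τ, hτn⟩ hc, Units.val_pow_eq_pow_val,
    Units.val_pow_eq_pow_val, fundChar_apply ι _ hπ, ← pow_mul, ← pow_mul, mul_comm e]

variable [IsAlgClosed E]

/-- A nonzero invariant subspace of an induced representation of level four is everything, and the
dimension is four, when the conjugate characters are distinct. -/
theorem ind_invariant_eq_top (hp2 : Odd p)
    (hE : ∀ a : E, ∃ n, 0 < n ∧ a ^ p ^ n = a) {Φ : GalQp p} (hΦ : IsFrobenius ι Φ) {e : ℕ}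
    (he : ¬ p ^ 4 - 1 ∣ e * (p ^ 2 - 1))
    (S : Submodule E (IndSpace (GalUnram p 4) (fundChar p ι 4 ^ e))) (hS0 : S ≠ ⊥)
    (hS : ∀ g, ∀ v ∈ S, ind (GalUnram p 4) (fundChar p ι 4 ^ e) g v ∈ S) :
    S = ⊤ ∧ Module.finrank E (IndSpace (GalUnram p 4) (fundChar p ι 4 ^ e)) = 4 := by
  have hp : p.Prime := Fact.out
  have hfd := hΦ.finite_indSpace (ψ := fundChar p ι 4 ^ e)
  have hle := hΦ.finrank_indSpace_le (ψ := fundChar p ι 4 ^ e)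
  obtain ⟨z, hz⟩ := exists_primitiveRoot_qpBar (p := p) (pow_sub_one_ne_zero (p := p) four_pos)
  have hN := not_dvd_pow_sub_one (p := p) four_pos
  have hζ := isPrimitiveRoot_red (ι := ι) hN hz
  have hπ := kummerRoot_pow p 4
  obtain ⟨τ, hτ, hτζ⟩ := exists_inertia_resChar_eq hp2 hE hΦ hN hπ hζ.pow_eq_one
  set l : E := red ι z ^ e with hl
  have hl0 : red ι z ≠ 0 := hζ.ne_zero (pow_sub_one_ne_zero four_pos)
  have hl4 : l ^ p ^ 4 = l := by
    rw [hl, ← pow_mul, mul_comm, pow_mul]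
    congr 1
    rw [← Nat.sub_add_cancel (Nat.one_le_pow 4 p hp.pos), pow_succ, hζ.pow_eq_one, one_mul]
  have hl2 : l ^ p ^ 2 ≠ l := by
    intro h
    refine he ((hζ.pow_eq_one_iff_dvd _).mp ?_)
    rw [← Nat.sub_add_cancel (Nat.one_le_pow 2 p hp.pos), pow_succ] at h
    rw [pow_mul, ← hl]
    exact mul_right_cancel₀ (pow_ne_zero _ hl0) (h.trans (one_mul _).symm)
  let ρ := ind (GalUnram p 4) (fundChar p ι 4 ^ e)
  have hAB : ∀ v, ρ τ (ρ Φ⁻¹ v) = ρ Φ⁻¹ ((ρ τ ^ p) v) := by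
    intro v
    have h1 : Φ * τ * Φ⁻¹ ∈ inertia ι := inertia_normal.conj_mem τ hτ Φ
    have h2 : ρ (Φ * τ * Φ⁻¹) v = ρ (τ ^ p) v := by
      refine hΦ.indSpace_ext fun i _ => ?_
      rw [hΦ.ind_inertia_apply h1 hπ, hΦ.ind_inertia_apply ((inertia ι).pow_mem hτ p) hπ,
        hΦ.resChar_conj hτ (ne_zero_of_pow_eq p hπ)]
      have h3 : ∀ k : ℕ, resChar ι (τ ^ k) (kummerRoot p 4) = resChar ι τ (kummerRoot p 4) ^ k := by
        intro k
        have := (inertiaHom ι (ne_zero_of_pow_eq p hπ)).map_pow ⟨τ, hτ⟩ k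
        exact (congrArg Units.val this).trans (Units.val_pow_eq_pow_val _ _)
      rw [h3]
    rw [← map_pow, ← h2, ← Module.End.mul_apply, ← Module.End.mul_apply, ← map_mul, ← map_mul,
      mul_assoc, inv_mul_cancel_left]
  let A : Module.End E S := (ρ τ).restrict (hS τ)
  have hSnt : Nontrivial S := Submodule.nontrivial_iff_ne_bot.mpr hS0
  -- An eigenvector of τ inside S has an eigenvalue with Frobenius orbit of length four. Its
  -- translates by Φ⁻¹ remain in S and are independent, which meets the upper bound for the
  -- dimension.
  obtain ⟨m, hm⟩ := Module.End.exists_eigenvalue (K := E) (V := S) A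
  obtain ⟨⟨w, hwS⟩, hw⟩ := hm.exists_hasEigenvector
  have hw0 : w ≠ 0 := fun h => hw.2 (Subtype.ext h)
  have hAw : ρ τ w = m • w := congrArg Subtype.val hw.apply_eq_smul
  obtain ⟨i, hi, hwi⟩ : ∃ i < 4, w.1 (Φ ^ i) ≠ 0 := by
    by_contra! hcon
    exact hw0 (hΦ.indSpace_ext hcon)
  have hmi : m = l ^ p ^ i := by
    have h1 := congrArg (fun f => f.1 (Φ ^ i)) hAw
    simp only [ρ] at h1
    rw [hΦ.ind_inertia_apply hτ hπ, hτζ] at h1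
    exact (mul_right_cancel₀ hwi h1).symm
  have hm4 : m ^ p ^ 4 = m := by rw [hmi, ← pow_mul, mul_comm, pow_mul, hl4]
  have hm2 : m ^ p ^ 2 ≠ m := by
    intro h
    rw [hmi, ← pow_mul, mul_comm, pow_mul] at h
    exact hl2 (iterateFrobenius_inj E p i h)
  have hBinj : Function.Injective (ρ Φ⁻¹) := by
    intro u v huv
    have h1 := congrArg (ρ Φ) huv
    rwa [← Module.End.mul_apply, ← Module.End.mul_apply, ← map_mul, mul_inv_cancel, map_one] at h1
  have hli := chain_linearIndependent hAB hBinj hw0 hAw (orbit_ne_of_sq_ne hm4 hm2)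
  have hmem : ∀ j : ℕ, ((ρ Φ⁻¹) ^ j) w ∈ S := by
    intro j
    induction j with
    | zero => exact hwS
    | succ j ih =>
      rw [pow_succ', Module.End.mul_apply]
      exact hS _ _ ih
  have h4 : 4 ≤ Module.finrank E S := by
    have h1 : LinearIndependent E fun j : Fin 4 => (⟨((ρ Φ⁻¹) ^ (j : ℕ)) w, hmem j⟩ : S) :=
      LinearIndependent.of_comp S.subtype hli
    simpa using h1.fintype_card_le_finrank
  have h5 := Submodule.finrank_le S
  exact ⟨Submodule.eq_top_of_finrank_eq (by omega), by omega⟩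

/-- The inducing character of level four differs from its conjugate by the square of Frobenius. -/
lemma not_dvd_level_four (hp2 : Odd p) {h : ℕ} (hh : Odd h) :
    ¬ p ^ 4 - 1 ∣ (p ^ 2 + 1) / 2 * h * (p ^ 2 - 1) := by
  have hp : p.Prime := Fact.out
  obtain ⟨s, hs⟩ : 2 ∣ p ^ 2 + 1 := (hp2.pow.add_odd odd_one).two_dvd
  have h1 : 1 ≤ p ^ 2 := Nat.one_le_pow 2 p hp.pos
  have h2 : 2 ≤ p ^ 2 := by nlinarith [hp.two_le]
  -- With s = (p²+1)/2 the divisibility reduces, after cancelling s(p²-1), to 2 ∣ h.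
  have h4 : p ^ 4 - 1 = 2 * (s * (p ^ 2 - 1)) := by
    rw [← mul_assoc, ← hs]
    zify [h1, Nat.one_le_pow 4 p hp.pos]
    ring
  rw [hs, Nat.mul_div_cancel_left _ two_pos, h4]
  have h5 : s * h * (p ^ 2 - 1) = h * (s * (p ^ 2 - 1)) := by ring
  rw [h5]
  have hs0 : 0 < s * (p ^ 2 - 1) := Nat.mul_pos (by omega) (by omega)
  intro hdvd
  exact (Nat.not_even_iff_odd.mpr hh) (even_iff_two_dvd.mpr (Nat.dvd_of_mul_dvd_mul_right hs0 hdvd))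

end GaloisInduction

/-! ### Transport of twists, open kernels and prime-field spans -/

section Generalities

variable {F G V W : Type*} [Field F] [Group G] [AddCommGroup V] [Module F V] [AddCommGroup W]

lemma nonempty_equiv_twist_of_equiv {K : Type*} [Field K] [Algebra F K] [Module K W]
    [FiniteDimensional F V]
    {ρ : Representation F G V} {σ : Representation K G W} (e : (baseChange K ρ).Equiv σ)
    (hσ : σ.IsIrreducible) {χ : G →* Fˣ} (T : W →ₗ[K] W) (hT0 : T ≠ 0)
    (hT : ∀ g x, T (σ g x) = algebraMap F K (χ g) • σ g (T x)) :
    Nonempty (ρ.Equiv (twist χ ρ)) := by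
  obtain ⟨L, hL⟩ : ∃ L : K ⊗[F] V ≃ₗ[K] W, ∀ g x, L (baseChange K ρ g x) = σ g (L x) :=
    ⟨e.toLinearEquiv, equiv_apply_apply e⟩
  refine nonempty_equiv_twist_of_baseChange K (isIrreducible_of_equiv e hσ)
    (L.symm.toLinearMap ∘ₗ T ∘ₗ L.toLinearMap) (fun h => hT0 ?_) ?_
  · ext x
    have h1 := LinearMap.congr_fun h (L.symm x)
    simpa using h1
  · intro g x
    apply L.injective
    rw [map_smul, hL]
    simp only [LinearMap.comp_apply, LinearEquiv.coe_coe, LinearEquiv.apply_symm_apply, hL, hT]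

/-- The stabilizer of a vector. -/
def stab (ρ : Representation F G V) (v : V) : Subgroup G where
  carrier := {g | ρ g v = v}
  one_mem' := by simp
  mul_mem' {a b} ha hb := by
    change ρ (a * b) v = v
    rw [map_mul, Module.End.mul_apply, show ρ b v = v from hb, show ρ a v = v from ha]
  inv_mem' {a} ha := by
    change ρ a⁻¹ v = v
    conv_lhs => rw [← show ρ a v = v from ha]
    rw [← Module.End.mul_apply, ← map_mul, inv_mul_cancel, map_one, Module.End.one_apply]

lemma isSmooth_of_open [TopologicalSpace G] [IsTopologicalGroup G] {ρ : Representation F G V}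
    {U : Subgroup G} (hU : IsOpen (U : Set G)) (h : ∀ u ∈ U, ∀ v, ρ u v = v) : IsSmooth ρ :=
  fun v => Subgroup.isOpen_mono (H₁ := U) (H₂ := stab ρ v) (fun u hu => h u hu v) hU

lemma isOpen_ker_of_isSmooth [TopologicalSpace G] [IsTopologicalGroup G] [FiniteDimensional F V]
    {ρ : Representation F G V} (hρ : IsSmooth ρ) :
    ∃ N : Subgroup G, N.Normal ∧ IsOpen (N : Set G) ∧ ∀ g, g ∈ N ↔ ρ g = 1 := by
  refine ⟨ρ.ker, inferInstance, ?_, fun g => MonoidHom.mem_ker⟩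
  let b := Module.finBasis F V
  have h1 : (ρ.ker : Set G) = ⋂ i, {g | ρ g (b i) = b i} := by
    ext g
    simp only [SetLike.mem_coe, MonoidHom.mem_ker, Set.mem_iInter]
    exact ⟨fun h i => by change ρ g (b i) = b i; rw [h]; rfl, fun h => b.ext h⟩
  rw [h1]
  exact isOpen_iInter_of_finite fun i => hρ (b i)

/-- The span of the image of an `𝔽_p`-vector space of order at most `p ^ n` has dimension at most
`n`. -/
lemma finrank_span_range_le {p : ℕ} [Fact p.Prime] [Module F W] {A : Type*} [AddCommGroup A]
    [Module (ZMod p) A] [Finite A] (φ : A →+ W) {n : ℕ} (hA : Nat.card A ≤ p ^ n) :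
    Module.finrank F (Submodule.span F (Set.range φ)) ≤ n ∧
      Module.Finite F (Submodule.span F (Set.range φ)) := by
  have hfin : Module.Finite (ZMod p) A := Module.Finite.of_finite
  let b := Module.finBasis (ZMod p) A
  have hr : Module.finrank (ZMod p) A ≤ n := by
    have h1 := Module.natCard_eq_pow_finrank (K := ZMod p) (V := A)
    rw [Nat.card_zmod] at h1
    exact (Nat.pow_le_pow_iff_right (Fact.out : p.Prime).one_lt).mp (h1 ▸ hA)
  let s : Fin (Module.finrank (ZMod p) A) → W := fun i => φ (b i)
  have hspan : Submodule.span F (Set.range φ) = Submodule.span F (Set.range s) := by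
    refine le_antisymm (Submodule.span_le.mpr ?_) (Submodule.span_mono ?_)
    · rintro _ ⟨x, rfl⟩
      rw [← b.sum_repr x, map_sum]
      refine Submodule.sum_mem _ fun i _ => ?_
      have h2 : (b.repr x i) • b i = (b.repr x i).val • b i := by
        rw [← Nat.cast_smul_eq_nsmul (ZMod p), ZMod.natCast_zmod_val]
      rw [h2, map_nsmul]
      exact Submodule.smul_of_tower_mem _ _ (Submodule.subset_span ⟨i, rfl⟩)
    · rintro _ ⟨i, rfl⟩
      exact ⟨b i, rfl⟩
  rw [hspan]
  exact ⟨(finrank_range_le_card s).trans (by simpa using hr),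
    Module.Finite.span_of_finite F (Set.finite_range s)⟩

end Generalities

/-! ### A finite Galois-stable set of functions from unramified integers -/

section Model

variable {p : ℕ} [Fact p.Prime]

lemma isOpen_galUnram {n : ℕ} (hn : 0 < n) : IsOpen (GalUnram p n : Set (GalQp p)) := by
  obtain ⟨z, hz⟩ := exists_primitiveRoot_qpBar (p := p) (pow_sub_one_ne_zero (p := p) hn)
  have : NeZero (p ^ n - 1) := ⟨pow_sub_one_ne_zero hn⟩
  refine Subgroup.isOpen_mono (H₁ := MulAction.stabilizer (GalQp p) z) (fun g hg => ?_)
    (isOpen_stabilizer_gal z)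
  rw [mem_galUnram_iff]
  intro x hx
  obtain ⟨i, -, rfl⟩ := hz.eq_pow_of_pow_eq_one hx
  rw [map_pow, show g z = z from hg]

/-- The integers of the unramified extension of degree `n`. -/
def unramifiedIntegers (p : ℕ) [Fact p.Prime] (n : ℕ) : AddSubgroup (QpBar p) where
  carrier := {x | x ∈ unramified p n ∧ ‖x‖ ≤ 1}
  zero_mem' := ⟨zero_mem _, by simp⟩
  add_mem' {a b} ha hb := ⟨add_mem ha.1 hb.1,
    mem_zpBar_iff.mp (add_mem (mem_zpBar_iff.mpr ha.2) (mem_zpBar_iff.mpr hb.2))⟩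
  neg_mem' {a} ha := ⟨neg_mem ha.1, by rw [norm_neg]; exact ha.2⟩

lemma galUnram_apply {n : ℕ} {h : GalQp p} (hh : h ∈ GalUnram p n) {x : QpBar p}
    (hx : x ∈ unramified p n) : h x = x :=
  (IntermediateField.mem_fixingSubgroup_iff _ _).mp hh x hx

lemma galUnram_apply_apply {n : ℕ} {h : GalQp p} (hh : h ∈ GalUnram p n) {x : QpBar p}
    (hx : x ∈ unramified p n) (g : GalQp p) : h (g x) = g x := by
  have h1 := galUnram_apply ((galUnram_normal n).conj_mem' h hh g) hx
  have h2 := congrArg g h1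
  rwa [← AlgEquiv.mul_apply, ← mul_assoc, ← mul_assoc, mul_inv_cancel, one_mul] at h2

lemma mem_unramified_of_fixed {n : ℕ} {x : QpBar p} (h : ∀ g ∈ GalUnram p n, g x = x) :
    x ∈ unramified p n := by
  rw [← InfiniteGalois.fixedField_fixingSubgroup (unramified p n),
    IntermediateField.mem_fixedField_iff]
  exact h

variable {E : Type*} [Field E] {ι : ZpBar p →+* E}

lemma kummer_div_mem_unramified {n : ℕ} {π : QpBar p} (hπ : π ^ (p ^ n - 1) = -(p : QpBar p))
    (g : GalQp p) : g π / π ∈ unramified p n :=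
  IntermediateField.subset_adjoin _ _ (kummer_apply_div_pow hπ g)

lemma resChar_galUnram_mul {n : ℕ} {h : GalQp p} (hh : h ∈ GalUnram p n) (g : GalQp p)
    {π : QpBar p} (hπ0 : π ≠ 0) (hπ : π ^ (p ^ n - 1) = -(p : QpBar p)) :
    resChar ι (h * g) π = resChar ι h π * resChar ι g π := by
  rw [resChar_comp h g hπ0, galUnram_apply hh (kummer_div_mem_unramified hπ g), mul_comm]
  rfl

variable (ι) in
/-- The element of the representation induced from a power of the fundamental character attached
to an integer of the unramified extension. -/
def indOfInteger (n : ℕ) [NeZero n] (e : ℕ) :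
    unramifiedIntegers p n →+ IndSpace (GalUnram p n) (fundChar p ι n ^ e) where
  toFun x := IndSpace.mk (fun g => resChar ι g (kummerRoot p n) ^ e * red ι (g x)) fun h g => by
    have hπ := kummerRoot_pow p n
    rw [resChar_galUnram_mul h.2 g (ne_zero_of_pow_eq p hπ) hπ, AlgEquiv.mul_apply,
      galUnram_apply_apply h.2 x.2.1, MonoidHom.pow_apply, Units.val_pow_eq_pow_val,
      fundChar_apply ι h hπ, mul_pow, mul_assoc]
  map_zero' := by
    refine Subtype.ext (funext fun g => ?_)
    change _ * red ι (g 0) = 0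
    rw [map_zero, red_zero, mul_zero]
  map_add' x y := by
    refine Subtype.ext (funext fun g => ?_)
    change _ * red ι (g (x + y)) = _ * red ι (g x) + _ * red ι (g y)
    rw [map_add, red_add ι (by rw [norm_gal]; exact x.2.2) (by rw [norm_gal]; exact y.2.2), mul_add]

lemma indOfInteger_apply {n : ℕ} [NeZero n] {e : ℕ} (x : unramifiedIntegers p n) (g : GalQp p) :
    (indOfInteger ι n e x).1 g = resChar ι g (kummerRoot p n) ^ e * red ι (g x) := rfl

/-- Galois acts on the integers semilinearly by x ↦ (gπ/π)^e · g x. The factor gπ/π is an unramified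
root of unity, so the result is again an unramified integer. -/
lemma ind_indOfInteger {n : ℕ} [NeZero n] {e : ℕ} (x : unramifiedIntegers p n) (g : GalQp p) :
    ∃ y, ind (GalUnram p n) (fundChar p ι n ^ e) g (indOfInteger ι n e x) =
      indOfInteger ι n e y := by
  have hπ := kummerRoot_pow p n
  have hπ0 := ne_zero_of_pow_eq p hπ
  refine ⟨⟨(g (kummerRoot p n) / kummerRoot p n) ^ e * g x, mul_mem (pow_mem
    (kummer_div_mem_unramified hπ g) e) (mem_unramified_of_fixed fun h hh =>
      galUnram_apply_apply hh x.2.1 g), ?_⟩, ?_⟩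
  · rw [norm_mul, norm_pow, norm_apply_div g hπ0, one_pow, one_mul, norm_gal]
    exact x.2.2
  · refine Subtype.ext (funext fun u => ?_)
    rw [ind_apply, indOfInteger_apply, indOfInteger_apply, resChar_comp u g hπ0, map_mul, map_pow,
      red_mul ι (by rw [norm_pow, norm_gal, norm_apply_div g hπ0, one_pow])
        (by rw [norm_gal, norm_gal]; exact x.2.2),
      red_pow ι (by rw [norm_gal, norm_apply_div g hπ0]), mul_pow, AlgEquiv.mul_apply]
    ring

variable [CharP E p]

/-- A function in the range is determined by its value at 1, the residue of x. Since Φ^n fixes x,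
this residue is a root of X^(p^n) - X. -/
lemma card_range_indOfInteger_le {Φ : GalQp p} (hΦ : IsFrobenius ι Φ) (n : ℕ) [NeZero n] (e : ℕ) :
    Finite (indOfInteger ι n e).range ∧ Nat.card (indOfInteger ι n e).range ≤ p ^ n := by
  classical
  have hn : 0 < n := Nat.pos_of_ne_zero (NeZero.ne n)
  have hq : 1 < p ^ n := Nat.one_lt_pow hn.ne' (Fact.out : p.Prime).one_lt
  let P : Polynomial E := Polynomial.X ^ p ^ n - Polynomial.X
  have hP0 : P ≠ 0 := FiniteField.X_pow_card_sub_X_ne_zero E hq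
  let s : Finset E := P.roots.toFinset
  have hs : s.card ≤ p ^ n := (Multiset.toFinset_card_le _).trans
    ((Polynomial.card_roots' P).trans (FiniteField.X_pow_card_sub_X_natDegree_eq E hq).le)
  have h1 : ∀ x : unramifiedIntegers p n, (indOfInteger ι n e x).1 1 = red ι x := fun x => by
    rw [indOfInteger_apply, AlgEquiv.one_apply, resChar, AlgEquiv.one_apply,
      div_self (ne_zero_of_pow_eq p (kummerRoot_pow p n)), red_one, one_pow, one_mul]
  have hmem : ∀ f : (indOfInteger ι n e).range, f.1.1 1 ∈ s := by
    rintro ⟨_, x, rfl⟩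
    rw [h1, Multiset.mem_toFinset, Polynomial.mem_roots hP0, Polynomial.IsRoot.def]
    simp only [P, Polynomial.eval_sub, Polynomial.eval_pow, Polynomial.eval_X]
    rw [sub_eq_zero, ← hΦ.pow_apply n x.2.2, galUnram_apply (hΦ.pow_mem_galUnram hn) x.2.1]
  let j : (indOfInteger ι n e).range → s := fun f => ⟨f.1.1 1, hmem f⟩
  have hj : Function.Injective j := by
    rintro ⟨_, x, rfl⟩ ⟨_, y, rfl⟩ hxy
    have h2 : red ι x = red ι y := by
      rw [← h1, ← h1]
      exact congrArg Subtype.val hxy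
    refine Subtype.ext (Subtype.ext (funext fun g => ?_))
    change (indOfInteger ι n e x).1 g = (indOfInteger ι n e y).1 g
    rw [indOfInteger_apply, indOfInteger_apply]
    congr 1
    rw [red_eq_red_iff ι x.2.2 y.2.2] at h2
    rwa [red_eq_red_iff ι (by rw [norm_gal]; exact x.2.2) (by rw [norm_gal]; exact y.2.2),
      ← map_sub, norm_gal]
  have hfin : Finite (indOfInteger ι n e).range := Finite.of_injective j hj
  refine ⟨hfin, (Nat.card_le_card_of_injective j hj).trans ?_⟩
  rwa [Nat.card_eq_fintype_card, Fintype.card_coe]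

end Model

/-! ### Intertwiners from conjugation -/

section Conjugation

variable {F G : Type*} [Field F] [Group G] {H : Subgroup G} [H.Normal] {ψ : H →* Fˣ}

/-- If conjugation by `t` twists `ψ` by the restriction of a character of the whole group, then
translation by `t` is an injective intertwiner of the induced representation with its twist. -/
theorem exists_ind_twist_map_of_conj (t : G) (η : G →* Fˣ)
    (hη : ∀ (u : H) (hc : t * u * t⁻¹ ∈ H), ψ ⟨t * u * t⁻¹, hc⟩ = η u * ψ u) :
    ∃ T : IndSpace H ψ →ₗ[F] IndSpace H ψ, Function.Injective T ∧
      ∀ g x, T (ind H ψ g x) = (η g : F) • ind H ψ g (T x) := by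
  have hη0 : ∀ g, (η g : F) ≠ 0 := fun g => (η g).ne_zero
  have hmk : ∀ (f : IndSpace H ψ) (u : H) (g : G),
      (η (u * g) : F)⁻¹ * f.1 (t * (u * g)) = (ψ u : F) * ((η g : F)⁻¹ * f.1 (t * g)) := by
    intro f u g
    have hc : t * u * t⁻¹ ∈ H := Subgroup.Normal.conj_mem inferInstance _ u.2 t
    have h1 : t * (u * g) = t * u * t⁻¹ * (t * g) := by group
    rw [h1, indSpace_apply_mul f hc, hη u hc, map_mul, Units.val_mul, Units.val_mul]
    have := hη0 u
    have := hη0 g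
    field_simp
  refine ⟨{ toFun := fun f => IndSpace.mk (fun g => (η g : F)⁻¹ * f.1 (t * g)) (hmk f)
            map_add' := fun f f' => Subtype.ext (funext fun g => mul_add _ _ _)
            map_smul' := fun a f => Subtype.ext (funext fun g => mul_left_comm _ _ _) }, ?_, ?_⟩
  · intro f f' hff
    refine Subtype.ext (funext fun g => ?_)
    have h1 : (η (t⁻¹ * g) : F)⁻¹ * f.1 (t * (t⁻¹ * g)) =
        (η (t⁻¹ * g) : F)⁻¹ * f'.1 (t * (t⁻¹ * g)) :=
      congrFun (congrArg Subtype.val hff) (t⁻¹ * g)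
    rw [mul_inv_cancel_left] at h1
    exact mul_left_cancel₀ (inv_ne_zero (hη0 _)) h1
  · intro g f
    refine Subtype.ext (funext fun x => ?_)
    change (η x : F)⁻¹ * f.1 (t * x * g) = (η g : F) * ((η (x * g) : F)⁻¹ * f.1 (t * (x * g)))
    rw [map_mul, Units.val_mul, mul_assoc t]
    have := hη0 x
    have := hη0 g
    field_simp

end Conjugation

/-! ### Models over a smaller field -/

section ScalarModel

variable {k E G W : Type*} [Field k] [Field E] [Algebra k E] [Group G] [TopologicalSpace G]
  [IsTopologicalGroup G] [AddCommGroup W] [Module E W] [Module k W] [IsScalarTower k E W]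
  [FiniteDimensional E W]

/-- An irreducible representation of dimension `n` with a nonzero invariant `k`-subspace of
dimension at most `n` has a model over `k`. -/
theorem exists_smooth_model {σ : Representation E G W} (hσ : σ.IsIrreducible) {n : ℕ}
    (hn : Module.finrank E W = n) (M : Submodule k W) (hM0 : M ≠ ⊥) (hMn : Module.finrank k M ≤ n)
    [FiniteDimensional k M] (hMG : ∀ g, M ≤ M.comap ((σ g).restrictScalars k)) {U : Subgroup G}
    (hU : IsOpen (U : Set G))
    (hMU : ∀ u ∈ U, M ≤ LinearMap.eqLocus ((σ u).restrictScalars k) LinearMap.id) :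
    ∃ ρ : Representation k G (Fin n → k), IsSmooth ρ ∧ Nonempty ((baseChange E ρ).Equiv σ) := by
  let L : E ⊗[k] M →ₗ[E] W := LinearMap.liftBaseChange E M.subtype
  have hLt : ∀ (a : E) (v : M), L (a ⊗ₜ v) = a • (v : W) := fun a v =>
    LinearMap.liftBaseChange_tmul _ _ _ _
  let τ : Representation k G M :=
    { toFun := fun g => ((σ g).restrictScalars k).restrict (hMG g)
      map_one' := by ext; simp
      map_mul' := fun g g' => by ext; simp }
  have hτ : ∀ g (v : M), ((τ g v : M) : W) = σ g v := fun _ _ => rfl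
  let β : Representation E G (E ⊗[k] M) := baseChange (F := k) (V := M) E τ
  have hβ : ∀ g (a : E) (v : M), β g (a ⊗ₜ v) = a ⊗ₜ τ g v := fun _ _ _ => rfl
  have hL : ∀ (g : G) (x : E ⊗[k] M), L (β g x) = σ g (L x) := by
    intro g x
    induction x using TensorProduct.induction_on with
    | zero => simp only [map_zero]
    | add x y hx hy => simp only [map_add, hx, hy]
    | tmul a v => rw [hβ, hLt, hLt, map_smul, hτ]
  -- The image of E ⊗ M is invariant and nonzero, hence everything. The bound on dim M then forces L
  -- to be an isomorphism.
  have hLsurj : Function.Surjective L := by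
    rw [← LinearMap.range_eq_top]
    refine (eq_bot_or_eq_top_of_isIrreducible hσ (LinearMap.range L) ?_).resolve_left ?_
    · rintro g _ ⟨x, rfl⟩
      exact ⟨β g x, hL g x⟩
    · intro hbot
      refine hM0 ((Submodule.eq_bot_iff _).mpr fun v hv => ?_)
      have h1 : v ∈ LinearMap.range L := ⟨1 ⊗ₜ ⟨v, hv⟩, by rw [hLt, one_smul]⟩
      rwa [hbot, Submodule.mem_bot] at h1
  have hMeq : Module.finrank k M = n := by
    have h1 := LinearMap.finrank_le_finrank_of_surjective hLsurj
    rw [Module.finrank_baseChange, hn] at h1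
    exact le_antisymm hMn h1
  have hLbij : Function.Bijective L := by
    have h1 : Module.finrank E (E ⊗[k] M) = Module.finrank E W := by
      rw [Module.finrank_baseChange, hMeq, hn]
    exact ⟨(LinearMap.injective_iff_surjective_of_finrank_eq_finrank h1).mpr hLsurj, hLsurj⟩
  let b : M ≃ₗ[k] (Fin n → k) := LinearEquiv.ofFinrankEq _ _ (by rw [hMeq, Module.finrank_fin_fun])
  let ρ : Representation k G (Fin n → k) :=
    { toFun := fun g => b.toLinearMap ∘ₗ τ g ∘ₗ b.symm.toLinearMap
      map_one' := LinearMap.ext fun v => by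
        simp only [map_one, LinearMap.comp_apply, Module.End.one_apply, LinearEquiv.coe_coe,
          LinearEquiv.apply_symm_apply]
      map_mul' := fun g g' => LinearMap.ext fun v => by
        simp only [map_mul, LinearMap.comp_apply, Module.End.mul_apply, LinearEquiv.coe_coe,
          LinearEquiv.symm_apply_apply] }
  have hρ : ∀ g v, ρ g v = b (τ g (b.symm v)) := fun _ _ => rfl
  refine ⟨ρ, isSmooth_of_open hU fun u hu v => ?_, ?_⟩
  · have h1 : τ u (b.symm v) = b.symm v := Subtype.ext (hMU u hu (b.symm v).2)
    rw [hρ, h1, LinearEquiv.apply_symm_apply]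
  let B : E ⊗[k] (Fin n → k) ≃ₗ[E] E ⊗[k] M := b.symm.baseChange k E _ _
  refine nonempty_equiv_of_bijective (L ∘ₗ B.toLinearMap) (fun g x => ?_)
    (hLbij.comp B.bijective)
  have hB : ∀ x, B (baseChange E ρ g x) = β g (B x) := by
    intro x
    induction x using TensorProduct.induction_on with
    | zero => simp only [map_zero]
    | add x y hx hy => simp only [map_add, hx, hy]
    | tmul a v =>
      change a ⊗ₜ b.symm (ρ g v) = a ⊗ₜ τ g (b.symm v)
      rw [hρ, LinearEquiv.symm_apply_apply]
  change L (B (baseChange E ρ g x)) = σ g (L (B x))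
  rw [hB, hL]

end ScalarModel

/-! ### The level-four family: twist invariance and models -/

section LevelFour

variable {p : ℕ} [Fact p.Prime] {E : Type*} [Field E] {ι : ZpBar p →+* E}

lemma fundChar_pow_card {n : ℕ} [NeZero n] (u : GalUnram p n) :
    fundChar p ι n u ^ (p ^ n - 1) = 1 := by
  have hπ := kummerRoot_pow p n
  ext
  rw [Units.val_pow_eq_pow_val, fundChar_apply ι u hπ, resChar,
    ← red_pow ι (norm_apply_div _ (ne_zero_of_pow_eq p hπ)).le, kummer_apply_div_pow hπ, red_one,
    Units.val_one]

lemma nontrivial_indSpace (n : ℕ) [NeZero n] (e : ℕ) :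
    ∃ f : IndSpace (GalUnram p n) (fundChar p ι n ^ e), f ∈ (indOfInteger ι n e).range ∧ f ≠ 0 := by
  refine ⟨_, ⟨⟨1, one_mem _, norm_one.le⟩, rfl⟩, fun h => ?_⟩
  have h1 := congrFun (congrArg Subtype.val h) 1
  rw [indOfInteger_apply, AlgEquiv.one_apply, resChar, AlgEquiv.one_apply,
    div_self (ne_zero_of_pow_eq p (kummerRoot_pow p n)), red_one, one_pow, one_mul] at h1
  exact one_ne_zero h1

/-- The elements attached to integers are fixed by an open subgroup. -/
lemma ind_indOfInteger_eq {n : ℕ} [NeZero n] {e : ℕ} (x : unramifiedIntegers p n) {g : GalQp p}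
    (hg : g ∈ GalUnram p n) (hgπ : g (kummerRoot p n) = kummerRoot p n) :
    ind (GalUnram p n) (fundChar p ι n ^ e) g (indOfInteger ι n e x) = indOfInteger ι n e x := by
  have hπ0 := ne_zero_of_pow_eq p (kummerRoot_pow p n)
  refine Subtype.ext (funext fun u => ?_)
  rw [ind_apply, indOfInteger_apply, indOfInteger_apply, resChar_comp u g hπ0, hgπ, div_self hπ0,
    map_one, red_one, one_mul, AlgEquiv.mul_apply, galUnram_apply hg x.2.1]

variable [CharP E p]

/-- The conjugate by the square of Frobenius of the inducing character is its quadratic twist. -/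
lemma fundChar_pow_sq_level_four (hp2 : Odd p) {h : ℕ} (hh : Odd h) (u : GalUnram p 4) :
    (fundChar p ι 4 u ^ ((p ^ 2 + 1) / 2 * h)) ^ p ^ 2 =
      (cyclo p E ^ ((p - 1) / 2)) (u : GalQp p) * fundChar p ι 4 u ^ ((p ^ 2 + 1) / 2 * h) := by
  have hp : p.Prime := Fact.out
  have hη : (cyclo p E ^ ((p - 1) / 2)) (u : GalQp p) = fundChar p ι 4 u ^ ((p ^ 4 - 1) / 2) := by
    have hπ := kummerRoot_pow p 4
    ext
    rw [cyclo_pow_eq_resChar_pow ι hp2 _ four_ne_zero hπ, Units.val_pow_eq_pow_val,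
      fundChar_apply ι u hπ]
  obtain ⟨s, hs⟩ : 2 ∣ p ^ 2 + 1 := (hp2.pow.add_odd odd_one).two_dvd
  have h1 : 1 ≤ p ^ 2 := Nat.one_le_pow 2 p hp.pos
  have h4 : p ^ 4 - 1 = 2 * (s * (p ^ 2 - 1)) := by
    rw [← mul_assoc, ← hs]
    zify [h1, Nat.one_le_pow 4 p hp.pos]
    ring
  obtain ⟨r, rfl⟩ := hh
  have hc := fundChar_pow_card (ι := ι) u
  rw [h4] at hc
  rw [hη, h4, hs, Nat.mul_div_cancel_left _ two_pos, Nat.mul_div_cancel_left _ two_pos, ← pow_add,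
    ← pow_mul]
  -- With s = (p²+1)/2 and h = 2r+1, shp² - sh = (2r+1)·s(p²-1), where s(p²-1) = (p^4-1)/2. Oddness
  -- of h leaves exactly one half-period, which is the quadratic character.
  have h5 : s * (2 * r + 1) * p ^ 2 =
      2 * (s * (p ^ 2 - 1)) * r + (s * (p ^ 2 - 1) + s * (2 * r + 1)) := by
    zify [h1]
    ring
  rw [h5, pow_add, pow_mul, hc, one_pow, one_mul]

/-- The induced representations of level four under consideration are isomorphic to their quadratic
twists. -/
theorem exists_ind_twist_map (hp2 : Odd p) {Φ : GalQp p} (hΦ : IsFrobenius ι Φ) {h : ℕ}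
    (hh : Odd h) :
    ∃ T : IndSpace (GalUnram p 4) (fundChar p ι 4 ^ ((p ^ 2 + 1) / 2 * h)) →ₗ[E]
        IndSpace (GalUnram p 4) (fundChar p ι 4 ^ ((p ^ 2 + 1) / 2 * h)),
      Function.Injective T ∧ ∀ g x,
        T (ind (GalUnram p 4) (fundChar p ι 4 ^ ((p ^ 2 + 1) / 2 * h)) g x) =
          ((cyclo p E ^ ((p - 1) / 2)) g : E) •
            ind (GalUnram p 4) (fundChar p ι 4 ^ ((p ^ 2 + 1) / 2 * h)) g (T x) := by
  refine exists_ind_twist_map_of_conj (H := GalUnram p 4) (Φ ^ 2) _ fun u hc => ?_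
  rw [MonoidHom.pow_apply, fundChar_conj (fun x hx => hΦ.pow_apply 2 hx) u hc, ← pow_mul,
    mul_comm (p ^ 2), pow_mul, fundChar_pow_sq_level_four hp2 hh u, MonoidHom.pow_apply,
    MonoidHom.pow_apply]

variable [IsAlgClosed E]

theorem isIrreducible_ind (hp2 : Odd p)
    (hE : ∀ a : E, ∃ n, 0 < n ∧ a ^ p ^ n = a) {Φ : GalQp p} (hΦ : IsFrobenius ι Φ) {h : ℕ}
    (hh : Odd h) :
    (ind (GalUnram p 4) (fundChar p ι 4 ^ ((p ^ 2 + 1) / 2 * h))).IsIrreducible := by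
  obtain ⟨f, -, hf⟩ := nontrivial_indSpace (ι := ι) 4 ((p ^ 2 + 1) / 2 * h)
  have : Nontrivial (IndSpace (GalUnram p 4) (fundChar p ι 4 ^ ((p ^ 2 + 1) / 2 * h))) :=
    ⟨f, 0, hf⟩
  refine isIrreducible_of_forall fun S hS => or_iff_not_imp_left.mpr fun hS0 => ?_
  exact (ind_invariant_eq_top hp2 hE hΦ (not_dvd_level_four hp2 hh) S hS0 hS).1

theorem finrank_ind (hp2 : Odd p)
    (hE : ∀ a : E, ∃ n, 0 < n ∧ a ^ p ^ n = a) {Φ : GalQp p} (hΦ : IsFrobenius ι Φ) {h : ℕ}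
    (hh : Odd h) :
    Module.finrank E (IndSpace (GalUnram p 4) (fundChar p ι 4 ^ ((p ^ 2 + 1) / 2 * h))) = 4 := by
  have := nontrivial_of_isIrreducible (isIrreducible_ind hp2 hE hΦ hh)
  exact (ind_invariant_eq_top hp2 hE hΦ (not_dvd_level_four hp2 hh) ⊤ top_ne_bot
    fun _ _ _ => trivial).2

/-- The functions attached to unramified integers form a Galois-stable 𝔽_p-space of order at most
p^4, so over any subfield k of scalars their span has dimension at most four and is the required
form. -/
theorem exists_model (hp2 : Odd p) (hE : ∀ a : E, ∃ n, 0 < n ∧ a ^ p ^ n = a) {Φ : GalQp p}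
    (hΦ : IsFrobenius ι Φ) (k : Type*) [Field k] [Algebra k E] {h : ℕ} (hh : Odd h) :
    ∃ ρ : Representation k (GalQp p) (Fin 4 → k), IsSmooth ρ ∧
      Nonempty ((baseChange E ρ).Equiv
        (ind (GalUnram p 4) (fundChar p ι 4 ^ ((p ^ 2 + 1) / 2 * h)))) := by
  have hirr := isIrreducible_ind hp2 hE hΦ hh
  have h4 := finrank_ind hp2 hE hΦ hh
  generalize (p ^ 2 + 1) / 2 * h = e at hirr h4 ⊢
  have hfd := hΦ.finite_indSpace (ψ := fundChar p ι 4 ^ e)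
  let A := (indOfInteger ι 4 e).range
  obtain ⟨hAfin, hAcard⟩ := card_range_indOfInteger_le hΦ 4 e
  have hpE : ∀ a : A, p • a = 0 := fun a => Subtype.ext <| by
    change p • (a : IndSpace (GalUnram p 4) (fundChar p ι 4 ^ e)) = 0
    rw [← Nat.cast_smul_eq_nsmul E, CharP.cast_eq_zero, zero_smul]
  let modA : Module (ZMod p) A := AddCommGroup.zmodModule hpE
  obtain ⟨hM4, hMfin⟩ := finrank_span_range_le (F := k) A.subtype hAcard
  -- The open subgroup fixing both the unramified field and the root π fixes every function in the
  -- range.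
  have hopen : IsOpen ((GalUnram p 4 ⊓ MulAction.stabilizer (GalQp p) (kummerRoot p 4) :
      Subgroup (GalQp p)) : Set (GalQp p)) :=
    (isOpen_galUnram four_pos).inter (isOpen_stabilizer_gal _)
  refine exists_smooth_model hirr h4 (Submodule.span k (Set.range A.subtype)) ?_ hM4 ?_ hopen ?_
  · obtain ⟨f, hfA, hf⟩ := nontrivial_indSpace (ι := ι) 4 e
    intro hbot
    have h1 : f ∈ Submodule.span k (Set.range A.subtype) := Submodule.subset_span ⟨⟨f, hfA⟩, rfl⟩
    rw [hbot, Submodule.mem_bot] at h1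
    exact hf h1
  · intro g
    refine Submodule.span_le.mpr ?_
    rintro _ ⟨⟨_, x, rfl⟩, rfl⟩
    obtain ⟨y, hy⟩ := ind_indOfInteger (ι := ι) (e := e) x g
    exact Submodule.subset_span ⟨⟨_, y, rfl⟩, hy.symm⟩
  · rintro u ⟨hu, hu'⟩
    refine Submodule.span_le.mpr ?_
    rintro _ ⟨⟨_, x, rfl⟩, rfl⟩
    exact ind_indOfInteger_eq x hu hu'

end LevelFour

/-! ### The family over a finite field -/

section FiniteCoefficients

lemma exists_pow_eq_self_algebraicClosure (p : ℕ) (k : Type*) [Field k] [Finite k] [CharP k p]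
    (a : AlgebraicClosure k) : ∃ n, 0 < n ∧ a ^ p ^ n = a := by
  have ha : IsIntegral k a := Algebra.IsIntegral.isIntegral a
  let L := IntermediateField.adjoin k {a}
  have hfd : FiniteDimensional k L := IntermediateField.adjoin.finiteDimensional ha
  have hfin : Finite L := Module.finite_of_finite k
  have hchar : CharP L p := charP_of_injective_algebraMap (algebraMap k L).injective p
  let hft : Fintype L := Fintype.ofFinite L
  obtain ⟨n, -, hn⟩ := FiniteField.card L p
  refine ⟨n, n.pos, ?_⟩
  have h1 := FiniteField.pow_card (⟨a, IntermediateField.mem_adjoin_simple_self k a⟩ : L)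
  rw [hn] at h1
  exact congrArg Subtype.val h1

variable {p : ℕ} [Fact p.Prime] {k : Type*} [Field k] [Finite k] [CharP k p]
  {ι : ZpBar p →+* AlgebraicClosure k}

theorem exists_model_algebraicClosure (hp2 : Odd p) (ι : ZpBar p →+* AlgebraicClosure k) {h : ℕ}
    (hh : Odd h) :
    ∃ ρ : Representation k (GalQp p) (Fin 4 → k), IsSmooth ρ ∧ IsAbsolutelyIrreducible ρ ∧
      Nonempty (ρ.Equiv (twist (cyclo p k ^ ((p - 1) / 2)) ρ)) ∧
      Nonempty ((baseChange (AlgebraicClosure k) ρ).Equiv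
        (ind (GalUnram p 4) (fundChar p ι 4 ^ ((p ^ 2 + 1) / 2 * h)))) := by
  have hchar : CharP (AlgebraicClosure k) p :=
    charP_of_injective_algebraMap (algebraMap k (AlgebraicClosure k)).injective p
  have hE := exists_pow_eq_self_algebraicClosure p k
  obtain ⟨Φ, hΦ⟩ : ∃ Φ, IsFrobenius ι Φ := exists_frobenius ι hE
  obtain ⟨ρ, hρ, ⟨e⟩⟩ := exists_model hp2 hE hΦ k hh
  have hirr := isIrreducible_ind hp2 hE hΦ hh
  refine ⟨ρ, hρ, isIrreducible_of_equiv e hirr, ?_, ⟨e⟩⟩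
  obtain ⟨T, hT, hTη⟩ := exists_ind_twist_map hp2 hΦ hh
  have hnt := nontrivial_of_isIrreducible hirr
  refine nonempty_equiv_twist_of_equiv e hirr T (fun h0 => ?_) fun g x => ?_
  · obtain ⟨x, hx⟩ := exists_ne (0 : IndSpace (GalUnram p 4)
      (fundChar p ι 4 ^ ((p ^ 2 + 1) / 2 * h)))
    exact hx (hT (by rw [h0, LinearMap.zero_apply, LinearMap.zero_apply]))
  · rw [hTη, MonoidHom.pow_apply, MonoidHom.pow_apply, Units.val_pow_eq_pow_val,
      Units.val_pow_eq_pow_val, map_pow, map_cyclo]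

theorem isAbsolutelyIrreducible_of_equiv_twist_ind (hp2 : Odd p) {V : Type*} [AddCommGroup V]
    [Module k V] [FiniteDimensional k V] {ρ : Representation k (GalQp p) V} {h : ℕ} (hh : Odd h)
    {χ : GalQp p →* (AlgebraicClosure k)ˣ}
    (e : (baseChange (AlgebraicClosure k) ρ).Equiv
      (twist χ (ind (GalUnram p 4) (fundChar p ι 4 ^ ((p ^ 2 + 1) / 2 * h))))) :
    IsAbsolutelyIrreducible ρ ∧ Nonempty (ρ.Equiv (twist (cyclo p k ^ ((p - 1) / 2)) ρ)) := by
  have hchar : CharP (AlgebraicClosure k) p :=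
    charP_of_injective_algebraMap (algebraMap k (AlgebraicClosure k)).injective p
  have hE := exists_pow_eq_self_algebraicClosure p k
  obtain ⟨Φ, hΦ⟩ : ∃ Φ, IsFrobenius ι Φ := exists_frobenius ι hE
  have hirr := isIrreducible_twist χ (isIrreducible_ind hp2 hE hΦ hh)
  refine ⟨isIrreducible_of_equiv e hirr, ?_⟩
  obtain ⟨T, hT, hTη⟩ := exists_ind_twist_map hp2 hΦ hh
  have hnt := nontrivial_of_isIrreducible hirr
  refine nonempty_equiv_twist_of_equiv e hirr T (fun h0 => ?_) fun g x => ?_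
  · obtain ⟨x, hx⟩ := exists_ne (0 : IndSpace (GalUnram p 4)
      (fundChar p ι 4 ^ ((p ^ 2 + 1) / 2 * h)))
    exact hx (hT (by rw [h0, LinearMap.zero_apply, LinearMap.zero_apply]))
  · rw [twist_apply, twist_apply, map_smul, hTη, smul_comm, MonoidHom.pow_apply,
      MonoidHom.pow_apply, Units.val_pow_eq_pow_val, Units.val_pow_eq_pow_val, map_pow, map_cyclo]

end FiniteCoefficients

/-! ### Fixed vectors of normal subgroups and of p-groups -/

section Fixed

variable {F G V W : Type*} [Field F] [Group G] [AddCommGroup V] [Module F V]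

/-- A normal subgroup having a nonzero fixed vector in an irreducible representation acts
trivially. -/
lemma apply_eq_self_of_fixed {ρ : Representation F G V} (hρ : ρ.IsIrreducible) (P : Subgroup G)
    [P.Normal] {v : V} (hv0 : v ≠ 0) (hv : ∀ τ ∈ P, ρ τ v = v) {τ : G} (hτ : τ ∈ P) (x : V) :
    ρ τ x = x := by
  let S : Submodule F V :=
    { carrier := {x | ∀ τ ∈ P, ρ τ x = x}
      zero_mem' := fun τ _ => map_zero _
      add_mem' := fun hx hy τ hτ => by rw [map_add, hx τ hτ, hy τ hτ]
      smul_mem' := fun a x hx τ hτ => by rw [map_smul, hx τ hτ] }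
  have hS : S = ⊤ := by
    refine (eq_bot_or_eq_top_of_isIrreducible hρ S ?_).resolve_left fun h => ?_
    · intro g x hx τ hτ
      have h1 := hx _ (Subgroup.Normal.conj_mem' ‹P.Normal› τ hτ g)
      have h2 : τ * g = g * (g⁻¹ * τ * g) := by group
      rw [← Module.End.mul_apply, ← map_mul, h2, map_mul, Module.End.mul_apply, h1]
    · have h1 : v ∈ S := hv
      rw [h, Submodule.mem_bot] at h1
      exact hv0 h1
  have hx : x ∈ S := hS ▸ Submodule.mem_top
  exact hx τ hτ

/-- A subgroup whose elements have `p`-power order modulo the kernel fixes a nonzero vector of a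
finite representation in characteristic `p`. -/
lemma exists_fixed_of_pow_eq_one {p : ℕ} [Fact p.Prime] [CharP F p] [Finite V] [Nontrivial V]
    (ρ : Representation F G V) (P : Subgroup G) (hP : ∀ τ ∈ P, ∃ a, ρ (τ ^ p ^ a) = 1) :
    ∃ v ≠ 0, ∀ τ ∈ P, ρ τ v = v := by
  let f : G →* (Module.End F V)ˣ := ρ.toHomUnits
  have hf : ∀ g v, f g • v = ρ g v := fun _ _ => rfl
  have hQ : IsPGroup p (P.map f) := by
    rintro ⟨_, τ, hτ, rfl⟩
    obtain ⟨a, ha⟩ := hP τ hτ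
    refine ⟨a, Subtype.ext (Units.ext ?_)⟩
    change ((f τ ^ p ^ a : (Module.End F V)ˣ) : Module.End F V) = 1
    rw [← map_pow]
    exact ha
  have hcard : p ∣ Nat.card V := by
    obtain ⟨v, hv⟩ := exists_ne (0 : V)
    have h1 : addOrderOf v = p := by
      refine addOrderOf_eq_prime ?_ hv
      rw [← Nat.cast_smul_eq_nsmul F, CharP.cast_eq_zero, zero_smul]
    rw [← h1]
    exact addOrderOf_dvd_natCard v
  -- A p-group on a finite set of order divisible by p that fixes 0 must fix another point.
  obtain ⟨v, hv, hv0⟩ := hQ.exists_fixed_point_of_prime_dvd_card_of_fixed_point V hcard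
    (a := 0) (fun q => smul_zero _)
  refine ⟨v, hv0.symm, fun τ hτ => ?_⟩
  exact hv ⟨f τ, Subgroup.mem_map_of_mem f hτ⟩

end Fixed

/-! ### Triviality of wild inertia, tame generators and unramified characters -/

section Tame

variable {p : ℕ} [Fact p.Prime] {E : Type*} [Field E] {ι : ZpBar p →+* E}

/-- Wild inertia acts trivially on an absolutely irreducible smooth representation. -/
theorem wild_apply_eq_self {k V : Type*} [Field k] [Finite k] [CharP k p] [Algebra k E]
    [AddCommGroup V] [Module k V] [FiniteDimensional k V] {ρ : Representation k (GalQp p) V}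
    (hσ : (baseChange E ρ).IsIrreducible) {N : Subgroup (GalQp p)} [N.Normal]
    (hN : IsOpen (N : Set (GalQp p))) (hNρ : ∀ n ∈ N, ρ n = 1) {τ : GalQp p} (hτ : τ ∈ wild N)
    (x : E ⊗[k] V) : baseChange E ρ τ x = x := by
  have hV : Finite V := Module.finite_of_finite k
  have hnt : Nontrivial V := by
    by_contra h
    rw [not_nontrivial_iff_subsingleton] at h
    have := nontrivial_of_isIrreducible hσ
    exact not_subsingleton (E ⊗[k] V) inferInstance
  -- Counting needs a finite space, so the fixed vector is found over k; irreducibility is then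
  -- applied over E.
  obtain ⟨v, hv0, hv⟩ := exists_fixed_of_pow_eq_one (p := p) ρ (wild N) fun τ hτ =>
    (exists_pow_mem_of_mem_wild hN hτ).imp fun a ha => hNρ _ ha
  refine apply_eq_self_of_fixed hσ (wild N) (v := 1 ⊗ₜ v) (fun h => hv0 ?_) (fun τ hτ => ?_) hτ x
  · exact one_tmul_injective E (h.trans (TensorProduct.tmul_zero _ _).symm)
  · rw [baseChange_tmul, hv τ hτ]

variable [CharP E p]

/-- Inertia acts on a representation trivial on wild inertia through a cyclic group. -/
theorem exists_tame_generator (hp2 : Odd p) (hE : ∀ a : E, ∃ n, 0 < n ∧ a ^ p ^ n = a)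
    {Φ : GalQp p} (hΦ : IsFrobenius ι Φ) {W : Type*} [AddCommGroup W] [Module E W]
    {σ : Representation E (GalQp p) W} {N : Subgroup (GalQp p)} [N.Normal]
    (hN : IsOpen (N : Set (GalQp p))) (hwild : ∀ τ ∈ wild N, ∀ x, σ τ x = x) :
    ∃ τ₀ ∈ inertia ι, IsPrimitiveRoot (resChar ι τ₀ (kummerRoot p 4)) (p ^ 4 - 1) ∧
      (∀ τ ∈ inertia ι, ∃ j : ℕ, σ τ = σ τ₀ ^ j ∧
        resChar ι τ (kummerRoot p 4) = resChar ι τ₀ (kummerRoot p 4) ^ j) ∧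
      ∀ v, σ τ₀ (σ Φ⁻¹ v) = σ Φ⁻¹ ((σ τ₀ ^ p) v) := by
  obtain ⟨d, hd, ⟨c, hc⟩, hdw⟩ := exists_tame_level (ι := ι) hN
    (pow_sub_one_ne_zero (p := p) four_pos) (not_dvd_pow_sub_one four_pos)
  have hd0 : d ≠ 0 := by rintro rfl; simp at hd
  have hc0 : 0 < c := Nat.pos_of_ne_zero (by rintro rfl; simp [hc] at hd0)
  have hdd : NeZero d := ⟨hd0⟩
  -- Taking y to be a c-th root of the chosen π makes the level-four tame value the c-th power of
  -- the one at level d, so a single τ₀ controls both.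
  obtain ⟨y, hy⟩ := IsAlgClosed.exists_pow_nat_eq (kummerRoot p 4) hc0
  have hyd : y ^ d = -(p : QpBar p) := by rw [hc, mul_comm, pow_mul, hy, kummerRoot_pow]
  have hy0 := kummer_ne_zero hd0 hyd
  obtain ⟨z, hz⟩ := exists_primitiveRoot_qpBar (p := p) hd0
  have hζ := isPrimitiveRoot_red (ι := ι) hd hz
  obtain ⟨τ₀, hτ₀, hτζ⟩ := exists_inertia_resChar_eq hp2 hE hΦ hd hyd hζ.pow_eq_one
  have hres : ∀ g, resChar ι g (kummerRoot p 4) = resChar ι g y ^ c := fun g => by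
    rw [← hy, resChar_pow g hy0]
  have hroot : ∀ g, resChar ι g y ^ d = 1 := fun g => by
    rw [resChar, ← red_pow ι (norm_apply_div g hy0).le, kummer_apply_div_pow hyd, red_one]
  have hrespow : ∀ j : ℕ, resChar ι (τ₀ ^ j) y = resChar ι τ₀ y ^ j := fun j =>
    (congrArg Units.val ((inertiaHom ι hy0).map_pow ⟨τ₀, hτ₀⟩ j)).trans
      (Units.val_pow_eq_pow_val _ _)
  -- Two inertia elements with the same tame value at level d differ by a wild element, which acts
  -- trivially.
  have key : ∀ τ ∈ inertia ι, ∀ τ' ∈ inertia ι, resChar ι τ y = resChar ι τ' y → σ τ = σ τ' := by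
    intro τ hτ τ' hτ' h
    have h1 : resChar ι (τ * τ'⁻¹) y = 1 := by
      have h2 : inertiaHom ι hy0 (⟨τ, hτ⟩ * ⟨τ', hτ'⟩⁻¹) = 1 := by
        rw [map_mul, map_inv, mul_inv_eq_one]
        exact Units.ext h
      exact congrArg Units.val h2
    have h3 := hwild _ (hdw y hyd _ ((inertia ι).mul_mem hτ ((inertia ι).inv_mem hτ')) h1)
    refine LinearMap.ext fun x => ?_
    rw [← h3 (σ τ' x), ← Module.End.mul_apply, ← map_mul, inv_mul_cancel_right]
  refine ⟨τ₀, hτ₀, ?_, ?_, ?_⟩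
  · rw [hres, hτζ]
    exact hζ.pow (Nat.pos_of_ne_zero hd0) (by rw [hc, mul_comm])
  · intro τ hτ
    obtain ⟨j, -, hj⟩ := hζ.eq_pow_of_pow_eq_one (hroot τ)
    rw [← hτζ, ← hrespow] at hj
    refine ⟨j, ?_, ?_⟩
    · rw [← map_pow]
      exact key _ hτ _ ((inertia ι).pow_mem hτ₀ j) hj.symm
    · rw [hres, hres, ← hj, hrespow, ← pow_mul, ← pow_mul, mul_comm]
  · intro v
    have h1 : σ (Φ * τ₀ * Φ⁻¹) = σ (τ₀ ^ p) :=
      key _ (inertia_normal.conj_mem τ₀ hτ₀ Φ) _ ((inertia ι).pow_mem hτ₀ p)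
        ((hΦ.resChar_conj hτ₀ hy0).trans (hrespow p).symm)
    rw [← map_pow, ← h1, ← Module.End.mul_apply, ← Module.End.mul_apply, ← map_mul, ← map_mul,
      mul_assoc, inv_mul_cancel_left]

/-- Every nonzero scalar is the value at Frobenius of an unramified character. -/
theorem IsFrobenius.exists_unramified_char (hE : ∀ a : E, ∃ n, 0 < n ∧ a ^ p ^ n = a)
    {Φ : GalQp p} (hΦ : IsFrobenius ι Φ) (ν : Eˣ) :
    ∃ (χ : GalQp p →* Eˣ) (n : ℕ), 0 < n ∧ (∀ g ∈ GalUnram p n, χ g = 1) ∧ χ Φ = ν := by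
  obtain ⟨m, hm, hνm⟩ := hE ν
  have hν : ν ^ (p ^ m - 1) = 1 := by
    have h1 : ν ^ p ^ m = ν := Units.ext (by rw [Units.val_pow_eq_pow_val, hνm])
    rw [← Nat.sub_add_cancel (Nat.one_le_pow m p (Fact.out : p.Prime).pos), pow_succ] at h1
    exact mul_eq_right.mp h1
  -- Any multiple of the order of ν serves as the degree of the unramified extension through which χ
  -- will factor.
  set n := p ^ m - 1 with hn
  have hn0 : 0 < n := Nat.pos_of_ne_zero (pow_sub_one_ne_zero hm)
  have hgen : ∀ x : GalQp p ⧸ GalUnram p n,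
      x ∈ Subgroup.zpowers (QuotientGroup.mk' (GalUnram p n) Φ) := by
    intro x
    obtain ⟨g, rfl⟩ := QuotientGroup.mk'_surjective _ x
    obtain ⟨i, -, h, hh, rfl⟩ := hΦ.exists_eq_mul_pow hn0 g
    refine ⟨i, ?_⟩
    change QuotientGroup.mk' (GalUnram p n) Φ ^ (i : ℤ) = _
    rw [zpow_natCast, map_mul, (QuotientGroup.eq_one_iff h).mpr hh |> fun h1 =>
      (show QuotientGroup.mk' (GalUnram p n) h = 1 from h1), one_mul, map_pow]
  -- If Φ^j is trivial on the unramified extension of degree n, it fixes a primitive (p^n-1)-st root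
  -- of unity, so n ∣ j. Thus ν satisfies every relation that Φ does.
  have hord : orderOf ν ∣ orderOf (QuotientGroup.mk' (GalUnram p n) Φ) := by
    refine (orderOf_dvd_of_pow_eq_one hν).trans ?_
    set j := orderOf (QuotientGroup.mk' (GalUnram p n) Φ) with hj
    have h1 : Φ ^ j ∈ GalUnram p n := by
      rw [← QuotientGroup.eq_one_iff]
      change QuotientGroup.mk' (GalUnram p n) (Φ ^ j) = 1
      rw [map_pow, hj, pow_orderOf_eq_one]
    obtain ⟨z, hz⟩ := exists_primitiveRoot_qpBar (p := p) (pow_sub_one_ne_zero (p := p) hn0)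
    have h2 := mem_galUnram_iff.mp h1 z hz.pow_eq_one
    rw [hΦ.pow_apply_root j (not_dvd_pow_sub_one hn0) hz.pow_eq_one,
      ← Nat.sub_add_cancel (Nat.one_le_pow j p (Fact.out : p.Prime).pos), pow_succ] at h2
    have h3 := (mul_eq_right₀ (hz.ne_zero (pow_sub_one_ne_zero hn0))).mp h2
    exact dvd_of_pow_sub_one_dvd (hz.dvd_of_pow_eq_one _ h3)
  refine ⟨(monoidHomOfForallMemZpowers hgen hord).comp (QuotientGroup.mk' (GalUnram p n)), n, hn0,
    fun g hg => ?_, ?_⟩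
  · rw [MonoidHom.comp_apply, show QuotientGroup.mk' (GalUnram p n) g = 1 from
      (QuotientGroup.eq_one_iff g).mpr hg, map_one]
  · exact monoidHomOfForallMemZpowers_apply_gen hgen hord

end Tame

/-! ### Structure of irreducible tame representations -/

section Structure

variable {p : ℕ} [Fact p.Prime] {E : Type*} [Field E] {ι : ZpBar p →+* E}
  {W : Type*} [AddCommGroup W] [Module E W] [FiniteDimensional E W]
  {σ : Representation E (GalQp p) W}

/-- The elements mapping a subspace onto itself. -/
def subspaceStabilizer (σ : Representation E (GalQp p) W) (X : Submodule E W) :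
    Subgroup (GalQp p) where
  carrier := {g | X.map (σ g) = X}
  one_mem' := by
    change X.map (σ 1) = X
    rw [map_one]
    exact Submodule.map_id X
  mul_mem' {a b} ha hb := by
    change X.map (σ (a * b)) = X
    rw [map_mul, Module.End.mul_eq_comp, Submodule.map_comp, show X.map (σ b) = X from hb,
      show X.map (σ a) = X from ha]
  inv_mem' {a} ha := by
    change X.map (σ a⁻¹) = X
    conv_lhs => rw [← show X.map (σ a) = X from ha]
    rw [← Submodule.map_comp, ← Module.End.mul_eq_comp, ← map_mul, inv_mul_cancel, map_one]
    exact Submodule.map_id X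

lemma rep_injective {F G V : Type*} [Field F] [Group G] [AddCommGroup V] [Module F V]
    (ρ : Representation F G V) (g : G) : Function.Injective (ρ g) := by
  intro u v huv
  have h1 := congrArg (ρ g⁻¹) huv
  rwa [← Module.End.mul_apply, ← Module.End.mul_apply, ← map_mul, inv_mul_cancel, map_one] at h1

lemma mem_subspaceStabilizer {X : Submodule E W} {g : GalQp p} (h : ∀ x ∈ X, σ g x ∈ X) :
    g ∈ subspaceStabilizer σ X := by
  change X.map (σ g) = X
  refine Submodule.eq_of_le_of_finrank_eq (Submodule.map_le_iff_le_comap.mpr h) ?_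
  exact (Submodule.equivMapOfInjective (σ g) (rep_injective σ g) X).finrank_eq.symm

variable [CharP E p] [IsAlgClosed E]

/-- An irreducible tame representation has a basis of eigenvectors for a generator of tame inertia
which is permuted by Frobenius up to scalars. -/
theorem exists_eigenbasis (hE : ∀ a : E, ∃ n, 0 < n ∧ a ^ p ^ n = a)
    {Φ : GalQp p} (hΦ : IsFrobenius ι Φ) (hσ : σ.IsIrreducible) {N : Subgroup (GalQp p)}
    (hN : IsOpen (N : Set (GalQp p))) (hNσ : ∀ g ∈ N, ∀ x, σ g x = x) {τ₀ : GalQp p}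
    (hI : ∀ τ ∈ inertia ι, ∃ j : ℕ, σ τ = σ τ₀ ^ j)
    (hAB : ∀ v, σ τ₀ (σ Φ⁻¹ v) = σ Φ⁻¹ ((σ τ₀ ^ p) v)) :
    ∃ (n : ℕ) (b : Module.Basis (Fin n) E W) (l m : E), 0 < n ∧ l ≠ 0 ∧ m ≠ 0 ∧ l ^ p ^ n = l ∧
      (∀ i, 0 < i → i < n → l ^ p ^ i ≠ l) ∧
      (∀ i : Fin n, σ τ₀ (b i) = l ^ p ^ (i : ℕ) • b i) ∧
      ∀ x, (σ Φ⁻¹ ^ n) x = m • x := by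
  classical
  set A := σ τ₀ with hA
  set B := σ Φ⁻¹ with hB
  have hBinj : Function.Injective B := rep_injective σ Φ⁻¹
  have hnt := nontrivial_of_isIrreducible hσ
  obtain ⟨l, hl⟩ := Module.End.exists_eigenvalue (K := E) (V := W) A
  obtain ⟨w₀, hw₀⟩ := hl.exists_hasEigenvector
  have hl0 : l ≠ 0 := by
    rintro rfl
    refine hw₀.2 (rep_injective σ τ₀ ?_)
    rw [map_zero]
    exact hw₀.apply_eq_smul.trans (zero_smul _ _)
  -- The length of the Frobenius orbit of l, which will turn out to be the dimension.
  let n := Nat.find (hE l)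
  have hn : 0 < n ∧ l ^ p ^ n = l := Nat.find_spec (hE l)
  have hmin : ∀ i, 0 < i → i < n → l ^ p ^ i ≠ l := fun i hi hin h =>
    Nat.find_min (hE l) hin ⟨hi, h⟩
  -- Since l^(p^n) = l, the operator B^n preserves the l-eigenspace, so w can be chosen as a common
  -- eigenvector of A and B^n.
  have hstab : ∀ v ∈ Module.End.eigenspace A l, (B ^ n) v ∈ Module.End.eigenspace A l := by
    intro v hv
    rw [Module.End.mem_eigenspace_iff] at hv ⊢
    rw [chain_eigen hAB hv n, hn.2]
  have hnt' : Nontrivial (Module.End.eigenspace A l) :=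
    ⟨⟨w₀, hw₀.1⟩, 0, fun h => hw₀.2 (congrArg Subtype.val h)⟩
  obtain ⟨m, hm⟩ := Module.End.exists_eigenvalue (K := E) ((B ^ n).restrict hstab)
  obtain ⟨⟨w, hwl⟩, hwm⟩ := hm.exists_hasEigenvector
  have hw0 : w ≠ 0 := fun h => hwm.2 (Subtype.ext h)
  have hw : A w = l • w := Module.End.mem_eigenspace_iff.mp hwl
  have hBw : (B ^ n) w = m • w := congrArg Subtype.val hwm.apply_eq_smul
  have hBninj : Function.Injective (B ^ n) := by
    rw [Module.End.coe_pow]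
    exact hBinj.iterate _
  have hm0 : m ≠ 0 := by
    rintro rfl
    rw [zero_smul] at hBw
    exact hw0 (hBninj (hBw.trans (map_zero _).symm))
  let v : Fin n → W := fun i => (B ^ (i : ℕ)) w
  have hli : LinearIndependent E v := chain_linearIndependent hAB hBinj hw0 hw hmin
  let X := Submodule.span E (Set.range v)
  have hXA : ∀ x ∈ X, A x ∈ X := by
    change X ≤ X.comap A
    refine Submodule.span_le.mpr ?_
    rintro _ ⟨i, rfl⟩
    change A ((B ^ (i : ℕ)) w) ∈ X
    rw [chain_eigen hAB hw]
    exact X.smul_mem _ (Submodule.subset_span ⟨i, rfl⟩)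
  have hXB : ∀ x ∈ X, B x ∈ X := by
    change X ≤ X.comap B
    refine Submodule.span_le.mpr ?_
    rintro _ ⟨i, rfl⟩
    change B ((B ^ (i : ℕ)) w) ∈ X
    rw [← Module.End.mul_apply, ← pow_succ']
    rcases (Nat.succ_le_of_lt i.2).lt_or_eq with h | h
    · exact Submodule.subset_span ⟨⟨i + 1, h⟩, rfl⟩
    · rw [show (i : ℕ) + 1 = n from h, hBw]
      exact X.smul_mem _ (Submodule.subset_span ⟨⟨0, hn.1⟩, rfl⟩)
  -- X is stable under A and B only; its stabilizer is open, contains inertia (powers of A) and Φ,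
  -- hence is the whole group.
  have htop : subspaceStabilizer σ X = ⊤ := by
    refine hΦ.eq_top hE (Subgroup.isOpen_mono (H₁ := N) (fun g hg => ?_) hN) (fun τ hτ => ?_) ?_
    · exact mem_subspaceStabilizer fun x hx => by rwa [hNσ g hg]
    · obtain ⟨j, hj⟩ := hI τ hτ
      refine mem_subspaceStabilizer fun x hx => ?_
      rw [hj]
      clear hj
      induction j with
      | zero => exact hx
      | succ j ih =>
        rw [pow_succ', Module.End.mul_apply]
        exact hXA _ ih
    · exact (Subgroup.inv_mem_iff _).mp (mem_subspaceStabilizer hXB)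
  have hX : X = ⊤ := by
    refine (eq_bot_or_eq_top_of_isIrreducible hσ X fun g x hx => ?_).resolve_left fun h => ?_
    · have hg : X.map (σ g) = X := by
        have : g ∈ subspaceStabilizer σ X := htop ▸ Subgroup.mem_top g
        exact this
      exact hg ▸ Submodule.mem_map_of_mem hx
    · have h1 : w ∈ X := Submodule.subset_span ⟨⟨0, hn.1⟩, rfl⟩
      rw [h, Submodule.mem_bot] at h1
      exact hw0 h1
  let b : Module.Basis (Fin n) E W := Module.Basis.mk hli hX.ge
  have hb : ∀ i, b i = (B ^ (i : ℕ)) w := fun i => Module.Basis.mk_apply hli hX.ge i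
  refine ⟨n, b, l, m, hn.1, hl0, hm0, hn.2, hmin, fun i => ?_, fun x => ?_⟩
  · rw [hb]
    exact chain_eigen hAB hw i
  -- B^n commutes with B, so it acts by the same scalar m on every translate of w.
  · have h1 : B ^ n = m • LinearMap.id := b.ext fun i => by
      rw [hb, ← Module.End.mul_apply, ← pow_add, add_comm, pow_add, Module.End.mul_apply, hBw,
        map_smul]
      rfl
    rw [h1]
    rfl

end Structure

/-! ### Eigenvalues opposite to a conjugate -/

section Exponent

variable {p : ℕ} [Fact p.Prime] {E : Type*} [Field E] [CharP E p]

/-- If the opposite of an element is a proper conjugate of it, then it is its conjugate by the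
square of Frobenius. -/
lemma pow_sq_eq_neg (hp2 : Odd p) {l : E} (hl0 : l ≠ 0) (h4 : l ^ p ^ 4 = l)
    (hmin : ∀ i, 0 < i → i < 4 → l ^ p ^ i ≠ l) {i : ℕ} (hi : i < 4) (h : l ^ p ^ i = -l) :
    l ^ p ^ 2 = -l := by
  -- Applying the relation twice makes 2i a period, which excludes i = 1 and i = 3. The case i = 0
  -- would give 2l = 0.
  have h2 : l ^ p ^ (2 * i) = l := by
    rw [two_mul, pow_add, pow_mul, h, hp2.pow.neg_pow, h, neg_neg]
  interval_cases i
  · rw [pow_zero, pow_one] at h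
    have h3 : (2 : E) * l = 0 := by linear_combination h
    have h5 : (2 : E) ≠ 0 := by
      have h6 : ((2 : ℕ) : E) ≠ 0 := by
        rw [Ne, CharP.cast_eq_zero_iff E p]
        intro h7
        have h8 := (Nat.prime_dvd_prime_iff_eq Fact.out Nat.prime_two).mp h7
        rw [h8] at hp2
        exact absurd hp2 (by decide)
      exact_mod_cast h6
    exact absurd ((mul_eq_zero.mp h3).resolve_left h5) hl0
  · exact absurd h2 (hmin 2 (by norm_num) (by norm_num))
  · exact h
  · refine absurd ?_ (hmin 2 (by norm_num) (by norm_num))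
    rw [show 2 * 3 = 4 + 2 by norm_num, pow_add, pow_mul, h4] at h2
    exact h2

/-- The exponent of a tame character of level four that is opposite to its conjugate by the square
of Frobenius. -/
lemma exists_odd_exponent (hp2 : Odd p) {z l : E} (hz : IsPrimitiveRoot z (p ^ 4 - 1))
    (hl0 : l ≠ 0) (h4 : l ^ p ^ 4 = l) (h2 : l ^ p ^ 2 = -l) :
    ∃ h : ℕ, Odd h ∧ 1 ≤ h ∧ h ≤ 2 * (p ^ 2 - 1) ∧ l = z ^ ((p ^ 2 + 1) / 2 * h) := by
  have hp : p.Prime := Fact.out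
  have : NeZero (p ^ 4 - 1) := ⟨pow_sub_one_ne_zero four_pos⟩
  have hpow : ∀ n, l ^ (p ^ n - 1) * l = l ^ p ^ n := fun n => by
    rw [← pow_succ, Nat.sub_add_cancel (Nat.one_le_pow n p hp.pos)]
  have h4' : l ^ (p ^ 4 - 1) = 1 := mul_right_cancel₀ hl0 (by rw [hpow, h4, one_mul])
  have h2' : l ^ (p ^ 2 - 1) = -1 := mul_right_cancel₀ hl0 (by rw [hpow, h2, neg_one_mul])
  obtain ⟨s, hs, rfl⟩ := hz.eq_pow_of_pow_eq_one h4'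
  obtain ⟨c, hc⟩ : 2 ∣ p ^ 2 + 1 := (hp2.pow.add_odd odd_one).two_dvd
  have h1 : 1 ≤ p ^ 2 := Nat.one_le_pow 2 p hp.pos
  have hp4 : p ^ 4 - 1 = 2 * c * (p ^ 2 - 1) := by
    rw [← hc]
    zify [h1, Nat.one_le_pow 4 p hp.pos]
    ring
  have hpos : 0 < p ^ 2 - 1 := Nat.pos_of_ne_zero (pow_sub_one_ne_zero two_pos)
  have hc0 : 0 < c := by omega
  -- From l^(2(p²-1)) = 1 one gets c ∣ s with c = (p²+1)/2. The quotient h is odd because l^(p²-1) =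
  -- -1 is not 1, and s < p^4-1 bounds it.
  have hdvd : p ^ 4 - 1 ∣ 2 * s * (p ^ 2 - 1) := by
    refine hz.dvd_of_pow_eq_one _ ?_
    rw [mul_assoc, mul_comm 2, pow_mul, pow_mul, h2', neg_one_sq]
  rw [hp4] at hdvd
  obtain ⟨h, rfl⟩ : c ∣ s :=
    Nat.dvd_of_mul_dvd_mul_left two_pos (Nat.dvd_of_mul_dvd_mul_right hpos hdvd)
  have hodd : Odd h := by
    rw [← Nat.not_even_iff_odd]
    rintro ⟨r, rfl⟩
    have h5 : (z ^ (c * (r + r))) ^ (p ^ 2 - 1) = 1 := by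
      rw [← pow_mul, show c * (r + r) * (p ^ 2 - 1) = 2 * c * (p ^ 2 - 1) * r by ring, ← hp4,
        pow_mul, hz.pow_eq_one, one_pow]
    rw [h5] at h2'
    have h6 : ((2 : ℕ) : E) = 0 := by
      push_cast
      linear_combination h2'
    rw [CharP.cast_eq_zero_iff E p] at h6
    have h8 := (Nat.prime_dvd_prime_iff_eq hp Nat.prime_two).mp h6
    rw [h8] at hp2
    exact absurd hp2 (by decide)
  refine ⟨h, hodd, hodd.pos, ?_, by rw [hc, Nat.mul_div_cancel_left _ two_pos]⟩
  rw [hp4, mul_comm 2, mul_assoc] at hs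
  exact (Nat.lt_of_mul_lt_mul_left hs).le

end Exponent

/-! ### Frobenius reciprocity and the converse direction -/

section Frobenius

variable {p : ℕ} [Fact p.Prime] {E : Type*} [Field E] {ι : ZpBar p →+* E}
  {W : Type*} [AddCommGroup W] [Module E W] {σ : Representation E (GalQp p) W}

/-- The elements of a subgroup acting on a linear form through a given character. -/
def formStabilizer (σ : Representation E (GalQp p) W) (f : W →ₗ[E] E) (H : Subgroup (GalQp p))
    (θ : H →* Eˣ) : Subgroup (GalQp p) where
  carrier := {g | ∃ hg : g ∈ H, ∀ x, f (σ g x) = θ ⟨g, hg⟩ * f x}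
  one_mem' := ⟨H.one_mem, fun x => by
    rw [map_one, Module.End.one_apply, show (⟨1, H.one_mem⟩ : H) = 1 from rfl, map_one,
      Units.val_one, one_mul]⟩
  mul_mem' := by
    rintro a b ⟨ha, ha'⟩ ⟨hb, hb'⟩
    refine ⟨H.mul_mem ha hb, fun x => ?_⟩
    rw [map_mul, Module.End.mul_apply, ha', hb', ← mul_assoc, ← Units.val_mul, ← map_mul]
    rfl
  inv_mem' := by
    rintro a ⟨ha, ha'⟩
    refine ⟨H.inv_mem ha, fun x => ?_⟩
    have h1 := ha' (σ a⁻¹ x)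
    rw [← Module.End.mul_apply, ← map_mul, mul_inv_cancel, map_one, Module.End.one_apply] at h1
    rw [h1, show (⟨a⁻¹, H.inv_mem ha⟩ : H) = ⟨a, ha⟩⁻¹ from rfl, map_inv θ, ← mul_assoc,
      Units.inv_mul, one_mul]

/-- Frobenius reciprocity for a character of a subgroup that is the twist by a character of the
group. -/
lemma nonempty_equiv_twist_ind {G W' : Type*} [Group G] [AddCommGroup W'] [Module E W']
    {σ : Representation E G W'} (hσ : σ.IsIrreducible) {H : Subgroup G} {ψ : H →* Eˣ}
    {χ : G →* Eˣ} (f : W' →ₗ[E] E) (hf0 : f ≠ 0)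
    (hf : ∀ (u : H) x, f (σ u x) = (χ u : E) * (ψ u : E) * f x)
    [FiniteDimensional E W'] [FiniteDimensional E (IndSpace H ψ)]
    (hdim : Module.finrank E (IndSpace H ψ) ≤ Module.finrank E W') :
    Nonempty (σ.Equiv (twist χ (ind H ψ))) := by
  have hχ : ∀ g, (χ g : E) ≠ 0 := fun g => (χ g).ne_zero
  -- The reciprocity map x ↦ (g ↦ χ(g)⁻¹ f(σ(g)x)); the factor χ⁻¹ removes χ from the transformation
  -- rule of f.
  let L : W' →ₗ[E] IndSpace H ψ :=
    { toFun := fun x => IndSpace.mk (fun g => (χ g : E)⁻¹ * f (σ g x)) fun u g => by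
        rw [map_mul, map_mul, Module.End.mul_apply, hf, Units.val_mul]
        have := hχ u
        have := hχ g
        field_simp
      map_add' := fun x y => Subtype.ext (funext fun g => by
        change (χ g : E)⁻¹ * f (σ g (x + y)) = (χ g : E)⁻¹ * f (σ g x) + (χ g : E)⁻¹ * f (σ g y)
        rw [map_add, map_add, mul_add])
      map_smul' := fun a x => Subtype.ext (funext fun g => by
        change (χ g : E)⁻¹ * f (σ g (a • x)) = a * ((χ g : E)⁻¹ * f (σ g x))
        rw [map_smul, map_smul, smul_eq_mul, mul_left_comm]) }
  have hLa : ∀ x g, (L x).1 g = (χ g : E)⁻¹ * f (σ g x) := fun _ _ => rfl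
  have hL : ∀ g x, L (σ g x) = twist χ (ind H ψ) g (L x) := fun g x =>
    Subtype.ext (funext fun u => by
      change (χ u : E)⁻¹ * f (σ u (σ g x)) = (χ g : E) * ((χ (u * g) : E)⁻¹ * f (σ (u * g) x))
      rw [← Module.End.mul_apply, ← map_mul, map_mul χ, Units.val_mul]
      have := hχ u
      have := hχ g
      field_simp)
  have hker : LinearMap.ker L = ⊥ := by
    refine (eq_bot_or_eq_top_of_isIrreducible hσ _ fun g x hx => ?_).resolve_right fun h => ?_
    · rw [LinearMap.mem_ker] at hx ⊢
      rw [hL, hx, map_zero]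
    · refine hf0 (LinearMap.ext fun x => ?_)
      have h1 : L x = 0 := LinearMap.mem_ker.mp (h ▸ Submodule.mem_top)
      have h2 := hLa x 1
      rw [h1, map_one, map_one, Units.val_one, inv_one, one_mul, Module.End.one_apply] at h2
      exact h2.symm
  have hinj := LinearMap.ker_eq_bot.mp hker
  have heq := le_antisymm (LinearMap.finrank_le_finrank_of_injective hinj) hdim
  exact nonempty_equiv_of_bijective L hL
    ⟨hinj, (LinearMap.injective_iff_surjective_of_finrank_eq_finrank heq).mp hinj⟩

variable [CharP E p] [IsAlgClosed E] [FiniteDimensional E W]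

/-- A four-dimensional irreducible tame representation isomorphic to its quadratic twist is induced,
up to an unramified twist. -/
theorem exists_equiv_twist_ind (hp2 : Odd p) (hE : ∀ a : E, ∃ n, 0 < n ∧ a ^ p ^ n = a)
    {Φ : GalQp p} (hΦ : IsFrobenius ι Φ) (hσ : σ.IsIrreducible) (hσ4 : Module.finrank E W = 4)
    {N : Subgroup (GalQp p)} [N.Normal] (hN : IsOpen (N : Set (GalQp p)))
    (hNσ : ∀ g ∈ N, ∀ x, σ g x = x) (hwild : ∀ τ ∈ wild N, ∀ x, σ τ x = x)
    (T : W ≃ₗ[E] W)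
    (hT : ∀ g x, T (σ g x) = ((cyclo p E ^ ((p - 1) / 2)) g : E) • σ g (T x)) :
    ∃ (χ : GalQp p →* Eˣ) (h : ℕ), IsSmoothChar χ ∧ Odd h ∧ 1 ≤ h ∧ h ≤ 2 * (p ^ 2 - 1) ∧
      Nonempty (σ.Equiv
        (twist χ (ind (GalUnram p 4) (fundChar p ι 4 ^ ((p ^ 2 + 1) / 2 * h))))) := by
  have hp : p.Prime := Fact.out
  have hπ := kummerRoot_pow p 4
  obtain ⟨τ₀, hτ₀, hz, hI, hAB⟩ := exists_tame_generator hp2 hE hΦ hN hwild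
  obtain ⟨n, b, l, m, hn0, hl0, hm0, hln, hmin, hb, hBn⟩ :=
    exists_eigenbasis hE hΦ hσ hN hNσ (fun τ hτ => (hI τ hτ).imp fun _ h => h.1) hAB
  obtain rfl : n = 4 := by rw [← hσ4, Module.finrank_eq_card_basis b, Fintype.card_fin]
  set z := resChar ι τ₀ (kummerRoot p 4) with hzdef
  -- The value is a primitive (p^4-1)-st root of unity raised to half its order.
  have hη : ((cyclo p E ^ ((p - 1) / 2)) τ₀ : E) = -1 := by
    rw [cyclo_pow_eq_resChar_pow ι hp2 τ₀ four_ne_zero hπ, ← hzdef]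
    have heven : 2 ∣ p ^ 4 - 1 := (Nat.Odd.sub_odd hp2.pow odd_one).two_dvd
    have h1 := hz.pow_of_dvd (p := (p ^ 4 - 1) / 2)
      (Nat.div_pos (Nat.le_of_dvd (Nat.pos_of_ne_zero (pow_sub_one_ne_zero four_pos)) heven)
        two_pos).ne' (Nat.div_dvd_of_dvd heven)
    rw [Nat.div_div_self heven (pow_sub_one_ne_zero four_pos)] at h1
    exact h1.eq_neg_one_of_two_right
  have hcoord : ∀ i x, b.coord i (σ τ₀ x) = l ^ p ^ (i : ℕ) * b.coord i x := by
    intro i x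
    have h1 : b.coord i ∘ₗ σ τ₀ = l ^ p ^ (i : ℕ) • b.coord i := b.ext fun j => by
      rw [LinearMap.comp_apply, hb, map_smul, LinearMap.smul_apply, Module.Basis.coord_apply,
        Module.Basis.repr_self_apply]
      split_ifs with hij
      · rw [hij]
      · rw [smul_zero, smul_zero]
    exact LinearMap.congr_fun h1 x
  -- T sends the l-eigenvector of τ₀ to a (-l)-eigenvector. A nonzero coordinate of it identifies -l
  -- with one of the four conjugates of l.
  have hl2 : l ^ p ^ 2 = -l := by
    have h1 : σ τ₀ (T (b 0)) = -l • T (b 0) := by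
      have h2 := hT τ₀ (b 0)
      rw [hb, hη, Fin.val_zero, pow_zero, pow_one, map_smul, neg_one_smul] at h2
      rw [neg_smul, h2, neg_neg]
    have h3 : T (b 0) ≠ 0 := fun h => b.ne_zero 0 (T.injective (h.trans (map_zero T).symm))
    obtain ⟨i, hi⟩ : ∃ i, b.coord i (T (b 0)) ≠ 0 := by
      by_contra! hcon
      exact h3 ((Module.Basis.forall_coord_eq_zero_iff b).mp hcon)
    have h4 := hcoord i (T (b 0))
    rw [h1, map_smul, smul_eq_mul] at h4
    exact pow_sq_eq_neg hp2 hl0 hln hmin i.2 (mul_right_cancel₀ hi h4).symm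
  obtain ⟨h, hodd, hh1, hh2, hlz⟩ := exists_odd_exponent hp2 hz hl0 hln hl2
  have hΦ4 := hΦ.pow_mem_galUnram (m := 4) four_pos
  let ψ := fundChar p ι 4 ^ ((p ^ 2 + 1) / 2 * h)
  -- Φ^4 acts by m⁻¹, because (Φ⁻¹)^4 acts by m; ν is chosen so that ν^4·ψ(Φ^4) = m⁻¹.
  obtain ⟨ν, hν⟩ := IsAlgClosed.exists_pow_nat_eq (m⁻¹ * (ψ ⟨Φ ^ 4, hΦ4⟩ : E)⁻¹) four_pos
  have hν0 : ν ≠ 0 := by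
    rintro rfl
    rw [zero_pow four_ne_zero] at hν
    exact mul_ne_zero (inv_ne_zero hm0) (inv_ne_zero (Units.ne_zero _)) hν.symm
  obtain ⟨χ, r, hr, hχ, hχΦ⟩ := hΦ.exists_unramified_char hE (Units.mk0 ν hν0)
  let θ : GalUnram p 4 →* Eˣ := χ.comp (GalUnram p 4).subtype * ψ
  have hθ : ∀ u : GalUnram p 4, (θ u : E) = χ u * ψ u := fun _ => rfl
  have hψ : ∀ u : GalUnram p 4, (ψ u : E) =
      resChar ι u (kummerRoot p 4) ^ ((p ^ 2 + 1) / 2 * h) := fun u => by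
    rw [MonoidHom.pow_apply, Units.val_pow_eq_pow_val, fundChar_apply ι u hπ]
  have hpowcoord : ∀ (j : ℕ) x, b.coord 0 ((σ τ₀ ^ j) x) = l ^ j * b.coord 0 x := by
    intro j x
    induction j with
    | zero => rw [pow_zero, pow_zero, one_mul, Module.End.one_apply]
    | succ j ih =>
      rw [pow_succ', Module.End.mul_apply, hcoord, Fin.val_zero, pow_zero, pow_one, ih, pow_succ',
        mul_assoc]
  -- The form `b.coord 0` transforms through χψ: this is checked on an open subgroup, on inertia and
  -- on Φ^4, which together exhaust the unramified subgroup.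
  have hle : GalUnram p 4 ≤ formStabilizer σ (b.coord 0) (GalUnram p 4) θ := by
    refine hΦ.galUnram_le hE ?_ ?_ four_pos ?_
    · refine Subgroup.isOpen_mono (H₁ := N ⊓ GalUnram p r ⊓ GalUnram p 4 ⊓
        MulAction.stabilizer (GalQp p) (kummerRoot p 4)) ?_
        (((hN.inter (isOpen_galUnram hr)).inter (isOpen_galUnram four_pos)).inter
          (isOpen_stabilizer_gal _))
      rintro g ⟨⟨⟨hgN, hgr⟩, hg4⟩, hgπ⟩
      refine ⟨hg4, fun x => ?_⟩
      rw [hNσ g hgN, hθ, hψ, hχ g hgr, resChar, show g (kummerRoot p 4) = kummerRoot p 4 from hgπ,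
        div_self (ne_zero_of_pow_eq p hπ), red_one, one_pow, Units.val_one, one_mul, one_mul]
    · intro τ hτ
      obtain ⟨j, hj, hjz⟩ := hI τ hτ
      refine ⟨inertia_le_galUnram four_pos hτ, fun x => ?_⟩
      rw [hj, hpowcoord, hθ, hψ, hjz, hχ τ (inertia_le_galUnram hr hτ), Units.val_one, one_mul, hlz,
        ← pow_mul, ← pow_mul, mul_comm j]
    · refine ⟨hΦ4, fun x => ?_⟩
      have h1 : x = m • σ (Φ ^ 4) x := by
        rw [← hBn, ← map_pow, ← Module.End.mul_apply, ← map_mul, inv_pow, inv_mul_cancel, map_one,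
          Module.End.one_apply]
      have h2 : ((χ (Φ ^ 4) : Eˣ) : E) = ν ^ 4 := by
        rw [map_pow, hχΦ, Units.val_pow_eq_pow_val, Units.val_mk0]
      conv_rhs => rw [h1]
      rw [hθ, h2, hν, map_smul, smul_eq_mul]
      have := (ψ ⟨Φ ^ 4, hΦ4⟩).ne_zero
      field_simp
  have hfd := hΦ.finite_indSpace (ψ := ψ)
  refine ⟨χ, h, isSmoothChar_of_eq_one (isOpen_galUnram hr) hχ, hodd, hh1, hh2,
    nonempty_equiv_twist_ind hσ (b.coord 0) (fun h0 => ?_) (fun u x => ?_) ?_⟩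
  · have h1 := LinearMap.congr_fun h0 (b 0)
    rw [Module.Basis.coord_apply, Module.Basis.repr_self, Finsupp.single_eq_same,
      LinearMap.zero_apply] at h1
    exact one_ne_zero h1
  · obtain ⟨_, hu⟩ := hle u.2
    exact (hu x).trans (by rw [hθ])
  · rw [hσ4]
    exact hΦ.finrank_indSpace_le (ψ := ψ)

end Frobenius

/-! ### The converse over a finite field -/

section FiniteCoefficients

variable {p : ℕ} [Fact p.Prime] {k : Type*} [Field k] [Finite k] [CharP k p]

theorem exists_equiv_twist_ind_of_isAbsolutelyIrreducible (hp2 : Odd p)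
    (ι : ZpBar p →+* AlgebraicClosure k) {V : Type*} [AddCommGroup V]
    [Module k V] {ρ : Representation k (GalQp p) V} (h4 : Module.finrank k V = 4)
    (hρ : IsSmooth ρ) (hirr : IsAbsolutelyIrreducible ρ)
    (e : ρ.Equiv (twist (cyclo p k ^ ((p - 1) / 2)) ρ)) :
    ∃ (χ : GalQp p →* (AlgebraicClosure k)ˣ) (h : ℕ), IsSmoothChar χ ∧ Odd h ∧ 1 ≤ h ∧
      h ≤ 2 * (p ^ 2 - 1) ∧ Nonempty ((baseChange (AlgebraicClosure k) ρ).Equiv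
        (twist χ (ind (GalUnram p 4) (fundChar p ι 4 ^ ((p ^ 2 + 1) / 2 * h))))) := by
  have hchar : CharP (AlgebraicClosure k) p :=
    charP_of_injective_algebraMap (algebraMap k (AlgebraicClosure k)).injective p
  have hE := exists_pow_eq_self_algebraicClosure p k
  obtain ⟨Φ, hΦ⟩ : ∃ Φ, IsFrobenius ι Φ := exists_frobenius ι hE
  have hfd : FiniteDimensional k V := Module.finite_of_finrank_pos (by rw [h4]; exact four_pos)
  obtain ⟨N, hNn, hN, hNρ⟩ := isOpen_ker_of_isSmooth hρ
  have hNσ : ∀ g ∈ N, ∀ x, baseChange (AlgebraicClosure k) ρ g x = x := by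
    intro g hg x
    induction x using TensorProduct.induction_on with
    | zero => rw [map_zero]
    | add x y hx hy => rw [map_add, hx, hy]
    | tmul a v => rw [baseChange_tmul, (hNρ g).mp hg, Module.End.one_apply]
  have h4' : Module.finrank (AlgebraicClosure k) (AlgebraicClosure k ⊗[k] V) = 4 := by
    rw [Module.finrank_baseChange, h4]
  refine exists_equiv_twist_ind hp2 hE hΦ hirr h4' hN hNσ
    (fun τ hτ x => wild_apply_eq_self hirr hN (fun n hn => (hNρ n).mp hn) hτ x)
    (e.toLinearEquiv.baseChange k (AlgebraicClosure k) V V) fun g x => ?_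
  have h1 : ((cyclo p (AlgebraicClosure k) ^ ((p - 1) / 2)) g : AlgebraicClosure k) =
      algebraMap k _ ((cyclo p k ^ ((p - 1) / 2)) g : kˣ) := by
    rw [MonoidHom.pow_apply, MonoidHom.pow_apply, Units.val_pow_eq_pow_val,
      Units.val_pow_eq_pow_val, map_pow, map_cyclo]
  rw [h1, ← baseChange_twist_apply]
  induction x using TensorProduct.induction_on with
  | zero => simp only [map_zero]
  | add x y hx hy => simp only [map_add, hx, hy]
  | tmul a v =>
    rw [baseChange_tmul]
    change a ⊗ₜ e.toLinearEquiv (ρ g v) = a ⊗ₜ twist _ ρ g (e.toLinearEquiv v)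
    rw [equiv_apply_apply]

end FiniteCoefficients

end ModpGalois

end

theorem mainTheorem9 (p : ℕ) [Fact p.Prime] (hp : Odd p)
    (k : Type*) [Field k] [Finite k] [CharP k p]
    (ι : ModpGalois.ZpBar p →+* AlgebraicClosure k) :
    -- the representations `Ind (ω_4 ^ ((p ^ 2 + 1) / 2 * h))` are four-dimensional, smooth, have a
    -- model over `k`, and this model is absolutely irreducible and invariant under the twist
    (∀ h : ℕ, Odd h → 1 ≤ h → h ≤ 2 * (p ^ 2 - 1) →
      ∃ ρ : Representation k (ModpGalois.GalQp p) (Fin 4 → k),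
        ModpGalois.IsSmooth ρ ∧
        ModpGalois.IsAbsolutelyIrreducible ρ ∧
        Nonempty (ρ.Equiv (ModpGalois.twist (ModpGalois.cyclo p k ^ ((p - 1) / 2)) ρ)) ∧
        Nonempty ((ModpGalois.baseChange (AlgebraicClosure k) ρ).Equiv
          (ModpGalois.ind (ModpGalois.GalUnram p 4)
            (ModpGalois.fundChar p ι 4 ^ ((p ^ 2 + 1) / 2 * h))))) ∧
    -- up to twist by a character, there are no others
    (∀ (V : Type*) [AddCommGroup V] [Module k V] (ρ : Representation k (ModpGalois.GalQp p) V),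
      Module.finrank k V = 4 → ModpGalois.IsSmooth ρ →
      ((ModpGalois.IsAbsolutelyIrreducible ρ ∧
          Nonempty (ρ.Equiv (ModpGalois.twist (ModpGalois.cyclo p k ^ ((p - 1) / 2)) ρ))) ↔
        ∃ (χ : ModpGalois.GalQp p →* (AlgebraicClosure k)ˣ) (h : ℕ),
          ModpGalois.IsSmoothChar χ ∧ Odd h ∧ 1 ≤ h ∧ h ≤ 2 * (p ^ 2 - 1) ∧
          Nonempty ((ModpGalois.baseChange (AlgebraicClosure k) ρ).Equiv
            (ModpGalois.twist χ (ModpGalois.ind (ModpGalois.GalUnram p 4)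
              (ModpGalois.fundChar p ι 4 ^ ((p ^ 2 + 1) / 2 * h))))))) := by
  refine ⟨fun h hh _ _ => ModpGalois.exists_model_algebraicClosure hp ι hh,
    fun V _ _ ρ h4 hρ => ⟨fun ⟨hirr, ⟨e⟩⟩ =>
      ModpGalois.exists_equiv_twist_ind_of_isAbsolutelyIrreducible hp ι h4 hρ hirr e, ?_⟩⟩
  rintro ⟨χ, h, -, hh, -, -, ⟨e⟩⟩
  have hfd : FiniteDimensional k V := Module.finite_of_finrank_pos (by rw [h4]; exact four_pos)
  exact ModpGalois.isAbsolutelyIrreducible_of_equiv_twist_ind hp hh e
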